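/- Let $d, L, r \in \mathbb{N}$ with $d \ge 1$, $L \geq 2$, $r \geq 2d$, let $c_1, c_2, c_3, c_4 > 0$ be constants, let $0 < \tau < 1/(d+1)$, and let $\sigma(x) = 1/(1+e^{-x})$ be the logistic squasher. **Network.** For $K \in \mathbb{N}$ and a weight vector $\mathbf{w} = (w_{k,i,j}^{(l)})$ put $$f_{\mathbf{w}}(x) = \sum_{k=1}^{K} w_{1,1,k}^{(L)} \cdot f_{k,1}^{(L)}(x) \qquad (x \in \mathbb{R}^d),$$ where, for $k = 1, \dots, K$ and $i = 1, \dots, r$, $$f_{k,i}^{(l)}(x) = \sigma\Big(\sum_{j=1}^{r} w_{k,i,j}^{(l-1)} f_{k,j}^{(l-1)}(x) + w_{k,i,0}^{(l-1)}\Big) \quad (l = 2, \dots, L), \qquad f_{k,i}^{(1)}(x) = \sigma\Big(\sum_{j=1}^{d} w_{k,i,j}^{(0)} x^{(j)} + w_{k,i,0}^{(0)}\Big).$$ **Data.** Let $(X,Y)$ be an $\mathbb{R}^d \times \mathbb{R}$-valued random vector with $\mathbf{E} Y^2 < \infty$, let $m(x) = \mathbf{E}\{Y \mid X = x\}$ be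 its regression function, and let $(X_1,Y_1), (X_2,Y_2), \dots$ be independent with the same distribution as $(X,Y)$. **Parameters.** Let $K_n \in \mathbb{N}$ and $L_n > 0$ be such that, for some $\kappa > 0$, $$\frac{K_n}{n^{\kappa}} \to 0, \qquad \frac{K_n}{n^{r} \log n} \to \infty \qquad (n \to \infty), \qquad L_n \geq (\log n)^{10 L + 10} \cdot K_n^{3/2},$$ and set $$\alpha_n = c_1 \log n, \qquad \beta_n = c_3 \log n, \qquad \lambda_n = \frac{1}{L_n}, \qquad t_n = \lceil c_4 \cdot L_n \cdot \log n \rceil.$$ **Estimate.** For sample size $n$ (and $K = K_n$) choose the initial weight vector $\mathbf{w}^{(0)}$ at random, independently of the data, with $w_{1,1,k}^{(L)} = 0$ for all $k$ and with all other weights independent, where the weights $w_{k,i,j}^{(l)}$ with $1 \leq l < L$ are uniformly distributed on $[-20 d (\log n)^2, 20 d (\log n)^2]$ and the weights $w_{k,i,j}^{(0)}$ are uniformly distributed on $[-n^{\tau}, n^{\tau}]$. Perform $t_n$ gradient descent steps $$\mathbf{w}^{(t+1)} = \mathbf{w}^{(t)} - \lambda_n \cdot (\nabla_{\mathbf{w}}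 F_n)(\mathbf{w}^{(t)}) \qquad (t = 0, \dots, t_n - 1)$$ on the regularised empirical $L_2$ risk $$F_n(\mathbf{w}) = \frac1n \sum_{i=1}^n |f_{\mathbf{w}}(X_i) - Y_i|^2 \cdot 1_{[-\alpha_n,\alpha_n]^d}(X_i) + c_2 \sum_{k=1}^{K_n} |w_{1,1,k}^{(L)}|^2,$$ and set $$m_n(x) = \max\{-\beta_n, \min\{\beta_n, f_{\mathbf{w}^{(t_n)}}(x)\}\} \cdot 1_{[-\alpha_n,\alpha_n]^d}(x).$$ **Conclusion.** The estimate is universally consistent: for every distribution of $(X,Y)$ with $\mathbf{E} Y^2 < \infty$, $$\mathbf{E} \int |m_n(x) - m(x)|^2 \, \mathbf{P}_X(dx) \to 0 \qquad (n \to \infty).$$ -/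

import Mathlib

open MeasureTheory ProbabilityTheory Filter Topology

noncomputable section

namespace ParallelNet

/-- Index set of the weights of a linear combination of `K` fully connected networks with `L`
layers, `r` neurons per layer and input dimension `d`:
* `Fin K`: the outer weights `w_{1,1,k}^{(L)}`;
* `Fin K × Fin r × Fin (d + 1)`: the input weights `w_{k,i,j}^{(0)}`;
* `Fin K × Fin (L - 1) × Fin r × Fin (r + 1)`: the weights `w_{k,i,j}^{(l)}`, `1 ≤ l ≤ L - 1`
  (the second component is `l - 1`).
In the last two cases `j = 0` is the bias. -/
abbrev WeightIndex (d L r K : ℕ) : Type :=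
  Fin K ⊕ (Fin K × Fin r × Fin (d + 1)) ⊕ (Fin K × Fin (L - 1) × Fin r × Fin (r + 1))

/-- The space of weight vectors, with the Euclidean inner product. -/
abbrev Weights (d L r K : ℕ) : Type := EuclideanSpace ℝ (WeightIndex d L r K)

variable {d L r K n : ℕ}

/-- The outer weight `w_{1,1,k}^{(L)}`. -/
def outerWeight (w : Weights d L r K) (k : Fin K) : ℝ := w (Sum.inl k)

/-- The input weight `w_{k,i,j}^{(0)}`; `j = 0` is the bias. -/
def inputWeight (w : Weights d L r K) (k : Fin K) (i : Fin r) (j : Fin (d + 1)) : ℝ :=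
  w (Sum.inr (Sum.inl (k, i, j)))

/-- The weight `w_{k,i,j}^{(l+1)}`, for `l = 0, …, L - 2`; `j = 0` is the bias. -/
def hiddenWeight (w : Weights d L r K) (k : Fin K) (l : Fin (L - 1)) (i : Fin r)
    (j : Fin (r + 1)) : ℝ :=
  w (Sum.inr (Sum.inr (k, l, i, j)))

/-- `neuron w x k l _ i` is the output `f_{k,i}^{(l+1)}(x)` of neuron `i` in layer `l + 1` of the
`k`-th network; `Real.sigmoid` is the logistic squasher `1 / (1 + exp (-x))`. -/
def neuron (w : Weights d L r K) (x : Fin d → ℝ) (k : Fin K) :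
    (l : ℕ) → l ≤ L - 1 → Fin r → ℝ
  | 0, _, i => Real.sigmoid (∑ j : Fin d, inputWeight w k i j.succ * x j + inputWeight w k i 0)
  | l + 1, h, i =>
      Real.sigmoid
        (∑ j : Fin r, hiddenWeight w k ⟨l, h⟩ i j.succ * neuron w x k l (Nat.le_of_succ_le h) j
          + hiddenWeight w k ⟨l, h⟩ i 0)

/-- The output `f_{k,1}^{(L)}(x)` of the `k`-th network: the first neuron of layer `L`
(for `r ≥ 1` and `L ≥ 1`). -/
def subnet (w : Weights d L r K) (x : Fin d → ℝ) (k : Fin K) : ℝ :=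
  if h : 0 < r then neuron w x k (L - 1) le_rfl ⟨0, h⟩ else 0

/-- The network `f_w(x) = ∑_k w_{1,1,k}^{(L)} f_{k,1}^{(L)}(x)`. -/
def network (w : Weights d L r K) (x : Fin d → ℝ) : ℝ :=
  ∑ k : Fin K, outerWeight w k * subnet w x k

/-- The cube `[-α, α]^d`. -/
def cube (d : ℕ) (α : ℝ) : Set (Fin d → ℝ) := Set.Icc (fun _ => -α) (fun _ => α)

/-- Truncation at the levels `-β` and `β`. -/
def trunc (β z : ℝ) : ℝ := max (-β) (min β z)

/-- The regularised empirical `L_2` risk, restricted to the data with `X_i ∈ [-α, α]^d`. -/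
def risk (c₂ α : ℝ) (data : Fin n → (Fin d → ℝ) × ℝ) (w : Weights d L r K) : ℝ :=
  (1 / (n : ℝ)) * ∑ i : Fin n,
      |network w (data i).1 - (data i).2| ^ 2 * (cube d α).indicator (fun _ => (1 : ℝ)) (data i).1
    + c₂ * ∑ k : Fin K, |outerWeight w k| ^ 2

/-- The weight vector after `t` steps of gradient descent on `risk` with step size `lam`,
started at `w₀`. -/
def gradDescent (c₂ α lam : ℝ) (data : Fin n → (Fin d → ℝ) × ℝ) (w₀ : Weights d L r K) :
    ℕ → Weights d L r K
  | 0 => w₀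
  | t + 1 =>
      gradDescent c₂ α lam data w₀ t
        - lam • gradient (risk c₂ α data) (gradDescent c₂ α lam data w₀ t)

/-- The estimate: the network after `t` gradient descent steps, truncated at the levels `±β` and
set to zero outside of `[-α, α]^d`. -/
def estimate (c₂ α β lam : ℝ) (t : ℕ) (data : Fin n → (Fin d → ℝ) × ℝ) (w₀ : Weights d L r K)
    (x : Fin d → ℝ) : ℝ :=
  trunc β (network (gradDescent c₂ α lam data w₀ t) x)
    * (cube d α).indicator (fun _ => (1 : ℝ)) x

/-- The random initialisation for sample size `n`: all weights are independent, the outer weights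
are zero, the hidden weights are uniformly distributed on `[-20 d (log n)^2, 20 d (log n)^2]`, and
the input weights are uniformly distributed on `[-n^τ, n^τ]`. -/
structure IsRandomInit {Ω : Type*} [MeasurableSpace Ω] (P : Measure Ω) (n : ℕ) (τ : ℝ)
    (W : Ω → Weights d L r K) : Prop where
  measurable : Measurable W
  indep : iIndepFun (fun (a : WeightIndex d L r K) (ω : Ω) => W ω a) P
  outer : ∀ ω k, outerWeight (W ω) k = 0
  hidden : ∀ k l i j,
    pdf.IsUniform (fun ω => hiddenWeight (W ω) k l i j)
      (Set.Icc (-(20 * (d : ℝ) * Real.log n ^ 2)) (20 * (d : ℝ) * Real.log n ^ 2)) P volume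
  input : ∀ k i j,
    pdf.IsUniform (fun ω => inputWeight (W ω) k i j)
      (Set.Icc (-((n : ℝ) ^ τ)) ((n : ℝ) ^ τ)) P volume

/-- The `L_2` error `∫ |g(x) - m(x)|^2 μ(dx)`, as an extended nonnegative number. -/
def l2Error (μ : Measure (Fin d → ℝ)) (g m : (Fin d → ℝ) → ℝ) : ENNReal :=
  ∫⁻ x, ENNReal.ofReal (|g x - m x| ^ 2) ∂μ

end ParallelNet

end

/-!
Write `V` for the Bayes risk `E (m(X) - Y)²`. Since `m(X)` is the orthogonal projection of `Y`, the
`L²` error of a predictor is its prediction error minus `V` (`integral_sq_error_eq`), so it suffices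
to show that the prediction error of the estimate is at most `V + o(1)`. Four facts give this.

*Approximation.* Linear combinations `∑ j, a j * v j` of single networks are dense in `L²`
(`exists_subnet_combination_approx`): networks whose hidden layers copy one neuron are ridge
functions of a sigmoidal function, and Cybenko's duality argument applies. Fix such a combination
`h` that is close to `m`.

*Random initialisation.* An initial network is `δ`-close to `v j` with a probability of order
`n ^ (-τ * r * (d + 1))`, up to logarithms. As `τ * (d + 1) < 1` and `K n ≥ n ^ r`, the expected
number `q` of such networks grows like a positive power of `n`, and by Chebyshev's inequality at
least half as many are present (`prob_few_blockClose_le`). Spreading `a j` evenly over them imitates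
`h` by a choice `u` of the outer weights with `∑ u ^ 2 = O(1 / q)`.

*Optimisation.* The step size `1 / L n` is below the inverse of the smoothness constant of the risk
on the region that is reached, which is `O(K n * n ^ (2 * τ))` up to logarithms
(`eventually_smoothConst_le`). Hence the risk decreases, and since the number of steps times the
step size is only of order `log n`, the whole path stays within a polylogarithmic distance of its
start. By the same energy bound only polylogarithmically many coordinates move by more than `δ / 2`,
so most of the networks close to `v j` stay close, and `u` keeps imitating `h` along the whole path
(`exists_reference_weights`). The risk is convex in the outer weights, so the regret bound of online
gradient descent compares the final risk with the risk of `u` along the path, at the cost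
`∑ u ^ 2 / log n` (`descent_regret`, `gradDescent_analysis`).

*Generalisation.* The weights stay bounded on the path, the input weights by about `n ^ τ` and the
hidden weights by powers of `log n`. So the networks vary on the length scale `n ^ (-τ)` up to
logarithms, in all their derivatives (`JetBound`, `neuron_jet`). They are encoded by rounded Taylor
polynomials of a high degree at about `n ^ (d * ρ)` grid points, where `τ < ρ` and `d * ρ < 1`
(`exists_jet_code`); the number `K n` of networks enters the entropy only through its logarithm.
Hoeffding's inequality and a union bound make the empirical truncated loss a uniform upper bound for
its expectation, up to `o(1)` (`tendsto_prob_deviation`). This holds for all reachable weights at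
once, however they depend on the data.

On the intersection of the good events the prediction error is at most the sample mean of
`comparisonLoss`, up to a small constant, and the expectation of this sample mean is close to `V`.
The truncated estimate is `O(log n)`, and the exceptional events have probability
`o((log n) ^ (-2))`, so they do not contribute.
-/

namespace ParallelNet

/-! ### Gradient descent on a locally smooth function -/

section Descent

variable {E : Type*} [NormedAddCommGroup E] [InnerProductSpace ℝ E]

/-- Gradient descent with step size `lam` at most the inverse of the smoothness constant: as long
as the region in which the descent inequality holds is not left, the risk decreases by at least
`lam / 2 * ‖gradient‖ ^ 2` in each step, and the energy bound in turn keeps the iterates in it. -/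
lemma descent_energy {F : E → ℝ} {g : E → E} {M R lam : ℝ} {w : ℕ → E} {T : ℕ}
    (hF : ∀ w, 0 ≤ F w) (hM : 0 ≤ M) (hR : 0 ≤ R) (hlam : 0 < lam)
    (hdesc : ∀ v, F v ≤ F (w 0) → ‖v - w 0‖ ≤ R → ∀ Δ : E, ‖Δ‖ ≤ 1 →
      F (v + Δ) ≤ F v + inner ℝ (g v) Δ + M / 2 * ‖Δ‖ ^ 2)
    (hlamM : lam * (F (w 0) + M) ≤ 1) (hw : ∀ t, w (t + 1) = w t - lam • g (w t))
    (hT : 2 * (lam * T) * F (w 0) ≤ R ^ 2) :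
    ∀ t ≤ T, F (w t) + lam / 2 * ∑ s ∈ Finset.range t, ‖g (w s)‖ ^ 2 ≤ F (w 0)
      ∧ ‖w t - w 0‖ ≤ R ∧ ∀ s ≤ t, F (w t) ≤ F (w s) := by
  intro t
  induction t with
  | zero =>
    intro _
    refine ⟨by simp, by simpa using hR, fun s hs => by rw [Nat.le_zero.1 hs]⟩
  | succ t ih =>
    intro ht
    obtain ⟨h1, h2, hanti⟩ := ih (by omega)
    have hsum : 0 ≤ ∑ s ∈ Finset.range t, ‖g (w s)‖ ^ 2 := Finset.sum_nonneg fun _ _ => sq_nonneg _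
    have hFt : F (w t) ≤ F (w 0) := by nlinarith
    -- a step of length one against the gradient must not make `F` negative, which bounds the
    -- gradient
    have hgt : lam * ‖g (w t)‖ ≤ 1 := by
      by_cases h0 : g (w t) = 0
      · simp [h0]
      have hn : 0 < ‖g (w t)‖ := norm_pos_iff.2 h0
      have := hdesc (w t) hFt h2 (-(‖g (w t)‖⁻¹ • g (w t))) (by
        rw [norm_neg, norm_smul, norm_inv, norm_norm, inv_mul_cancel₀ hn.ne'])
      rw [norm_neg, norm_smul, norm_inv, norm_norm, inv_mul_cancel₀ hn.ne', inner_neg_right,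
        inner_smul_right, real_inner_self_eq_norm_sq] at this
      have h3 : ‖g (w t)‖⁻¹ * ‖g (w t)‖ ^ 2 = ‖g (w t)‖ := by field_simp
      rw [h3] at this
      have h4 := hF (w t + -(‖g (w t)‖⁻¹ • g (w t)))
      have : ‖g (w t)‖ ≤ F (w 0) + M := by linarith
      nlinarith
    have hstep : F (w (t + 1)) ≤ F (w t) - lam / 2 * ‖g (w t)‖ ^ 2 := by
      have := hdesc (w t) hFt h2 (-(lam • g (w t))) (by
        rw [norm_neg, norm_smul, Real.norm_of_nonneg hlam.le]; exact hgt)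
      rw [← sub_eq_add_neg, ← hw, norm_neg, norm_smul, Real.norm_of_nonneg hlam.le, inner_neg_right,
        inner_smul_right, real_inner_self_eq_norm_sq] at this
      have h5 : lam * M ≤ 1 := by nlinarith [hF (w 0)]
      nlinarith [mul_nonneg hlam.le (sq_nonneg ‖g (w t)‖)]
    have hen : F (w (t + 1)) + lam / 2 * ∑ s ∈ Finset.range (t + 1), ‖g (w s)‖ ^ 2 ≤ F (w 0) := by
      rw [Finset.sum_range_succ]; linarith
    refine ⟨hen, ?_, fun s hs => ?_⟩
    swap
    · rcases Nat.le_succ_iff.1 hs with h | h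
      · exact le_trans (by nlinarith [sq_nonneg ‖g (w t)‖]) (hanti s h)
      · rw [h]
    have htel : ∀ t, w t - w 0 = -∑ s ∈ Finset.range t, lam • g (w s) := by
      intro t
      induction t with
      | zero => simp
      | succ t ih => rw [Finset.sum_range_succ, neg_add, ← ih, hw]; abel
    -- the length of the path is bounded by Cauchy-Schwarz
    have hnorm : ‖w (t + 1) - w 0‖ ^ 2
        ≤ ((t + 1 : ℕ) : ℝ) * ∑ s ∈ Finset.range (t + 1), (lam * ‖g (w s)‖) ^ 2 := by
      have h6 : ‖w (t + 1) - w 0‖ ≤ ∑ s ∈ Finset.range (t + 1), lam * ‖g (w s)‖ := by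
        rw [htel, norm_neg]
        refine (norm_sum_le _ _).trans (Finset.sum_le_sum fun s _ => ?_)
        rw [norm_smul, Real.norm_of_nonneg hlam.le]
      refine (pow_le_pow_left₀ (norm_nonneg _) h6 2).trans ?_
      have := sq_sum_le_card_mul_sum_sq (s := Finset.range (t + 1)) (f := fun s => lam * ‖g (w s)‖)
      simpa using this
    refine (sq_le_sq₀ (norm_nonneg _) hR).1 ?_
    have hpos := hF (w (t + 1))
    simp_rw [mul_pow] at hnorm
    rw [← Finset.mul_sum] at hnorm
    have hT' : ((t + 1 : ℕ) : ℝ) ≤ T := by exact_mod_cast ht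
    set G := ∑ s ∈ Finset.range (t + 1), ‖g (w s)‖ ^ 2
    have hS0 : 0 ≤ G := Finset.sum_nonneg fun _ _ => sq_nonneg _
    have h7 : lam * G ≤ 2 * F (w 0) := by nlinarith
    calc ‖w (t + 1) - w 0‖ ^ 2 ≤ ((t + 1 : ℕ) : ℝ) * (lam ^ 2 * G) := hnorm
      _ ≤ T * (lam ^ 2 * G) := by gcongr
      _ = (lam * T) * (lam * G) := by ring
      _ ≤ (lam * T) * (2 * F (w 0)) := by gcongr
      _ ≤ R ^ 2 := by linarith

end Descent

/-- Only few coordinates move by more than `δ` along the path of gradient descent: the squared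
lengths of the coordinate paths add up to at most `R ^ 2`. -/
lemma card_moved_coordinates_le {ι : Type*} [Fintype ι]
    {g : EuclideanSpace ℝ ι → EuclideanSpace ℝ ι} {lam R δ F₀ : ℝ} {w : ℕ → EuclideanSpace ℝ ι} {T : ℕ} (hlam : 0 < lam) (hδ : 0 < δ)
    (hw : ∀ t, w (t + 1) = w t - lam • g (w t))
    (hen : lam / 2 * ∑ s ∈ Finset.range T, ‖g (w s)‖ ^ 2 ≤ F₀)
    (hT : 2 * (lam * T) * F₀ ≤ R ^ 2) (A : Finset ι)
    (hA : ∀ a ∈ A, ∃ t ≤ T, δ < |w t a - w 0 a|) :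
    (A.card : ℝ) * δ ^ 2 ≤ R ^ 2 := by
  have htel : ∀ t a, w t a - w 0 a = -∑ s ∈ Finset.range t, lam * g (w s) a := by
    intro t a
    induction t with
    | zero => simp
    | succ t ih =>
      rw [Finset.sum_range_succ, neg_add, ← ih, hw]
      simp only [PiLp.sub_apply, PiLp.smul_apply, smul_eq_mul]
      ring
  have hmove : ∀ a ∈ A, δ ^ 2 ≤ T * ∑ s ∈ Finset.range T, (lam * g (w s) a) ^ 2 := by
    intro a ha
    obtain ⟨t, ht, h⟩ := hA a ha
    calc δ ^ 2 ≤ |w t a - w 0 a| ^ 2 := by gcongr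
      _ = (∑ s ∈ Finset.range t, lam * g (w s) a) ^ 2 := by rw [htel, sq_abs, neg_sq]
      _ ≤ t * ∑ s ∈ Finset.range t, (lam * g (w s) a) ^ 2 := by
        simpa using sq_sum_le_card_mul_sum_sq (s := Finset.range t) (f := fun s => lam * g (w s) a)
      _ ≤ T * ∑ s ∈ Finset.range T, (lam * g (w s) a) ^ 2 := by
        gcongr
  have hnn : ∀ s, ∑ a ∈ A, (g (w s) a) ^ 2 ≤ ‖g (w s)‖ ^ 2 := by
    intro s
    rw [EuclideanSpace.real_norm_sq_eq]
    exact Finset.sum_le_sum_of_subset_of_nonneg (Finset.subset_univ _) fun _ _ _ => sq_nonneg _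
  calc (A.card : ℝ) * δ ^ 2 = ∑ a ∈ A, δ ^ 2 := by simp
    _ ≤ ∑ a ∈ A, T * ∑ s ∈ Finset.range T, (lam * g (w s) a) ^ 2 := Finset.sum_le_sum hmove
    _ = T * lam ^ 2 * ∑ s ∈ Finset.range T, ∑ a ∈ A, (g (w s) a) ^ 2 := by
      rw [← Finset.mul_sum, Finset.sum_comm, mul_assoc]
      simp_rw [mul_pow, ← Finset.mul_sum]
    _ ≤ T * lam ^ 2 * ∑ s ∈ Finset.range T, ‖g (w s)‖ ^ 2 := by
      gcongr with s _; exact hnn s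
    _ = 2 * (lam * T) * (lam / 2 * ∑ s ∈ Finset.range T, ‖g (w s)‖ ^ 2) := by ring
    _ ≤ 2 * (lam * T) * F₀ := by gcongr
    _ ≤ R ^ 2 := hT

/-- The vector `w` with its coordinates of the first kind replaced by `u`. -/
def replaceOuter {α β : Type*} (w : EuclideanSpace ℝ (α ⊕ β)) (u : α → ℝ) :
    EuclideanSpace ℝ (α ⊕ β) :=
  WithLp.toLp 2 (Sum.elim u fun b => w (Sum.inr b))

/-- If the risk is convex in the coordinates of the first kind, then gradient descent competes with
every fixed choice `u` of these coordinates, although the remaining coordinates move: this is the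
regret bound of online gradient descent applied to the risks `u ↦ F (replaceOuter (w t) u)`. -/
lemma descent_regret {α β : Type*} [Fintype α] [Fintype β]
    {F : EuclideanSpace ℝ (α ⊕ β) → ℝ} {g : EuclideanSpace ℝ (α ⊕ β) → EuclideanSpace ℝ (α ⊕ β)}
    {lam Ξ : ℝ} {w : ℕ → EuclideanSpace ℝ (α ⊕ β)} {T : ℕ} {u : α → ℝ} (hF : ∀ w, 0 ≤ F w)
    (hlam : 0 < lam) (hT : 0 < T) (hw : ∀ t, w (t + 1) = w t - lam • g (w t))
    (hconv : ∀ v Δ : EuclideanSpace ℝ (α ⊕ β), (∀ b, Δ (Sum.inr b) = 0) →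
      F v + inner ℝ (g v) Δ ≤ F (v + Δ))
    (hen : ∀ t ≤ T, F (w t) + lam / 2 * ∑ s ∈ Finset.range t, ‖g (w s)‖ ^ 2 ≤ F (w 0))
    (hmono : ∀ t < T, F (w T) ≤ F (w t))
    (h0 : ∀ a, w 0 (Sum.inl a) = 0) (hΞ : ∀ t < T, F (replaceOuter (w t) u) ≤ Ξ) :
    F (w T) ≤ Ξ + (∑ a, u a ^ 2 + 2 * lam * F (w 0)) / (2 * (lam * T)) := by
  have key : ∀ t ≤ T, ∑ a, (w t (Sum.inl a) - u a) ^ 2 + 2 * lam * (t * (F (w T) - Ξ))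
      ≤ ∑ a, u a ^ 2 + lam ^ 2 * ∑ s ∈ Finset.range t, ‖g (w s)‖ ^ 2 := by
    intro t
    induction t with
    | zero => intro _; simp [h0]
    | succ t ih =>
      intro ht
      have ih := ih (by omega)
      set Δ : EuclideanSpace ℝ (α ⊕ β) :=
        WithLp.toLp 2 (Sum.elim (fun a => u a - w t (Sum.inl a)) 0) with hΔ
      have hrep : w t + Δ = replaceOuter (w t) u := by
        ext i
        rcases i with a | b <;> simp [hΔ, replaceOuter]
      have hc := hconv (w t) Δ (by intro b; simp [hΔ])
      rw [hrep] at hc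
      have hin : inner ℝ (g (w t)) Δ
          = ∑ a, g (w t) (Sum.inl a) * (u a - w t (Sum.inl a)) := by
        rw [PiLp.inner_apply, Fintype.sum_sum_type]
        simp [hΔ, mul_comm]
      have hsq : ∑ a, g (w t) (Sum.inl a) ^ 2 ≤ ‖g (w t)‖ ^ 2 := by
        rw [EuclideanSpace.real_norm_sq_eq, Fintype.sum_sum_type]
        have : 0 ≤ ∑ b, g (w t) (Sum.inr b) ^ 2 := Finset.sum_nonneg fun _ _ => sq_nonneg _
        linarith
      have hexp : ∑ a, (w (t + 1) (Sum.inl a) - u a) ^ 2 = ∑ a, (w t (Sum.inl a) - u a) ^ 2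
          + 2 * lam * (∑ a, g (w t) (Sum.inl a) * (u a - w t (Sum.inl a)))
          + lam ^ 2 * ∑ a, g (w t) (Sum.inl a) ^ 2 := by
        rw [Finset.mul_sum, Finset.mul_sum, ← Finset.sum_add_distrib, ← Finset.sum_add_distrib]
        refine Finset.sum_congr rfl fun a _ => ?_
        rw [hw]; simp; ring
      rw [hexp, ← hin, Finset.sum_range_succ]
      have h1 := hmono t (by omega)
      have h2 := hΞ t (by omega)
      push_cast
      nlinarith [sq_nonneg lam, mul_le_mul_of_nonneg_left hsq (sq_nonneg lam)]
  have h1 := key T le_rfl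
  have h2 := hen T le_rfl
  have h3 := hF (w T)
  have h4 : 0 ≤ ∑ a, (w T (Sum.inl a) - u a) ^ 2 := Finset.sum_nonneg fun _ _ => sq_nonneg _
  have h5 : 0 < lam * T := by positivity
  rw [← sub_le_iff_le_add', le_div_iff₀ (by positivity)]
  nlinarith

/-! ### Bounds for higher derivatives of the networks -/

section Jets

open scoped ContDiff

variable {E : Type*} [NormedAddCommGroup E] [NormedSpace ℝ E]

/-- `JetBound k f x C D`: the derivatives of `f` of order `i ≤ k` at the point `x` are bounded by
`C * D ^ i`, so `f` varies around `x` on the length scale `1 / D`. -/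
def JetBound (k : ℕ) (f : E → ℝ) (x : E) (C D : ℝ) : Prop :=
  ∀ i ≤ k, ‖iteratedFDeriv ℝ i f x‖ ≤ C * D ^ i

variable {k : ℕ} {f g : E → ℝ} {x : E} {C C' D D' : ℝ}

lemma JetBound.mono (h : JetBound k f x C D) (hC : C ≤ C') (hC' : 0 ≤ C') (hD0 : 0 ≤ D)
    (hD : D ≤ D') : JetBound k f x C' D' := fun i hi =>
  (h i hi).trans (by gcongr)

lemma JetBound.nonneg (h : JetBound k f x C D) : 0 ≤ C := by
  have := h 0 (Nat.zero_le k)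
  rw [pow_zero, mul_one] at this
  exact (norm_nonneg _).trans this

lemma JetBound.add (hf : JetBound k f x C D) (hg : JetBound k g x C' D)
    (hfs : ContDiff ℝ ω f) (hgs : ContDiff ℝ ω g) :
    JetBound k (fun y => f y + g y) x (C + C') D := fun i hi => by
  have : iteratedFDeriv ℝ i (fun y => f y + g y) x
      = iteratedFDeriv ℝ i f x + iteratedFDeriv ℝ i g x :=
    iteratedFDeriv_add_apply (hfs.contDiffAt.of_le le_top) (hgs.contDiffAt.of_le le_top)
  rw [this, add_mul]
  exact (norm_add_le _ _).trans (add_le_add (hf i hi) (hg i hi))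

lemma JetBound.sum {ι : Type*} {s : Finset ι} {f : ι → E → ℝ} {C : ι → ℝ}
    (hf : ∀ i ∈ s, JetBound k (f i) x (C i) D) (hfs : ∀ i ∈ s, ContDiff ℝ ω (f i)) :
    JetBound k (fun y => ∑ i ∈ s, f i y) x (∑ i ∈ s, C i) D := fun j hj => by
  rw [iteratedFDeriv_fun_sum_apply fun i hi => ((hfs i hi).contDiffAt.of_le le_top), Finset.sum_mul]
  exact (norm_sum_le _ _).trans (Finset.sum_le_sum fun i hi => hf i hi j hj)

lemma JetBound.mul (hf : JetBound k f x C D) (hg : JetBound k g x C' D')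
    (hfs : ContDiff ℝ ω f) (hgs : ContDiff ℝ ω g) :
    JetBound k (fun y => f y * g y) x (C * C') (D + D') := fun i hi => by
  refine (norm_iteratedFDeriv_mul_le hfs hgs x (n := i) le_top).trans ?_
  rw [add_pow, Finset.mul_sum]
  refine Finset.sum_le_sum fun j hj => ?_
  have hj : j ≤ i := Nat.lt_succ_iff.1 (Finset.mem_range.1 hj)
  calc (i.choose j : ℝ) * ‖iteratedFDeriv ℝ j f x‖ * ‖iteratedFDeriv ℝ (i - j) g x‖
      ≤ i.choose j * (C * D ^ j) * (C' * D' ^ (i - j)) := by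
        have h1 := hf j (hj.trans hi)
        have h2 := hg (i - j) ((Nat.sub_le _ _).trans hi)
        have h3 := (norm_nonneg _).trans h1
        gcongr
    _ = C * C' * (D ^ j * D' ^ (i - j) * i.choose j) := by ring

lemma JetBound.affine (ℓ : E →L[ℝ] ℝ) (c : ℝ) (hC : |ℓ x + c| ≤ C) (hD : ‖ℓ‖ ≤ C * D) :
    JetBound k (fun y => ℓ y + c) x C D := by
  rintro (_ | i) -
  · simpa using hC
  rw [← norm_iteratedFDeriv_fderiv]
  have : fderiv ℝ (fun y => ℓ y + c) = fun _ => ℓ := by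
    ext1 y
    rw [fderiv_add_const, ℓ.fderiv]
  rw [this]
  rcases i with _ | i
  · simpa using hD
  · rw [iteratedFDeriv_const_of_ne (by omega)]
    have h0 : 0 ≤ C := (_root_.abs_nonneg _).trans hC
    have h1 : 0 ≤ C * D := (norm_nonneg _).trans hD
    rcases h0.eq_or_lt with h | h
    · simp [← h]
    · have : 0 ≤ D := nonneg_of_mul_nonneg_right h1 h
      simp only [Pi.zero_apply, norm_zero]
      positivity

lemma JetBound.const (c : ℝ) (hD : 0 ≤ D) (hC : |c| ≤ C) : JetBound k (fun _ : E => c) x C D := by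
  have h0 : 0 ≤ C := (_root_.abs_nonneg _).trans hC
  simpa using JetBound.affine (k := k) (x := x) (0 : E →L[ℝ] ℝ) c (C := C) (D := D) (by simpa)
    (by simp; positivity)

/-- All derivatives of the logistic squasher are polynomials in the squasher, since
`σ' = σ * (1 - σ)`; hence they are bounded. -/
lemma exists_bound_iteratedFDeriv_sigmoid (k : ℕ) :
    ∃ B : ℝ, 1 ≤ B ∧ ∀ i ≤ k, ∀ x : ℝ, ‖iteratedFDeriv ℝ i Real.sigmoid x‖ ≤ B := by
  have hpoly : ∀ i : ℕ, ∃ p : Polynomial ℝ,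
      iteratedDeriv i Real.sigmoid = fun x => p.eval (Real.sigmoid x) := by
    intro i
    induction i with
    | zero => exact ⟨Polynomial.X, by simp⟩
    | succ i ih =>
      obtain ⟨p, hp⟩ := ih
      refine ⟨Polynomial.derivative p * (Polynomial.X * (1 - Polynomial.X)), ?_⟩
      ext x
      rw [iteratedDeriv_succ, hp]
      have := (p.hasDerivAt (Real.sigmoid x)).comp x (Real.hasDerivAt_sigmoid x)
      rw [show (fun x => p.eval (Real.sigmoid x)) = (fun x => p.eval x) ∘ Real.sigmoid from rfl,
        this.deriv]
      simp
  have hb : ∀ i : ℕ, ∃ B : ℝ, ∀ x : ℝ, ‖iteratedFDeriv ℝ i Real.sigmoid x‖ ≤ B := by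
    intro i
    obtain ⟨p, hp⟩ := hpoly i
    obtain ⟨B, hB⟩ := (isCompact_Icc (a := (0 : ℝ)) (b := 1)).exists_bound_of_continuousOn
      p.continuous.continuousOn
    refine ⟨B, fun x => ?_⟩
    rw [norm_iteratedFDeriv_eq_norm_iteratedDeriv, hp]
    exact hB _ ⟨Real.sigmoid_nonneg x, Real.sigmoid_le_one x⟩
  choose B hB using hb
  refine ⟨1 + ∑ i ∈ Finset.range (k + 1), |B i|, ?_, fun i hi x => ?_⟩
  · have : 0 ≤ ∑ i ∈ Finset.range (k + 1), |B i| := Finset.sum_nonneg fun _ _ => _root_.abs_nonneg _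
    linarith
  · have := Finset.single_le_sum (f := fun i => |B i|) (fun _ _ => _root_.abs_nonneg _)
      (Finset.mem_range.2 (Nat.lt_succ_of_le hi))
    linarith [hB i x, le_abs_self (B i)]

lemma JetBound.sigmoid {B : ℝ} (hB : ∀ i ≤ k, ∀ x : ℝ, ‖iteratedFDeriv ℝ i Real.sigmoid x‖ ≤ B)
    (hf : JetBound k f x C D) (hfs : ContDiff ℝ ω f) (hC : 1 ≤ C) (hD : 0 ≤ D) :
    JetBound k (fun y => Real.sigmoid (f y)) x (k.factorial * B) (C * D) := fun i hi => by
  have hB0 : 0 ≤ B := (norm_nonneg _).trans (hB 0 (Nat.zero_le _) 0)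
  have := norm_iteratedFDeriv_comp_le (g := Real.sigmoid) (f := f) (n := i) contDiff_sigmoid hfs
    le_top x (C := B) (D := C * D) (fun j hj => hB j (hj.trans hi) _) (fun j hj1 hj => by
      refine (hf j (hj.trans hi)).trans ?_
      rw [mul_pow]
      gcongr
      exact le_self_pow₀ hC (by omega))
  refine this.trans ?_
  have : (i.factorial : ℝ) ≤ k.factorial := by exact_mod_cast Nat.factorial_le hi
  gcongr

lemma neuron_contDiff {d L r K : ℕ} {w : E → Weights d L r K} {ξ : E → Fin d → ℝ} {κ : Fin K}
    (hw : ∀ a, ContDiff ℝ ω fun e => w e a) (hξ : ∀ j, ContDiff ℝ ω fun e => ξ e j)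
    (l : ℕ) (hl : l ≤ L - 1) (i : Fin r) :
    ContDiff ℝ ω fun e => neuron (w e) (ξ e) κ l hl i := by
  have hwi : ∀ i j, ContDiff ℝ ω fun e => inputWeight (w e) κ i j := fun i j => hw _
  have hwh : ∀ l i j, ContDiff ℝ ω fun e => hiddenWeight (w e) κ l i j := fun l i j => hw _
  induction l generalizing i with
  | zero => exact ContDiff.sigmoid ((ContDiff.sum fun j _ => (hwi _ _).mul (hξ j)).add (hwi _ _))
  | succ l ih =>
    exact ContDiff.sigmoid ((ContDiff.sum fun j _ => (hwh _ _ _).mul (ih _ j)).add (hwh _ _ _))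

lemma subnet_contDiff {d L r K : ℕ} {w : E → Weights d L r K} {ξ : E → Fin d → ℝ} {κ : Fin K}
    (hw : ∀ a, ContDiff ℝ ω fun e => w e a) (hξ : ∀ j, ContDiff ℝ ω fun e => ξ e j) :
    ContDiff ℝ ω fun e => subnet (w e) (ξ e) κ := by
  unfold subnet
  split_ifs
  · exact neuron_contDiff hw hξ _ _ _
  · exact contDiff_const

lemma network_contDiff {d L r K : ℕ} {w : E → Weights d L r K} {ξ : E → Fin d → ℝ}
    (hw : ∀ a, ContDiff ℝ ω fun e => w e a) (hξ : ∀ j, ContDiff ℝ ω fun e => ξ e j) :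
    ContDiff ℝ ω fun e => network (w e) (ξ e) :=
  ContDiff.sum fun _ _ => (hw _).mul (subnet_contDiff hw hξ)

/-- If weights and inputs depend smoothly on a parameter `e`, on the length scale `1 / D₀`, then
the neurons of layer `l + 1` vary on the length scale `1 / D₀` divided by a factor that is linear in
the size `I` of the input weights and polynomial in the sizes `X` and `H` of the inputs and of the
hidden weights. -/
theorem neuron_jet {d L r K : ℕ} {B I X H D₀ : ℝ}
    (hB1 : 1 ≤ B) (hB : ∀ i ≤ k, ∀ x : ℝ, ‖iteratedFDeriv ℝ i Real.sigmoid x‖ ≤ B)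
    (hI : 1 ≤ I) (hX : 1 ≤ X) (hH : 1 ≤ H) (hD₀ : 0 ≤ D₀)
    {w : E → Weights d L r K} {ξ : E → Fin d → ℝ} {κ : Fin K} {e : E}
    (hw : ∀ a, ContDiff ℝ ω fun e => w e a) (hξ : ∀ j, ContDiff ℝ ω fun e => ξ e j)
    (hinp : ∀ i j, JetBound k (fun e => inputWeight (w e) κ i j) e I D₀)
    (hhid : ∀ l i j, JetBound k (fun e => hiddenWeight (w e) κ l i j) e H D₀)
    (hxi : ∀ j, JetBound k (fun e => ξ e j) e X D₀) (l : ℕ) (hl : l ≤ L - 1) (i : Fin r) :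
    JetBound k (fun e => neuron (w e) (ξ e) κ l hl i) e (k.factorial * B)
      (D₀ * (2 * ((d + 1) * I * X)) * (2 * ((r + 1) * H * (k.factorial * B))) ^ l) := by
  set S : ℝ := k.factorial * B with hS
  have hS1 : 1 ≤ S := one_le_mul_of_one_le_of_one_le
    (by exact_mod_cast Nat.succ_le_of_lt k.factorial_pos) hB1
  have hIX : 1 ≤ (d + 1) * I * X :=
    one_le_mul_of_one_le_of_one_le (one_le_mul_of_one_le_of_one_le (by simp) hI) hX
  have hrH : 1 ≤ (r + 1) * H * S :=
    one_le_mul_of_one_le_of_one_le (one_le_mul_of_one_le_of_one_le (by simp) hH) hS1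
  have hwi : ∀ i j, ContDiff ℝ ω fun e => inputWeight (w e) κ i j := fun i j => hw _
  have hwh : ∀ l i j, ContDiff ℝ ω fun e => hiddenWeight (w e) κ l i j := fun l i j => hw _
  induction l generalizing i with
  | zero =>
    have hs1 : ContDiff ℝ ω fun e =>
        ∑ j : Fin d, inputWeight (w e) κ i j.succ * ξ e j + inputWeight (w e) κ i 0 :=
      (ContDiff.sum fun j _ => (hwi _ _).mul (hξ j)).add (hwi _ _)
    have h1 : JetBound k (fun e => ∑ j : Fin d, inputWeight (w e) κ i j.succ * ξ e j
        + inputWeight (w e) κ i 0) e (∑ _j : Fin d, I * X + I * X) (D₀ + D₀) :=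
      (JetBound.sum (fun j _ => (hinp i _).mul (hxi j) (hwi _ _) (hξ j))
        fun j _ => (hwi _ _).mul (hξ j)).add ((hinp i 0).mono (by nlinarith) (by positivity) hD₀
          (by linarith)) (ContDiff.sum fun j _ => (hwi _ _).mul (hξ j)) (hwi _ _)
    have h2 := (h1.mono (C' := (d + 1) * I * X) (by simp; linarith) (by positivity)
      (by positivity) le_rfl).sigmoid hB hs1 hIX (by positivity)
    simp only [neuron]
    convert h2 using 1
    ring
  | succ l ih =>
    set D := D₀ * (2 * ((d + 1) * I * X)) * (2 * ((r + 1) * H * S)) ^ l with hD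
    have hle : D₀ ≤ D := by
      rw [hD, mul_assoc]
      refine le_mul_of_one_le_right hD₀ (one_le_mul_of_one_le_of_one_le (by linarith)
        (one_le_pow₀ (by linarith)))
    have hs0 := fun j => neuron_contDiff (κ := κ) hw hξ l (Nat.le_of_succ_le hl) j
    have hs1 : ContDiff ℝ ω fun e =>
        ∑ j : Fin r, hiddenWeight (w e) κ ⟨l, hl⟩ i j.succ
          * neuron (w e) (ξ e) κ l (Nat.le_of_succ_le hl) j + hiddenWeight (w e) κ ⟨l, hl⟩ i 0 :=
      (ContDiff.sum fun j _ => (hwh _ _ _).mul (hs0 j)).add (hwh _ _ _)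
    have h1 : JetBound k (fun e => ∑ j : Fin r, hiddenWeight (w e) κ ⟨l, hl⟩ i j.succ
          * neuron (w e) (ξ e) κ l (Nat.le_of_succ_le hl) j + hiddenWeight (w e) κ ⟨l, hl⟩ i 0) e
        (∑ _j : Fin r, H * S + H * S) (D₀ + D) :=
      (JetBound.sum (fun j _ => (hhid _ i _).mul (ih (Nat.le_of_succ_le hl) j) (hwh _ _ _) (hs0 j))
        fun j _ => (hwh _ _ _).mul (hs0 j)).add ((hhid _ i 0).mono (by nlinarith) (by positivity) hD₀
          (by linarith)) (ContDiff.sum fun j _ => (hwh _ _ _).mul (hs0 j)) (hwh _ _ _)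
    have h2 := (h1.mono (C' := (r + 1) * H * S) (D' := 2 * D) (by simp; linarith) (by positivity)
      (by positivity) (by linarith)).sigmoid hB hs1 hrH (by positivity)
    simp only [neuron]
    refine h2.mono le_rfl (by positivity) (by positivity) (le_of_eq ?_)
    rw [pow_succ, hD]
    ring

/-- The factor by which a network with `L` layers whose inputs, input weights and hidden weights are
bounded by `X`, `I` and `H` shrinks the length scale; `S` bounds the derivatives of the squasher. -/
def netScale (d L r : ℕ) (S X I H : ℝ) : ℝ :=
  2 * ((d + 1) * I * X) * (2 * ((r + 1) * H * S)) ^ (L - 1)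

lemma subnet_jet {d L r K : ℕ} {B I X H D₀ : ℝ}
    (hB1 : 1 ≤ B) (hB : ∀ i ≤ k, ∀ x : ℝ, ‖iteratedFDeriv ℝ i Real.sigmoid x‖ ≤ B)
    (hI : 1 ≤ I) (hX : 1 ≤ X) (hH : 1 ≤ H) (hD₀ : 0 ≤ D₀)
    {w : E → Weights d L r K} {ξ : E → Fin d → ℝ} {κ : Fin K} {e : E}
    (hw : ∀ a, ContDiff ℝ ω fun e => w e a) (hξ : ∀ j, ContDiff ℝ ω fun e => ξ e j)
    (hinp : ∀ i j, JetBound k (fun e => inputWeight (w e) κ i j) e I D₀)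
    (hhid : ∀ l i j, JetBound k (fun e => hiddenWeight (w e) κ l i j) e H D₀)
    (hxi : ∀ j, JetBound k (fun e => ξ e j) e X D₀) :
    JetBound k (fun e => subnet (w e) (ξ e) κ) e (k.factorial * B)
      (D₀ * netScale d L r (k.factorial * B) X I H) := by
  unfold subnet netScale
  split_ifs
  · rw [← mul_assoc]
    exact neuron_jet hB1 hB hI hX hH hD₀ hw hξ hinp hhid hxi _ _ _
  · exact JetBound.const _ (by positivity) (by simp; positivity)

end Jets

/-! ### Smoothness and partial convexity of the regularised risk -/

section Risk

open scoped ContDiff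

variable {E : Type*} [NormedAddCommGroup E] [NormedSpace ℝ E] {d L r K n : ℕ}

/-- Bounds `I` and `H` for the input weights and the hidden weights, and a bound `U` for the
Euclidean norm of the outer weights. -/
structure WeightBound (w : Weights d L r K) (U I H : ℝ) : Prop where
  outer : ∑ κ, outerWeight w κ ^ 2 ≤ U ^ 2
  input : ∀ κ i j, |inputWeight w κ i j| ≤ I
  hidden : ∀ κ l i j, |hiddenWeight w κ l i j| ≤ H

lemma WeightBound.sum_abs_le {w : Weights d L r K} {U I H : ℝ} (h : WeightBound w U I H)
    (hU : 0 ≤ U) : ∑ κ, |outerWeight w κ| ≤ √K * U := by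
  rw [← Real.sqrt_sq hU, ← Real.sqrt_mul (Nat.cast_nonneg _)]
  apply Real.le_sqrt_of_sq_le
  have := sq_sum_le_card_mul_sum_sq (s := Finset.univ) (f := fun κ => |outerWeight w κ|)
  simp only [sq_abs, Finset.card_univ, Fintype.card_fin] at this
  exact this.trans (mul_le_mul_of_nonneg_left h.outer (Nat.cast_nonneg _))

lemma netScale_nonneg {S X I H : ℝ} (hS : 0 ≤ S) (hX : 0 ≤ X) (hI : 0 ≤ I) (hH : 0 ≤ H) :
    0 ≤ netScale d L r S X I H := by
  unfold netScale; positivity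

lemma subnet_mem_Icc (w : Weights d L r K) (x : Fin d → ℝ) (κ : Fin K) :
    subnet w x κ ∈ Set.Icc (0 : ℝ) 1 := by
  unfold subnet
  split_ifs with h
  · have : ∀ (l : ℕ) (hl : l ≤ L - 1) i, neuron w x κ l hl i ∈ Set.Icc (0 : ℝ) 1 := by
      rintro (_ | l) hl i <;> exact ⟨Real.sigmoid_nonneg _, Real.sigmoid_le_one _⟩
    exact this _ _ _
  · simp

lemma neuron_congr {K' : ℕ} {w : Weights d L r K} {w' : Weights d L r K'} {κ : Fin K} {κ' : Fin K'}
    (x : Fin d → ℝ) (hin : ∀ i j, inputWeight w κ i j = inputWeight w' κ' i j)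
    (hhid : ∀ l i j, hiddenWeight w κ l i j = hiddenWeight w' κ' l i j) (l : ℕ) (hl : l ≤ L - 1)
    (i : Fin r) : neuron w x κ l hl i = neuron w' x κ' l hl i := by
  induction l generalizing i with
  | zero => simp only [neuron, hin]
  | succ l ih => simp only [neuron, hhid, ih]

lemma subnet_congr {K' : ℕ} {w : Weights d L r K} {w' : Weights d L r K'} {κ : Fin K} {κ' : Fin K'}
    (x : Fin d → ℝ) (hin : ∀ i j, inputWeight w κ i j = inputWeight w' κ' i j)
    (hhid : ∀ l i j, hiddenWeight w κ l i j = hiddenWeight w' κ' l i j) :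
    subnet w x κ = subnet w' x κ' := by
  unfold subnet
  split_ifs
  · exact neuron_congr x hin hhid _ _ _
  · rfl

lemma network_jet {k : ℕ} {B I X H D₀ A : ℝ} {C : Fin K → ℝ}
    (hB1 : 1 ≤ B) (hB : ∀ i ≤ k, ∀ x : ℝ, ‖iteratedFDeriv ℝ i Real.sigmoid x‖ ≤ B)
    (hI : 1 ≤ I) (hX : 1 ≤ X) (hH : 1 ≤ H) (hD₀ : 0 ≤ D₀)
    {w : E → Weights d L r K} {ξ : E → Fin d → ℝ} {e : E}
    (hw : ∀ a, ContDiff ℝ ω fun e => w e a) (hξ : ∀ j, ContDiff ℝ ω fun e => ξ e j)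
    (hout : ∀ κ, JetBound k (fun e => outerWeight (w e) κ) e (C κ) D₀) (hC : ∑ κ, C κ ≤ A)
    (hinp : ∀ κ i j, JetBound k (fun e => inputWeight (w e) κ i j) e I D₀)
    (hhid : ∀ κ l i j, JetBound k (fun e => hiddenWeight (w e) κ l i j) e H D₀)
    (hxi : ∀ j, JetBound k (fun e => ξ e j) e X D₀) :
    JetBound k (fun e => network (w e) (ξ e)) e (A * (k.factorial * B))
      (D₀ * (1 + netScale d L r (k.factorial * B) X I H)) := by
  have hΛ : 0 ≤ netScale d L r (k.factorial * B) X I H :=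
    netScale_nonneg (by positivity) (by positivity) (by positivity) (by positivity)
  have hA : 0 ≤ A := le_trans (Finset.sum_nonneg fun κ _ => (hout κ).nonneg) hC
  refine JetBound.mono (JetBound.sum (D := D₀ + D₀ * netScale d L r (k.factorial * B) X I H)
    (C := fun κ => C κ * (k.factorial * B)) (fun κ _ => (hout κ).mul
      (subnet_jet hB1 hB hI hX hH hD₀ hw hξ (hinp κ) (hhid κ) hxi) (hw _) (subnet_contDiff hw hξ))
    fun κ _ => (hw _).mul (subnet_contDiff hw hξ)) ?_ (by positivity) (by positivity)
    (by rw [mul_add, mul_one])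
  rw [← Finset.sum_mul]
  gcongr

lemma risk_eq (c₂ α : ℝ) (data : Fin n → (Fin d → ℝ) × ℝ) (w : Weights d L r K) :
    risk c₂ α data w = (1 / (n : ℝ)) * ∑ i : Fin n,
      (network w (data i).1 - (data i).2) * (network w (data i).1 - (data i).2)
        * (cube d α).indicator (fun _ => (1 : ℝ)) (data i).1
      + c₂ * ∑ k : Fin K, outerWeight w k * outerWeight w k := by
  simp only [risk, sq_abs]
  simp only [sq]

lemma risk_contDiff (c₂ α : ℝ) (data : Fin n → (Fin d → ℝ) × ℝ) {w : E → Weights d L r K}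
    (hw : ∀ a, ContDiff ℝ ω fun e => w e a) :
    ContDiff ℝ ω fun e => risk c₂ α data (w e) := by
  simp only [risk_eq]
  have h1 : ∀ i, ContDiff ℝ ω fun e => network (w e) (data i).1 - (data i).2 := fun i =>
    (network_contDiff (ξ := fun _ => (data i).1) hw fun _ => contDiff_const).sub contDiff_const
  exact (contDiff_const.mul (ContDiff.sum fun i _ => ((h1 i).mul (h1 i)).mul contDiff_const)).add
    (contDiff_const.mul (ContDiff.sum fun κ _ => (hw _).mul (hw _)))

lemma differentiable_risk (c₂ α : ℝ) (data : Fin n → (Fin d → ℝ) × ℝ) :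
    Differentiable ℝ (risk c₂ α data : Weights d L r K → ℝ) :=
  (risk_contDiff c₂ α data (w := id) fun _ => contDiff_piLp_apply _).differentiable (by simp)

/-- The directional derivative of the risk, in terms of its gradient. -/
lemma hasDerivAt_risk_line (c₂ α : ℝ) (data : Fin n → (Fin d → ℝ) × ℝ) (w Δ : Weights d L r K) :
    HasDerivAt (fun s : ℝ => risk c₂ α data (w + s • Δ))
      (inner ℝ (gradient (risk c₂ α data) w) Δ) 0 := by
  have h1 : HasDerivAt (fun s : ℝ => w + s • Δ) Δ 0 := by
    simpa using ((hasDerivAt_id (0 : ℝ)).smul_const Δ).const_add w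
  have h2 := ((differentiable_risk c₂ α data) (w + (0 : ℝ) • Δ)).hasGradientAt.hasFDerivAt
  have := h2.comp_hasDerivAt (0 : ℝ) h1
  rw [zero_smul, add_zero, InnerProductSpace.toDual_apply_apply] at this
  exact this

lemma risk_nonneg {c₂ : ℝ} (hc₂ : 0 ≤ c₂) (α : ℝ) (data : Fin n → (Fin d → ℝ) × ℝ)
    (w : Weights d L r K) : 0 ≤ risk c₂ α data w := by
  unfold risk
  have : ∀ x, 0 ≤ (cube d α).indicator (fun _ => (1 : ℝ)) x :=
    fun x => Set.indicator_nonneg (fun _ _ => zero_le_one) x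
  have h1 : 0 ≤ ∑ i : Fin n, |network w (data i).1 - (data i).2| ^ 2
      * (cube d α).indicator (fun _ => (1 : ℝ)) (data i).1 :=
    Finset.sum_nonneg fun i _ => mul_nonneg (sq_nonneg _) (this _)
  positivity

lemma outer_le_risk {c₂ : ℝ} (α : ℝ) (data : Fin n → (Fin d → ℝ) × ℝ)
    (w : Weights d L r K) : c₂ * ∑ κ, outerWeight w κ ^ 2 ≤ risk c₂ α data w := by
  unfold risk
  have : ∀ x, 0 ≤ (cube d α).indicator (fun _ => (1 : ℝ)) x :=
    fun x => Set.indicator_nonneg (fun _ _ => zero_le_one) x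
  have h1 : 0 ≤ ∑ i : Fin n, |network w (data i).1 - (data i).2| ^ 2
      * (cube d α).indicator (fun _ => (1 : ℝ)) (data i).1 :=
    Finset.sum_nonneg fun i _ => mul_nonneg (sq_nonneg _) (this _)
  simp only [sq_abs] at h1 ⊢
  have : 0 ≤ 1 / (n : ℝ) * ∑ i : Fin n, (network w (data i).1 - (data i).2) ^ 2
      * (cube d α).indicator (fun _ => (1 : ℝ)) (data i).1 := by positivity
  linarith

lemma risk_le_of_outer_eq_zero {c₂ : ℝ} (α : ℝ) (data : Fin n → (Fin d → ℝ) × ℝ)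
    {w : Weights d L r K} (hw : ∀ κ, outerWeight w κ = 0) :
    risk c₂ α data w ≤ 1 / (n : ℝ) * ∑ i, (data i).2 ^ 2 := by
  have h0 : ∀ x, network w x = 0 := fun x => by simp [network, hw]
  simp only [risk, hw, h0, zero_sub, abs_neg, sq_abs, abs_zero]
  simp only [ne_eq, OfNat.ofNat_ne_zero, not_false_eq_true, zero_pow, Finset.sum_const_zero,
    mul_zero, add_zero]
  gcongr with i _
  exact mul_le_of_le_one_right (sq_nonneg _) (Set.indicator_le_self' (by simp) _ |>.trans le_rfl)

/-- The network is linear in the outer weights, so the risk is convex in them. -/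
lemma risk_convex_outer {c₂ : ℝ} (hc₂ : 0 ≤ c₂) (α : ℝ) (data : Fin n → (Fin d → ℝ) × ℝ)
    (w Δ : Weights d L r K) (hΔ : ∀ b, Δ (Sum.inr b) = 0) :
    risk c₂ α data w + inner ℝ (gradient (risk c₂ α data) w) Δ ≤ risk c₂ α data (w + Δ) := by
  set c : (Fin d → ℝ) → ℝ := fun x => ∑ κ, outerWeight Δ κ * subnet w x κ with hc
  set ind : (Fin d → ℝ) → ℝ := (cube d α).indicator fun _ => (1 : ℝ) with hind
  have hnet : ∀ (s : ℝ) x, network (w + s • Δ) x = network w x + s * c x := by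
    intro s x
    have : ∀ κ, subnet (w + s • Δ) x κ = subnet w x κ := fun κ =>
      subnet_congr x (fun i j => by simp [inputWeight, hΔ]) fun l i j => by simp [hiddenWeight, hΔ]
    simp only [network, this, hc, Finset.mul_sum, ← Finset.sum_add_distrib]
    refine Finset.sum_congr rfl fun κ _ => ?_
    simp only [outerWeight, PiLp.add_apply, PiLp.smul_apply, smul_eq_mul]
    ring
  set q : ℝ := 1 / (n : ℝ) * ∑ i, c (data i).1 ^ 2 * ind (data i).1
    + c₂ * ∑ κ, outerWeight Δ κ ^ 2 with hq
  set b : ℝ := 1 / (n : ℝ) * ∑ i, 2 * (network w (data i).1 - (data i).2) * c (data i).1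
    * ind (data i).1 + c₂ * ∑ κ, 2 * outerWeight w κ * outerWeight Δ κ with hb
  -- the risk is a quadratic polynomial, with leading coefficient `q ≥ 0`, along the line
  have hquad : ∀ s : ℝ, risk c₂ α data (w + s • Δ) = risk c₂ α data w + s * b + s ^ 2 * q := by
    intro s
    have h1 : ∑ i, |network (w + s • Δ) (data i).1 - (data i).2| ^ 2 * ind (data i).1
        = ∑ i, |network w (data i).1 - (data i).2| ^ 2 * ind (data i).1
          + s * ∑ i, 2 * (network w (data i).1 - (data i).2) * c (data i).1 * ind (data i).1
          + s ^ 2 * ∑ i, c (data i).1 ^ 2 * ind (data i).1 := by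
      rw [Finset.mul_sum, Finset.mul_sum, ← Finset.sum_add_distrib, ← Finset.sum_add_distrib]
      refine Finset.sum_congr rfl fun i _ => ?_
      rw [hnet, sq_abs, sq_abs]
      ring
    have h2 : ∑ κ, |outerWeight (w + s • Δ) κ| ^ 2 = ∑ κ, |outerWeight w κ| ^ 2
        + s * ∑ κ, 2 * outerWeight w κ * outerWeight Δ κ + s ^ 2 * ∑ κ, outerWeight Δ κ ^ 2 := by
      rw [Finset.mul_sum, Finset.mul_sum, ← Finset.sum_add_distrib, ← Finset.sum_add_distrib]
      refine Finset.sum_congr rfl fun κ _ => ?_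
      simp only [outerWeight, PiLp.add_apply, PiLp.smul_apply, smul_eq_mul, sq_abs]
      ring
    unfold risk
    rw [h1, h2, hq, hb]
    ring
  have hd1 := hasDerivAt_risk_line c₂ α data w Δ
  have hd2 : HasDerivAt (fun s : ℝ => risk c₂ α data (w + s • Δ)) b 0 := by
    simp_rw [hquad]
    have := (((hasDerivAt_id (0 : ℝ)).mul_const b).const_add (risk c₂ α data w)).add
      (((hasDerivAt_id (0 : ℝ)).pow 2).mul_const q)
    refine this.congr_deriv ?_
    simp
  have hq0 : 0 ≤ q := by
    have : ∀ x, 0 ≤ ind x := fun x => Set.indicator_nonneg (fun _ _ => zero_le_one) x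
    have h1 : 0 ≤ ∑ i, c (data i).1 ^ 2 * ind (data i).1 :=
      Finset.sum_nonneg fun i _ => mul_nonneg (sq_nonneg _) (this _)
    positivity
  have h1 := hquad 1
  rw [one_smul, one_mul, one_pow, one_mul] at h1
  rw [hd1.unique hd2, h1]
  linarith

/-- The smoothness constant of the risk in the region given by `WeightBound`; `V` bounds the mean of
the squared responses and `S` the derivatives of the squasher. -/
noncomputable def smoothConst (d L r K : ℕ) (c₂ S V X U I H : ℝ) : ℝ :=
  (2 * (√K * (U + 1) * S) ^ 2 + 2 * V + c₂ * (2 * U ^ 2 + 2))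
    * (2 * (1 + netScale d L r S X I H)) ^ 2

lemma descent_of_second_derivative_bound {f : ℝ → ℝ} {C b : ℝ} (hf : ContDiff ℝ ω f)
    (hb : HasDerivAt f b 0) (hC : ∀ s ∈ Set.Icc (0 : ℝ) 1, ‖iteratedFDeriv ℝ 2 f s‖ ≤ C) :
    f 1 ≤ f 0 + b + C := by
  have hC0 : 0 ≤ C := (norm_nonneg _).trans (hC 0 (by simp))
  have hdf : Differentiable ℝ f := hf.differentiable (by simp)
  have hdd : Differentiable ℝ (deriv f) :=
    ((contDiff_succ_iff_deriv (n := 1)).1 (hf.of_le le_top)).2.2.differentiable (by simp)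
  have h1 : ∀ s ∈ Set.Icc (0 : ℝ) 1, ‖deriv f s - deriv f 0‖ ≤ C := by
    intro s hs
    have := Convex.norm_image_sub_le_of_norm_deriv_le (f := deriv f) (s := Set.Icc (0 : ℝ) 1)
      (x := 0) (y := s) (C := C) (fun x _ => hdd x) (fun x hx => by
        have := hC x hx
        rwa [norm_iteratedFDeriv_eq_norm_iteratedDeriv, iteratedDeriv_succ, iteratedDeriv_one]
          at this) (convex_Icc _ _) (by simp) hs
    refine this.trans (mul_le_of_le_one_right hC0 ?_)
    rw [sub_zero, Real.norm_of_nonneg hs.1]; exact hs.2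
  rw [hb.deriv] at h1
  have hlin : Differentiable ℝ fun s : ℝ => s * b := by fun_prop
  have h2 := Convex.norm_image_sub_le_of_norm_deriv_le (f := fun s => f s - s * b)
    (s := Set.Icc (0 : ℝ) 1) (x := 0) (y := 1) (C := C) (fun x _ => (hdf x).sub (hlin x))
    (fun x hx => by
      have : deriv (fun s => f s - s * b) x = deriv f x - b := by
        have := (hdf x).hasDerivAt.sub ((hasDerivAt_id x).mul_const b)
        rw [one_mul] at this
        exact this.deriv
      rw [this]; exact h1 x hx) (convex_Icc _ _) (by simp) (by simp)
  have := (Real.norm_eq_abs _ ▸ (le_abs_self _).trans h2)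
  simp at this
  linarith

/-- The second derivative of the risk along a line in the region given by `WeightBound`. -/
lemma risk_jet_line {B X U I H V α c₂ s : ℝ} (hc₂ : 0 ≤ c₂)
    (hB1 : 1 ≤ B) (hB : ∀ i ≤ 2, ∀ x : ℝ, ‖iteratedFDeriv ℝ i Real.sigmoid x‖ ≤ B)
    (hI : 1 ≤ I) (hX : 1 ≤ X) (hH : 1 ≤ H) (hU : 0 ≤ U) (hα : α ≤ X)
    {data : Fin n → (Fin d → ℝ) × ℝ} (hV : 1 / (n : ℝ) * ∑ i, (data i).2 ^ 2 ≤ V)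
    {w Δ : Weights d L r K} (hΔ : Δ ≠ 0) (hw : WeightBound (w + s • Δ) U I H) :
    JetBound 2 (fun s : ℝ => risk c₂ α data (w + s • Δ)) s
      (2 * (√K * (U + 1) * ((2 : ℕ).factorial * B)) ^ 2 + 2 * V + c₂ * (2 * U ^ 2 + 2))
      (‖Δ‖ * (2 * (1 + netScale d L r ((2 : ℕ).factorial * B) X I H))) := by
  have hn : 0 < ‖Δ‖ := norm_pos_iff.2 hΔ
  set Λ := netScale d L r ((2 : ℕ).factorial * B) X I H with hΛ
  have hΛ0 : 0 ≤ Λ :=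
    netScale_nonneg (by positivity) (by positivity) (by positivity) (by positivity)
  set A : ℝ := √K * (U + 1) with hA
  have hA0 : 0 ≤ A := by positivity
  have hsm : ∀ a, ContDiff ℝ ω fun s : ℝ => (w + s • Δ) a := fun a => by
    simp only [PiLp.add_apply, PiLp.smul_apply, smul_eq_mul]
    fun_prop
  have hcoord : ∀ a, |Δ a| ≤ ‖Δ‖ := fun a => by
    simpa using PiLp.norm_apply_le Δ a
  have hjet : ∀ (a : WeightIndex d L r K) (C : ℝ), |(w + s • Δ) a| ≤ C → |Δ a| ≤ C * ‖Δ‖ →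
      JetBound 2 (fun s : ℝ => (w + s • Δ) a) s C ‖Δ‖ := by
    intro a C h1 h2
    have := JetBound.affine (k := 2) (x := s) (ContinuousLinearMap.toSpanSingleton ℝ (Δ a)) (w a)
      (C := C) (D := ‖Δ‖) (by simpa [add_comm] using h1) (by simpa using h2)
    simpa [add_comm] using this
  -- `C κ` bounds the outer weight and its speed relative to `‖Δ‖`; the bound for `∑ κ, C κ ^ 2`
  -- does not depend on `K`, so that by Cauchy-Schwarz `∑ κ, C κ` is only of order `√K`
  set C : Fin K → ℝ := fun κ => |outerWeight (w + s • Δ) κ| + |outerWeight Δ κ| / ‖Δ‖ with hC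
  have hC0 : ∀ κ, 0 ≤ C κ := fun κ => by positivity
  have hout : ∀ κ, JetBound 2 (fun s : ℝ => outerWeight (w + s • Δ) κ) s (C κ) ‖Δ‖ := fun κ =>
    hjet _ _ (by simp only [hC, outerWeight]; linarith [show 0 ≤ |Δ (Sum.inl κ)| / ‖Δ‖ by positivity])
      (by
        simp only [hC, outerWeight, add_mul, div_mul_cancel₀ _ hn.ne']
        linarith [show 0 ≤ |(w + s • Δ) (Sum.inl κ)| * ‖Δ‖ by positivity])
  have hΔsq : ∑ κ, (|outerWeight Δ κ| / ‖Δ‖) ^ 2 ≤ 1 := by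
    simp only [div_pow, sq_abs, ← Finset.sum_div]
    rw [div_le_one (by positivity), EuclideanSpace.real_norm_sq_eq, Fintype.sum_sum_type]
    exact le_add_of_nonneg_right (Finset.sum_nonneg fun _ _ => sq_nonneg _)
  have hCsq : ∑ κ, C κ ^ 2 ≤ 2 * U ^ 2 + 2 := by
    have : ∀ κ, C κ ^ 2 ≤ 2 * outerWeight (w + s • Δ) κ ^ 2 + 2 * (|outerWeight Δ κ| / ‖Δ‖) ^ 2 :=
      fun κ => by
        rw [← sq_abs (outerWeight (w + s • Δ) κ)]
        simp only [hC]
        nlinarith [sq_nonneg (|outerWeight (w + s • Δ) κ| - |outerWeight Δ κ| / ‖Δ‖)]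
    refine (Finset.sum_le_sum fun κ _ => this κ).trans ?_
    rw [Finset.sum_add_distrib, ← Finset.mul_sum, ← Finset.mul_sum]
    linarith [hw.outer]
  have hCsum : ∑ κ, C κ ≤ A := by
    have h1 : ∑ κ, |outerWeight Δ κ| / ‖Δ‖ ≤ √K := by
      apply Real.le_sqrt_of_sq_le
      have := sq_sum_le_card_mul_sum_sq (s := Finset.univ) (f := fun κ => |outerWeight Δ κ| / ‖Δ‖)
      simp only [Finset.card_univ, Fintype.card_fin] at this
      exact this.trans (mul_le_of_le_one_right (Nat.cast_nonneg _) hΔsq)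
    simp only [hC, Finset.sum_add_distrib, hA]
    linarith [hw.sum_abs_le hU]
  have hnet : ∀ x ∈ cube d α, JetBound 2 (fun s : ℝ => network (w + s • Δ) x) s
      (A * ((2 : ℕ).factorial * B)) (‖Δ‖ * (1 + Λ)) := fun x hx =>
    network_jet hB1 hB hI hX hH hn.le hsm (fun _ => contDiff_const) hout hCsum
      (fun κ i j => hjet _ _ (hw.input κ i j) ((hcoord _).trans (by nlinarith)))
      (fun κ l i j => hjet _ _ (hw.hidden κ l i j) ((hcoord _).trans (by nlinarith)))
      (fun j => JetBound.const _ hn.le (abs_le.2 ⟨by linarith [hx.1 j], (hx.2 j).trans hα⟩))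
  set P : ℝ := A * ((2 : ℕ).factorial * B) with hP
  have hP0 : 0 ≤ P := by positivity
  have hD : 0 ≤ ‖Δ‖ * (1 + Λ) := by positivity
  have hns : ∀ x, ContDiff ℝ ω fun s : ℝ => network (w + s • Δ) x :=
    fun x => network_contDiff hsm fun _ => contDiff_const
  have hterm : ∀ i, JetBound 2 (fun s : ℝ => (network (w + s • Δ) (data i).1 - (data i).2)
      * (network (w + s • Δ) (data i).1 - (data i).2)
        * (cube d α).indicator (fun _ => (1 : ℝ)) (data i).1) s
      (2 * P ^ 2 + 2 * (data i).2 ^ 2) (‖Δ‖ * (2 * (1 + Λ))) := by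
    intro i
    by_cases hx : (data i).1 ∈ cube d α
    · rw [Set.indicator_of_mem hx]
      simp only [mul_one]
      have h1 : JetBound 2 (fun s : ℝ => network (w + s • Δ) (data i).1 - (data i).2) s
          (P + |(data i).2|) (‖Δ‖ * (1 + Λ)) := by
        simpa only [sub_eq_add_neg] using (hnet _ hx).add
          (JetBound.const (k := 2) (x := s) (-(data i).2) hD (by rw [abs_neg])) (hns _)
          contDiff_const
      have h2 := h1.mul h1 ((hns _).sub contDiff_const) ((hns _).sub contDiff_const)
      refine h2.mono ?_ (by positivity) (by positivity) (le_of_eq (by ring))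
      rw [← sq_abs (data i).2]
      nlinarith [sq_nonneg (P - |(data i).2|)]
    · rw [Set.indicator_of_notMem hx]
      simp only [mul_zero]
      exact JetBound.const _ (by positivity) (by simp; positivity)
  simp only [risk_eq]
  have hts : ∀ i, ContDiff ℝ ω fun s : ℝ => (network (w + s • Δ) (data i).1 - (data i).2)
      * (network (w + s • Δ) (data i).1 - (data i).2)
        * (cube d α).indicator (fun _ => (1 : ℝ)) (data i).1 := fun i =>
    (((hns _).sub contDiff_const).mul ((hns _).sub contDiff_const)).mul contDiff_const
  have h1 := (JetBound.const (k := 2) (x := s) (D := 0) (1 / (n : ℝ)) le_rfl le_rfl).mul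
    (JetBound.sum (s := Finset.univ) (fun i _ => hterm i) fun i _ => hts i) contDiff_const
    (ContDiff.sum fun i _ => hts i)
  have h2 := (JetBound.const (k := 2) (x := s) (D := 0) c₂ le_rfl le_rfl).mul
    (JetBound.sum (s := Finset.univ) (fun κ _ => (hout κ).mul (hout κ) (hsm _) (hsm _))
      fun κ _ => (hsm _).mul (hsm _)) contDiff_const
    (ContDiff.sum fun κ _ => (hsm _).mul (hsm _))
  rw [zero_add] at h1 h2
  have hN : |1 / (n : ℝ)| * ∑ i, (2 * P ^ 2 + 2 * (data i).2 ^ 2) ≤ 2 * P ^ 2 + 2 * V := by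
    rw [abs_of_nonneg (by positivity), Finset.sum_add_distrib, mul_add,
      ← Finset.mul_sum (f := fun i => (data i).2 ^ 2), mul_left_comm]
    have h3 : 1 / (n : ℝ) * ∑ _i : Fin n, 2 * P ^ 2 ≤ 2 * P ^ 2 := by
      simp only [Finset.sum_const, Finset.card_univ, Fintype.card_fin, nsmul_eq_mul]
      rw [← mul_assoc]
      refine mul_le_of_le_one_left (by positivity) ?_
      rw [one_div]
      exact inv_mul_le_one
    linarith
  have hN2 : |c₂| * ∑ κ, C κ * C κ ≤ c₂ * (2 * U ^ 2 + 2) := by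
    rw [abs_of_nonneg hc₂]
    simp only [← sq]
    gcongr
  have hV0 : 0 ≤ V := le_trans (by positivity) hV
  exact (h1.mono hN (by positivity) (by positivity) le_rfl).add
    (h2.mono hN2 (by positivity) (by positivity) (by nlinarith [mul_nonneg hn.le hΛ0]))
    (contDiff_const.mul (ContDiff.sum fun i _ => hts i))
    (contDiff_const.mul (ContDiff.sum fun κ _ => (hsm _).mul (hsm _)))

/-- The descent inequality for the risk, on segments inside the region given by `WeightBound`. -/
lemma risk_descent {B X U I H V α c₂ : ℝ} (hc₂ : 0 ≤ c₂)
    (hB1 : 1 ≤ B) (hB : ∀ i ≤ 2, ∀ x : ℝ, ‖iteratedFDeriv ℝ i Real.sigmoid x‖ ≤ B)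
    (hI : 1 ≤ I) (hX : 1 ≤ X) (hH : 1 ≤ H) (hU : 0 ≤ U) (hα : α ≤ X)
    {data : Fin n → (Fin d → ℝ) × ℝ} (hV : 1 / (n : ℝ) * ∑ i, (data i).2 ^ 2 ≤ V)
    {w Δ : Weights d L r K} (hw : ∀ s ∈ Set.Icc (0 : ℝ) 1, WeightBound (w + s • Δ) U I H) :
    risk c₂ α data (w + Δ) ≤ risk c₂ α data w + inner ℝ (gradient (risk c₂ α data) w) Δ
      + smoothConst d L r K c₂ ((2 : ℕ).factorial * B) V X U I H * ‖Δ‖ ^ 2 := by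
  rcases eq_or_ne Δ 0 with rfl | hΔ
  · simp
  have hsm : ∀ a, ContDiff ℝ ω fun s : ℝ => (w + s • Δ) a := fun a => by
    simp only [PiLp.add_apply, PiLp.smul_apply, smul_eq_mul]
    fun_prop
  have := descent_of_second_derivative_bound (risk_contDiff c₂ α data hsm)
    (hasDerivAt_risk_line c₂ α data w Δ)
    (fun s hs => risk_jet_line hc₂ hB1 hB hI hX hH hU hα hV hΔ (hw s hs) 2 le_rfl)
  simp only [one_smul, zero_smul, add_zero] at this
  refine this.trans (le_of_eq ?_)
  rw [smoothConst, mul_pow]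
  ring

end Risk

/-! ### Gradient descent on the regularised risk -/

section Optimisation

variable {d L r K n : ℕ}

/-- What the analysis of gradient descent gives: the weights stay bounded; few coordinates move by
more than a given amount; and the final risk is compared with the risk at an arbitrary fixed choice
`u` of the outer weights, up to the cost `(∑ u ^ 2) / (lam * T)` of finding it. -/
theorem gradDescent_analysis {B X U I H I₀ H₀ V R α c₂ lam : ℝ} {T : ℕ} (hc₂ : 0 < c₂)
    (hB1 : 1 ≤ B) (hB : ∀ i ≤ 2, ∀ x : ℝ, ‖iteratedFDeriv ℝ i Real.sigmoid x‖ ≤ B)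
    (hI₀ : 0 ≤ I₀) (hH₀ : 0 ≤ H₀) (hR : 0 ≤ R) (hI : I₀ + R + 1 ≤ I) (hH : H₀ + R + 1 ≤ H)
    (hX : 1 ≤ X) (hα : α ≤ X) (hU : 0 ≤ U) (hUV : 2 * (V / c₂) + 2 ≤ U ^ 2)
    {data : Fin n → (Fin d → ℝ) × ℝ} (hV : 1 / (n : ℝ) * ∑ i, (data i).2 ^ 2 ≤ V)
    {w₀ : Weights d L r K} (h0 : ∀ κ, outerWeight w₀ κ = 0)
    (h0I : ∀ κ i j, |inputWeight w₀ κ i j| ≤ I₀) (h0H : ∀ κ l i j, |hiddenWeight w₀ κ l i j| ≤ H₀)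
    (hlam : 0 < lam) (hT : 0 < T)
    (hlamM : lam * (V + 2 * smoothConst d L r K c₂ ((2 : ℕ).factorial * B) V X U I H) ≤ 1)
    (hTR : 2 * (lam * T) * V ≤ R ^ 2) :
    (∀ t ≤ T, WeightBound (gradDescent c₂ α lam data w₀ t) U I H) ∧
    (∀ δ > 0, ∀ A : Finset (WeightIndex d L r K),
      (∀ a ∈ A, ∃ t ≤ T, δ < |gradDescent c₂ α lam data w₀ t a - w₀ a|) →
        (A.card : ℝ) * δ ^ 2 ≤ R ^ 2) ∧
    (∀ (u : Fin K → ℝ) (Ξ : ℝ),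
      (∀ t < T, risk c₂ α data (replaceOuter (gradDescent c₂ α lam data w₀ t) u) ≤ Ξ) →
        risk c₂ α data (gradDescent c₂ α lam data w₀ T)
          ≤ Ξ + (∑ κ, u κ ^ 2 + 2 * lam * V) / (2 * (lam * T))) := by
  set w := gradDescent c₂ α lam data w₀ with hw
  set F : Weights d L r K → ℝ := risk c₂ α data with hF
  set M := smoothConst d L r K c₂ ((2 : ℕ).factorial * B) V X U I H with hMdef
  have hV0 : 0 ≤ V := le_trans (by positivity) hV
  have hM : 0 ≤ M := by
    rw [hMdef, smoothConst]; positivity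
  have hF0 : F (w 0) ≤ V := (risk_le_of_outer_eq_zero α data h0).trans hV
  have hFnn : ∀ v, 0 ≤ F v := risk_nonneg hc₂.le α data
  have hcoord : ∀ (v : Weights d L r K) a, |v a| ≤ ‖v‖ := fun v a => by
    simpa using PiLp.norm_apply_le v a
  -- below the initial risk the regularisation bounds the outer weights
  have hreg : ∀ v, F v ≤ F (w 0) → ‖v - w 0‖ ≤ R → ∀ Δ : Weights d L r K, ‖Δ‖ ≤ 1 →
      WeightBound (v + Δ) U I H := by
    intro v h1 h2 Δ h3
    have hmove : ∀ a, |(v + Δ) a| ≤ |w₀ a| + R + 1 := fun a => by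
      have : (v + Δ) a = w₀ a + (v - w 0) a + Δ a := by
        simp [hw, gradDescent]
      rw [this]
      have h4 := (hcoord (v - w 0) a).trans h2
      have h5 := (hcoord Δ a).trans h3
      exact (abs_add_three _ _ _).trans (by linarith)
    refine ⟨?_, fun κ i j => (hmove _).trans ?_, fun κ l i j => (hmove _).trans ?_⟩
    · have h4 : ∑ κ, outerWeight v κ ^ 2 ≤ V / c₂ := by
        rw [le_div_iff₀ hc₂, mul_comm]
        exact (outer_le_risk α data v).trans (h1.trans hF0)
      have h5 : ∑ κ, outerWeight Δ κ ^ 2 ≤ 1 := by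
        refine le_trans ?_ (pow_le_one₀ (n := 2) (norm_nonneg Δ) h3)
        rw [EuclideanSpace.real_norm_sq_eq, Fintype.sum_sum_type]
        exact le_add_of_nonneg_right (Finset.sum_nonneg fun _ _ => sq_nonneg _)
      have h6 : ∀ κ, outerWeight (v + Δ) κ ^ 2 ≤ 2 * outerWeight v κ ^ 2 + 2 * outerWeight Δ κ ^ 2 :=
        fun κ => by
          simp only [outerWeight, PiLp.add_apply]
          nlinarith [sq_nonneg (v (Sum.inl κ) - Δ (Sum.inl κ))]
      refine (Finset.sum_le_sum fun κ _ => h6 κ).trans ?_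
      rw [Finset.sum_add_distrib, ← Finset.mul_sum, ← Finset.mul_sum]
      linarith
    · linarith [h0I κ i j, show |inputWeight w₀ κ i j| = |w₀ (Sum.inr (Sum.inl (κ, i, j)))| from rfl]
    · linarith [h0H κ l i j,
        show |hiddenWeight w₀ κ l i j| = |w₀ (Sum.inr (Sum.inr (κ, l, i, j)))| from rfl]
  have hdesc : ∀ v, F v ≤ F (w 0) → ‖v - w 0‖ ≤ R → ∀ Δ : Weights d L r K, ‖Δ‖ ≤ 1 →
      F (v + Δ) ≤ F v + inner ℝ (gradient F v) Δ + 2 * M / 2 * ‖Δ‖ ^ 2 := by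
    intro v h1 h2 Δ h3
    rw [mul_div_cancel_left₀ _ (two_ne_zero)]
    refine risk_descent hc₂.le hB1 hB (by linarith) hX (by linarith) hU hα hV fun s hs => ?_
    refine hreg v h1 h2 _ ?_
    rw [norm_smul, Real.norm_of_nonneg hs.1]
    exact mul_le_one₀ hs.2 (norm_nonneg _) h3
  have hstep : ∀ t, w (t + 1) = w t - lam • gradient F (w t) := fun t => rfl
  have hen := descent_energy hFnn (by positivity) hR hlam hdesc
    (le_trans (by gcongr) hlamM) hstep (T := T) (le_trans (by gcongr) hTR)
  have hfin := hen T le_rfl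
  refine ⟨fun t ht => ?_, fun δ hδ A hA => ?_, fun u Ξ hΞ => ?_⟩
  · have h1 := hen t ht
    simpa using hreg (w t) (h1.2.2 0 (Nat.zero_le _)) h1.2.1 0 (by simp)
  · refine card_moved_coordinates_le (F₀ := F (w 0)) hlam hδ hstep ?_ (le_trans (by gcongr) hTR) A hA
    linarith [hfin.1, hFnn (w T)]
  · refine (descent_regret hFnn hlam hT hstep (risk_convex_outer hc₂.le α data)
      (fun t ht => (hen t ht).1) (fun t ht => hfin.2.2 t ht.le) h0 hΞ).trans ?_
    gcongr

end Optimisation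

/-! ### Density of the networks in `L²` -/

section Density

variable {d L r : ℕ}

/-- Cybenko's theorem in dual form: an integrable function that annihilates all ridge
functions of a sigmoidal `ψ` annihilates all half-spaces. Hence its positive and negative parts
define measures with the same images under linear functionals, so with the same characteristic
function. -/
lemma ae_eq_zero_of_forall_integral_ridge {E : Type*} [NormedAddCommGroup E] [NormedSpace ℝ E]
    [MeasurableSpace E] [BorelSpace E] [SecondCountableTopology E] [CompleteSpace E]
    {μ : Measure E} {g : E → ℝ} (hg : Integrable g μ) {ψ : ℝ → ℝ} {a b : ℝ} (hψ : Continuous ψ)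
    (hψ1 : ∀ t, |ψ t| ≤ 1) (htop : Tendsto ψ atTop (𝓝 a)) (hbot : Tendsto ψ atBot (𝓝 b))
    (hab : b ≠ a) (hψ0 : ψ 0 ≠ 0)
    (h : ∀ (ℓ : StrongDual ℝ E) (c : ℝ), ∫ x, g x * ψ (ℓ x + c) ∂μ = 0) :
    g =ᵐ[μ] 0 := by
  have huniv : ∫ x, g x ∂μ = 0 := by
    have := h 0 0
    simpa [integral_mul_const, hψ0] using this
  have hhalf : ∀ (ℓ : StrongDual ℝ E) (c : ℝ), ∫ x in {x | ℓ x ≤ c}, g x ∂μ = 0 := by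
    intro ℓ c
    have hms : MeasurableSet {x | ℓ x ≤ c} := measurableSet_le ℓ.measurable measurable_const
    -- the shift by `√n` puts the boundary `ℓ x = c` on the side where `ψ` tends to `b`
    have hlim : Tendsto (fun n : ℕ => ∫ x, g x * ψ (((n : ℝ) • ℓ) x + (-(n * c) - √n)) ∂μ) atTop
        (𝓝 (∫ x, ({x | ℓ x ≤ c}.indicator (fun x => b * g x) x
          + {x | ℓ x ≤ c}ᶜ.indicator (fun x => a * g x) x) ∂μ)) := by
      refine tendsto_integral_of_dominated_convergence (fun x => ‖g x‖) (fun n => ?_) hg.norm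
        (fun n => Eventually.of_forall fun x => ?_) (Eventually.of_forall fun x => ?_)
      · exact hg.aestronglyMeasurable.mul
          (hψ.comp (((n : ℝ) • ℓ).continuous.add continuous_const)).aestronglyMeasurable
      · rw [norm_mul]
        exact mul_le_of_le_one_right (norm_nonneg _) (hψ1 _)
      · have hsq : Tendsto (fun n : ℕ => √(n : ℝ)) atTop atTop :=
          Real.tendsto_sqrt_atTop.comp tendsto_natCast_atTop_atTop
        have harg : ∀ n : ℕ, ((n : ℝ) • ℓ) x + (-(n * c) - √n) = √n * (√n * (ℓ x - c) - 1) := by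
          intro n
          have : (n : ℝ) = √n * √n := (Real.mul_self_sqrt (Nat.cast_nonneg n)).symm
          simp only [smul_apply, smul_eq_mul]
          linear_combination (ℓ x - c) * this
        simp only [harg]
        by_cases hx : ℓ x ≤ c
        · have : Tendsto (fun n : ℕ => √(n : ℝ) * (√n * (ℓ x - c) - 1)) atTop atBot := by
            refine tendsto_atBot_mono (fun n => ?_) (tendsto_neg_atTop_atBot.comp hsq)
            have := Real.sqrt_nonneg (n : ℝ)
            simp only [Function.comp]
            nlinarith [mul_nonneg (mul_nonneg this this) (sub_nonneg.2 hx)]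
          have := (hbot.comp this).const_mul (g x)
          simpa [hx, mul_comm] using this
        · push Not at hx
          have h1 : Tendsto (fun n : ℕ => √(n : ℝ) * (√n * (ℓ x - c) - 1)) atTop atTop :=
            hsq.atTop_mul_atTop₀ (tendsto_atTop_add_const_right _ _
              (hsq.atTop_mul_const (sub_pos.2 hx)))
          have := (htop.comp h1).const_mul (g x)
          simpa [hx.not_ge, mul_comm] using this
    simp only [h] at hlim
    have h0 := tendsto_nhds_unique hlim tendsto_const_nhds
    rw [integral_add ((hg.const_mul b).indicator hms) ((hg.const_mul a).indicator hms.compl),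
      integral_indicator hms, integral_indicator hms.compl, integral_const_mul,
      integral_const_mul] at h0
    have h1 := integral_add_compl hms hg
    rw [huniv] at h1
    have h2 : (b - a) * ∫ x in {x | ℓ x ≤ c}, g x ∂μ = 0 := by linear_combination h0 - a * h1
    exact (mul_eq_zero.1 h2).resolve_left (sub_ne_zero.2 hab)
  have hfin : ∀ f : E → ℝ, Integrable f μ → ∫⁻ x, ENNReal.ofReal (f x) ∂μ ≠ ⊤ := fun f hf =>
    ((lintegral_mono fun x => Real.ofReal_le_enorm (f x)).trans_lt hf.2).ne
  set μp := μ.withDensity fun x => ENNReal.ofReal (g x)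
  set μm := μ.withDensity fun x => ENNReal.ofReal (-g x)
  have : IsFiniteMeasure μp := isFiniteMeasure_withDensity (hfin g hg)
  have : IsFiniteMeasure μm := isFiniteMeasure_withDensity (hfin _ hg.neg)
  have hmap : ∀ ℓ : StrongDual ℝ E, μp.map ℓ = μm.map ℓ := by
    intro ℓ
    refine Measure.ext_of_Iic _ _ fun c => ?_
    have hms : MeasurableSet {x | ℓ x ≤ c} := measurableSet_le ℓ.measurable measurable_const
    rw [Measure.map_apply ℓ.measurable measurableSet_Iic,
      Measure.map_apply ℓ.measurable measurableSet_Iic]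
    change μp {x | ℓ x ≤ c} = μm {x | ℓ x ≤ c}
    rw [withDensity_apply _ hms, withDensity_apply _ hms]
    have h1 := hhalf ℓ c
    rw [integral_eq_lintegral_pos_part_sub_lintegral_neg_part hg.integrableOn, sub_eq_zero,
      ENNReal.toReal_eq_toReal_iff'] at h1
    · exact h1
    · exact ((setLIntegral_le_lintegral _ _).trans_lt (hfin g hg).lt_top).ne
    · exact ((setLIntegral_le_lintegral _ _).trans_lt (hfin _ hg.neg).lt_top).ne
  have hμ : μp = μm := by
    refine Measure.ext_of_charFunDual (funext fun ℓ => ?_)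
    rw [charFunDual_eq_charFun_map_one, charFunDual_eq_charFun_map_one, hmap]
  have hm : AEMeasurable g μ := hg.aestronglyMeasurable.aemeasurable
  have := (withDensity_eq_iff hm.ennreal_ofReal hm.neg.ennreal_ofReal (hfin g hg)).1 hμ
  filter_upwards [this] with x hx
  simp only [Pi.neg_apply] at hx
  rcases le_total 0 (g x) with h1 | h1
  · rw [ENNReal.ofReal_of_nonpos (by linarith : -g x ≤ 0)] at hx
    exact le_antisymm (ENNReal.ofReal_eq_zero.1 hx) h1
  · rw [ENNReal.ofReal_of_nonpos h1] at hx
    have := ENNReal.ofReal_eq_zero.1 hx.symm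
    simp only [Pi.zero_apply]
    linarith

lemma iterate_sigmoid_limits (l : ℕ) : ∃ a b : ℝ, b < a ∧
    Tendsto (Real.sigmoid^[l + 1]) atTop (𝓝 a) ∧ Tendsto (Real.sigmoid^[l + 1]) atBot (𝓝 b) := by
  induction l with
  | zero => exact ⟨1, 0, one_pos, by simpa using Real.tendsto_sigmoid_atTop,
      by simpa using Real.tendsto_sigmoid_atBot⟩
  | succ l ih =>
    obtain ⟨a, b, hab, ha, hb⟩ := ih
    refine ⟨Real.sigmoid a, Real.sigmoid b, Real.sigmoid_strictMono hab, ?_, ?_⟩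
    · rw [Function.iterate_succ']
      exact (continuous_sigmoid.tendsto a).comp ha
    · rw [Function.iterate_succ']
      exact (continuous_sigmoid.tendsto b).comp hb

/-- The weights of a single network that computes `σ (σ (⋯ σ (p · x + c)))`: each hidden neuron
copies the first neuron of the layer below. -/
noncomputable def ridgeWeights (L r : ℕ) (p : Fin d → ℝ) (c : ℝ) : Weights d L r 1 :=
  WithLp.toLp 2 (Sum.elim (fun _ => 0) (Sum.elim (fun q => Fin.cases c p q.2.2)
    fun q => if (q.2.2.2 : ℕ) = 1 then 1 else 0))

lemma subnet_ridgeWeights (hr : 0 < r) (p : Fin d → ℝ) (c : ℝ) (x : Fin d → ℝ) :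
    subnet (ridgeWeights L r p c) x 0 = Real.sigmoid^[L - 1 + 1] (∑ j, p j * x j + c) := by
  have : ∀ (l : ℕ) (hl : l ≤ L - 1) i, neuron (ridgeWeights L r p c) x 0 l hl i
      = Real.sigmoid^[l + 1] (∑ j, p j * x j + c) := by
    intro l hl
    induction l with
    | zero => intro i; simp [neuron, inputWeight, ridgeWeights]
    | succ l ih =>
      intro i
      rw [Function.iterate_succ_apply']
      have hw : ∀ j : Fin (r + 1), hiddenWeight (ridgeWeights L r p c) 0 ⟨l, hl⟩ i j
          = if (j : ℕ) = 1 then 1 else 0 := fun j => rfl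
      simp only [neuron, ih, hw]
      have hsum : ∑ j : Fin r, (if ((j.succ : Fin (r + 1)) : ℕ) = 1 then (1 : ℝ) else 0) = 1 := by
        rw [Finset.sum_eq_single (⟨0, hr⟩ : Fin r)]
        · simp
        · intro j _ hj
          have : (j : ℕ) ≠ 0 := fun h => hj (Fin.ext h)
          simp [this]
        · simp
      rw [← Finset.sum_mul, hsum]
      simp
  rw [subnet, dif_pos hr, this]

lemma continuous_subnet {K : ℕ} (w : Weights d L r K) (κ : Fin K) :
    Continuous fun x => subnet w x κ :=
  (subnet_contDiff (E := Fin d → ℝ) (w := fun _ => w) (ξ := fun x => x) (fun _ => contDiff_const)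
    fun j => contDiff_apply ℝ ℝ j).continuous

lemma memLp_subnet {K : ℕ} (μ : Measure (Fin d → ℝ)) [IsFiniteMeasure μ] (w : Weights d L r K)
    (κ : Fin K) : MemLp (fun x => subnet w x κ) 2 μ :=
  MemLp.of_bound (continuous_subnet w κ).aestronglyMeasurable 1 (Eventually.of_forall fun x => by
    have := subnet_mem_Icc w x κ
    rw [Real.norm_of_nonneg this.1]; exact this.2)

/-- Linear combinations of networks are dense in `L²`. -/
theorem exists_subnet_combination_approx (hr : 0 < r) (μ : Measure (Fin d → ℝ)) [IsFiniteMeasure μ]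
    (L : ℕ) {m : (Fin d → ℝ) → ℝ} (hm : MemLp m 2 μ) {ε : ℝ} (hε : 0 < ε) :
    ∃ (J : ℕ) (a : Fin J → ℝ) (v : Fin J → Weights d L r 1),
      ∫ x, (∑ j, a j * subnet (v j) x 0 - m x) ^ 2 ∂μ ≤ ε := by
  set φ : Weights d L r 1 → Lp ℝ 2 μ := fun v => (memLp_subnet μ v 0).toLp _ with hφ
  set V := Submodule.span ℝ (Set.range φ) with hV
  have hbot : Vᗮ = ⊥ := by
    rw [Submodule.eq_bot_iff]
    intro g hg
    have horth : ∀ v : Weights d L r 1, ∫ x, g x * subnet v x 0 ∂μ = 0 := by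
      intro v
      have h1 := (Submodule.mem_orthogonal V g).1 hg (φ v) (Submodule.subset_span ⟨v, rfl⟩)
      rw [L2.inner_def] at h1
      rw [← h1]
      refine integral_congr_ae ?_
      filter_upwards [(memLp_subnet μ v 0).coeFn_toLp] with x hx
      simp only [hφ]
      rw [hx]
      simp
    obtain ⟨a, b, hab, ha, hb⟩ := iterate_sigmoid_limits (L - 1)
    have hcont : Continuous (Real.sigmoid^[L - 1 + 1]) := continuous_sigmoid.iterate _
    have hval : ∀ t, 0 < Real.sigmoid^[L - 1 + 1] t ∧ Real.sigmoid^[L - 1 + 1] t ≤ 1 := fun t => by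
      rw [Function.iterate_succ_apply']
      exact ⟨Real.sigmoid_pos _, Real.sigmoid_le_one _⟩
    have hg1 : Integrable g μ := (Lp.memLp g).integrable (by norm_num)
    have := ae_eq_zero_of_forall_integral_ridge hg1 hcont
      (fun t => by rw [abs_of_pos (hval t).1]; exact (hval t).2) ha hb hab.ne (hval 0).1.ne'
      (fun ℓ c => by
        rw [← horth (ridgeWeights L r (fun j => ℓ (Pi.single j 1)) c)]
        congr 1
        ext x
        rw [subnet_ridgeWeights hr]
        congr 3
        conv_lhs => rw [← Finset.univ_sum_single x, map_sum]
        refine Finset.sum_congr rfl fun j _ => ?_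
        have : Pi.single j (x j) = x j • (Pi.single j 1 : Fin d → ℝ) := by
          rw [← Pi.single_smul, smul_eq_mul, mul_one]
        rw [this, map_smul, smul_eq_mul, mul_comm])
    exact (Lp.eq_zero_iff_ae_eq_zero).2 this
  have htop : V.topologicalClosure = ⊤ := Submodule.topologicalClosure_eq_top_iff.2 hbot
  have hmem : hm.toLp m ∈ closure (V : Set (Lp ℝ 2 μ)) := by
    rw [← Submodule.topologicalClosure_coe, htop]; trivial
  obtain ⟨h, hhV, hdist⟩ := Metric.mem_closure_iff.1 hmem (√ε) (Real.sqrt_pos.2 hε)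
  obtain ⟨J, a, v, hsum⟩ := Submodule.mem_span_set'.1 hhV
  choose u hu using fun i => (v i).2
  refine ⟨J, a, u, ?_⟩
  have hae : ∀ᵐ x ∂μ, (h - hm.toLp m) x = ∑ j, a j * subnet (u j) x 0 - m x := by
    have h1 : ∀ᵐ x ∂μ, ∀ j, φ (u j) x = subnet (u j) x (0 : Fin 1) :=
      ae_all_iff.2 fun j => (memLp_subnet μ (u j) 0).coeFn_toLp
    have h2 : ∀ᵐ x ∂μ, (∑ j, a j • φ (u j) : Lp ℝ 2 μ) x = ∑ j, (a j • φ (u j) : Lp ℝ 2 μ) x := by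
      filter_upwards [Lp.coeFn_fun_finsetSum Finset.univ fun j => a j • φ (u j)] with x hx
      exact hx
    have h3 : ∀ᵐ x ∂μ, ∀ j, (a j • φ (u j) : Lp ℝ 2 μ) x = a j * φ (u j) x :=
      ae_all_iff.2 fun j => Lp.coeFn_smul (a j) (φ (u j))
    have hh : h = ∑ j, a j • φ (u j) := by rw [← hsum]; simp only [hu]
    filter_upwards [Lp.coeFn_sub h (hm.toLp m), hm.coeFn_toLp, h1, h2, h3] with x e0 e1 e2 e3 e4
    rw [e0, Pi.sub_apply, e1, hh, e3]
    simp only [e4, e2]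
  have hnorm : ‖h - hm.toLp m‖ ^ 2 ≤ ε := by
    rw [← Real.sq_sqrt hε.le]
    rw [dist_comm, dist_eq_norm] at hdist
    gcongr
  rw [← real_inner_self_eq_norm_sq, L2.inner_def] at hnorm
  refine le_trans (le_of_eq (integral_congr_ae ?_)) hnorm
  filter_upwards [hae] with x hx
  rw [hx]
  simp [sq]

end Density

/-! ### The random initial weights -/

section Init

variable {Ω : Type*} [MeasurableSpace Ω] {P : Measure Ω} {d L r K n : ℕ}

lemma IsUniform_ae_abs_le {X : Ω → ℝ} {ρ : ℝ} (hρ : 0 < ρ)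
    (h : pdf.IsUniform X (Set.Icc (-ρ) ρ) P volume) : ∀ᵐ ω ∂P, |X ω| ≤ ρ := by
  have h1 := h.measure_preimage (by simp; linarith) (by simp)
    (measurableSet_Icc (a := -ρ) (b := ρ)).compl
  rw [Set.inter_compl_self, measure_empty, ENNReal.zero_div] at h1
  rw [ae_iff]
  convert h1 using 2
  ext ω
  simp [abs_le]

lemma IsUniform_real_abs_sub_le {X : Ω → ℝ} {ρ c δ : ℝ} (hδ : 0 < δ) (hc : |c| + δ ≤ ρ)
    (h : pdf.IsUniform X (Set.Icc (-ρ) ρ) P volume) : P.real {ω | |X ω - c| ≤ δ} = δ / ρ := by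
  have hρ : 0 < ρ := by have := abs_nonneg c; linarith
  have h1 := h.measure_preimage (by simp; linarith) (by simp)
    (measurableSet_Icc (a := c - δ) (b := c + δ))
  have hset : {ω | |X ω - c| ≤ δ} = X ⁻¹' Set.Icc (c - δ) (c + δ) := by
    ext ω
    simp only [Set.mem_ofPred_eq, abs_le, Set.mem_preimage, Set.mem_Icc]
    constructor <;> rintro ⟨h1, h2⟩ <;> constructor <;> linarith
  have hsub : Set.Icc (c - δ) (c + δ) ⊆ Set.Icc (-ρ) ρ :=
    Set.Icc_subset_Icc (by linarith [neg_abs_le c]) (by linarith [le_abs_self c])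
  rw [measureReal_def, hset, h1, Set.inter_eq_self_of_subset_right hsub, Real.volume_Icc,
    Real.volume_Icc, ENNReal.toReal_div, ENNReal.toReal_ofReal (by linarith),
    ENNReal.toReal_ofReal (by linarith)]
  field_simp
  ring

/-- The index set of the weights of a single network of the linear combination, without its outer
weight. -/
abbrev BlockIndex (d L r : ℕ) : Type :=
  (Fin r × Fin (d + 1)) ⊕ (Fin (L - 1) × Fin r × Fin (r + 1))

/-- The position of a weight of the `κ`-th network among all weights. -/
def blockIndex (κ : Fin K) : BlockIndex d L r → WeightIndex d L r K :=
  Sum.elim (fun q => Sum.inr (Sum.inl (κ, q))) fun q => Sum.inr (Sum.inr (κ, q))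

lemma blockIndex_eq_iff {κ κ' : Fin K} {b b' : BlockIndex d L r} :
    blockIndex κ b = blockIndex κ' b' ↔ κ = κ' ∧ b = b' := by
  rcases b with b | b <;> rcases b' with b' | b' <;> simp [blockIndex]

/-- The weights of the `κ`-th network of `w` differ by at most `δ` from those of `v`. -/
def BlockClose (w : Weights d L r K) (v : Weights d L r 1) (δ : ℝ) (κ : Fin K) : Prop :=
  ∀ b, |w (blockIndex κ b) - v (blockIndex 0 b)| ≤ δ

/-- The probability that an initial network is `δ`-close to a given one, when the input weights are
uniform on `[-ρ₁, ρ₁]` and the hidden weights on `[-ρ₂, ρ₂]`. -/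
noncomputable def closeProb (d L r : ℕ) (δ ρ₁ ρ₂ : ℝ) : ℝ :=
  (δ / ρ₁) ^ (r * (d + 1)) * (δ / ρ₂) ^ ((L - 1) * (r * (r + 1)))

variable {τ δ : ℝ} {W : Ω → Weights d L r K} {v : Weights d L r 1}

lemma measurable_coord (hW : Measurable W) (a : WeightIndex d L r K) :
    Measurable (fun ω => W ω a : Ω → ℝ) :=
  (EuclideanSpace.proj a : Weights d L r K →L[ℝ] ℝ).measurable.comp hW

lemma measurableSet_blockClose (hW : Measurable W) (κ : Fin K) :
    MeasurableSet {ω | BlockClose (W ω) v δ κ} := by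
  simp only [BlockClose, Set.ofPred_forall]
  refine MeasurableSet.iInter fun b => ?_
  have h : Measurable (fun ω => W ω (blockIndex κ b) : Ω → ℝ) := measurable_coord hW _
  exact measurableSet_le (by fun_prop) measurable_const

lemma real_blockClose (hW : IsRandomInit P n τ W) (hδ : 0 < δ)
    (hv1 : ∀ b, |v (blockIndex 0 (Sum.inl b))| + δ ≤ (n : ℝ) ^ τ)
    (hv2 : ∀ b, |v (blockIndex 0 (Sum.inr b))| + δ ≤ 20 * (d : ℝ) * Real.log n ^ 2) (κ : Fin K) :
    P.real {ω | BlockClose (W ω) v δ κ}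
      = closeProb d L r δ ((n : ℝ) ^ τ) (20 * (d : ℝ) * Real.log n ^ 2) := by
  have hind : iIndepFun (fun (b : BlockIndex d L r) ω => W ω (blockIndex κ b)) P :=
    hW.indep.precomp (g := blockIndex κ) fun b b' h => (blockIndex_eq_iff.1 h).2
  have h1 := hind.measure_inter_preimage_eq_mul Finset.univ
    (sets := fun b => {t | |t - v (blockIndex 0 b)| ≤ δ})
    (fun b _ => measurableSet_le (by fun_prop) measurable_const)
  have hset : {ω | BlockClose (W ω) v δ κ}
      = ⋂ b ∈ Finset.univ, (fun ω => W ω (blockIndex κ b)) ⁻¹'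
        {t | |t - v (blockIndex 0 b)| ≤ δ} := by
    ext ω; simp [BlockClose]
  rw [measureReal_def, hset, h1, ENNReal.toReal_prod, Fintype.prod_sum_type, closeProb]
  congr 1
  · have : r * (d + 1) = (Finset.univ : Finset (Fin r × Fin (d + 1))).card := by simp
    rw [this, ← Finset.prod_const]
    exact Finset.prod_congr rfl fun b _ =>
      IsUniform_real_abs_sub_le hδ (hv1 b) (hW.input κ b.1 b.2)
  · have : (L - 1) * (r * (r + 1))
        = (Finset.univ : Finset (Fin (L - 1) × Fin r × Fin (r + 1))).card := by
      simp
    rw [this, ← Finset.prod_const]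
    exact Finset.prod_congr rfl fun b _ =>
      IsUniform_real_abs_sub_le hδ (hv2 b) (hW.hidden κ b.1 b.2.1 b.2.2)

/-- Distinct networks depend on disjoint sets of independent weights. -/
lemma indepFun_blockClose (hW : IsRandomInit P n τ W) {κ κ' : Fin K} (hκ : κ ≠ κ') :
    IndepFun ({ω | BlockClose (W ω) v δ κ}.indicator fun _ => (1 : ℝ))
      ({ω | BlockClose (W ω) v δ κ'}.indicator fun _ => (1 : ℝ)) P := by
  classical
  set S : Fin K → Finset (WeightIndex d L r K) := fun κ => Finset.univ.image (blockIndex κ) with hS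
  have hmem : ∀ κ (b : BlockIndex d L r), blockIndex κ b ∈ S κ := fun κ b => by simp [hS]
  have hdisj : Disjoint (S κ) (S κ') := by
    rw [Finset.disjoint_left]
    simp only [hS, Finset.mem_image, Finset.mem_univ, true_and, not_exists]
    rintro _ ⟨b, rfl⟩ b' h
    exact hκ (blockIndex_eq_iff.1 h).1.symm
  have h1 := hW.indep.indepFun_finset (S κ) (S κ') hdisj fun a => measurable_coord hW.measurable a
  set A : ∀ κ, Set (S κ → ℝ) :=
    fun κ => {u | ∀ b, |u ⟨blockIndex κ b, hmem κ b⟩ - v (blockIndex 0 b)| ≤ δ} with hA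
  have hAm : ∀ κ, MeasurableSet (A κ) := fun κ => by
    simp only [hA, Set.ofPred_forall]
    exact MeasurableSet.iInter fun b => measurableSet_le (by fun_prop) measurable_const
  have hφ : ∀ κ, Measurable ((A κ).indicator fun _ => (1 : ℝ)) := fun κ =>
    measurable_const.indicator (hAm κ)
  exact h1.comp (hφ κ) (hφ κ')

/-- Chebyshev's inequality: at least half of the expected number of initial networks are close to a
given network, except with probability at most `4` divided by the expected number. -/
lemma prob_few_blockClose_le [IsProbabilityMeasure P] (hW : IsRandomInit P n τ W) (hδ : 0 < δ)
    (hv1 : ∀ b, |v (blockIndex 0 (Sum.inl b))| + δ ≤ (n : ℝ) ^ τ)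
    (hv2 : ∀ b, |v (blockIndex 0 (Sum.inr b))| + δ ≤ 20 * (d : ℝ) * Real.log n ^ 2)
    {q : ℝ} (hq : 0 < q)
    (hqK : q = K * closeProb d L r δ ((n : ℝ) ^ τ) (20 * (d : ℝ) * Real.log n ^ 2)) :
    P {ω | ({κ | BlockClose (W ω) v δ κ}.ncard : ℝ) < q / 2} ≤ ENNReal.ofReal (4 / q) := by
  classical
  set p := closeProb d L r δ ((n : ℝ) ^ τ) (20 * (d : ℝ) * Real.log n ^ 2) with hp
  set f : Fin K → Ω → ℝ := fun κ => {ω | BlockClose (W ω) v δ κ}.indicator fun _ => (1 : ℝ) with hf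
  have hms := fun κ => measurableSet_blockClose (v := v) (δ := δ) hW.measurable κ
  have hL2 : ∀ κ, MemLp (f κ) 2 P := fun κ => (memLp_const 1).indicator (hms κ)
  have hE : ∀ κ, ∫ ω, f κ ω ∂P = p := fun κ => by
    rw [hf, integral_indicator_const _ (hms κ), real_blockClose hW hδ hv1 hv2, smul_eq_mul,
      mul_one]
  have hcard : ∀ ω, (∑ κ, f κ) ω = ({κ | BlockClose (W ω) v δ κ}.ncard : ℝ) := fun ω => by
    rw [Finset.sum_apply, Set.ncard_eq_toFinset_card']
    simp [hf, Set.indicator_apply, Finset.sum_boole]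
  have hEsum : ∫ ω, (∑ κ, f κ) ω ∂P = q := by
    simp only [Finset.sum_apply]
    rw [integral_finsetSum _ fun κ _ => (hL2 κ).integrable (by norm_num)]
    simp [hE, hqK]
  have hvar : variance (∑ κ, f κ) P ≤ q := by
    rw [IndepFun.variance_sum (fun κ _ => hL2 κ) fun κ _ κ' _ h => indepFun_blockClose hW h]
    have : ∀ κ, variance (f κ) P ≤ p := fun κ => by
      refine (variance_le_expectation_sq (hL2 κ).aestronglyMeasurable).trans (le_of_eq ?_)
      rw [← hE κ]
      congr 1
      ext ω
      by_cases h : BlockClose (W ω) v δ κ <;> simp [hf, h]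
    refine (Finset.sum_le_sum fun κ _ => this κ).trans ?_
    simp [hqK]
  have hch := meas_ge_le_variance_div_sq (memLp_finsetSum' Finset.univ fun κ _ => hL2 κ)
    (half_pos hq)
  refine (measure_mono fun ω hω => ?_).trans (hch.trans (ENNReal.ofReal_le_ofReal ?_))
  · simp only [Set.mem_ofPred_eq] at hω ⊢
    rw [hEsum, hcard, abs_sub_comm]
    exact le_trans (by linarith) (le_abs_self _)
  · rw [div_le_div_iff₀ (by positivity) hq]
    nlinarith

end Init

/-! ### Covering of classes of smooth functions -/

section Cover

open scoped ContDiff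

/-- In a finite-dimensional space the vectors can be rounded at the scale `η` so that vectors of
norm at most `R` take a number of values that is polynomial in `R / η`. -/
lemma exists_rounding (V : Type*) [NormedAddCommGroup V] [NormedSpace ℝ V]
    [FiniteDimensional ℝ V] :
    ∃ (N : ℕ) (C : ℝ), 0 ≤ C ∧ ∀ η > 0, ∃ code : V → Fin N → ℤ,
      (∀ v v', code v = code v' → ‖v - v'‖ ≤ η) ∧
      ∀ R v, ‖v‖ ≤ R → ∀ i, |(code v i : ℝ)| ≤ C * R / η + 1 := by
  set N := Module.finrank ℝ V
  let e : V ≃L[ℝ] (Fin N → ℝ) := ContinuousLinearEquiv.ofFinrankEq (by simp [N])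
  set b : ℝ := ‖(e.symm : (Fin N → ℝ) →L[ℝ] V)‖ + 1 with hb
  have hb0 : 0 < b := by positivity
  refine ⟨N, ‖(e : V →L[ℝ] (Fin N → ℝ))‖ * b, by positivity, fun η hη =>
    ⟨fun v i => ⌊e v i / (η / b)⌋, fun v v' h => ?_, fun R v hv i => ?_⟩⟩
  · have h1 : ‖e v - e v'‖ ≤ η / b := by
      rw [pi_norm_le_iff_of_nonneg (by positivity)]
      intro i
      have := Int.abs_sub_lt_one_of_floor_eq_floor (congrFun h i)
      rw [← sub_div, abs_div, abs_of_pos (show 0 < η / b by positivity),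
        div_lt_one (by positivity)] at this
      exact this.le
    have h2 : v - v' = (e.symm : (Fin N → ℝ) →L[ℝ] V) (e v - e v') := by simp
    rw [h2]
    calc _ ≤ ‖(e.symm : (Fin N → ℝ) →L[ℝ] V)‖ * ‖e v - e v'‖ := ContinuousLinearMap.le_opNorm _ _
      _ ≤ b * (η / b) := by gcongr; linarith
      _ = η := by field_simp
  · have h1 : |e v i| ≤ ‖(e : V →L[ℝ] (Fin N → ℝ))‖ * R :=
      (norm_le_pi_norm (e v) i).trans (((e : V →L[ℝ] (Fin N → ℝ)).le_opNorm v).trans (by gcongr))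
    have h2 : |e v i / (η / b)| ≤ ‖(e : V →L[ℝ] (Fin N → ℝ))‖ * b * R / η := by
      rw [abs_div, abs_of_pos (show 0 < η / b by positivity), div_div_eq_mul_div]
      gcongr ?_ / η
      linarith [mul_le_mul_of_nonneg_right h1 hb0.le]
    have h3 := Int.floor_le (e v i / (η / b))
    have h4 := Int.lt_floor_add_one (e v i / (η / b))
    rw [abs_le] at h2 ⊢
    constructor <;> linarith

/-- Two functions whose derivatives of order less than `k` nearly agree at a point, and whose
`k`-th derivatives are bounded, are close near this point. -/
lemma norm_iteratedFDeriv_le_of_center {E : Type*} [NormedAddCommGroup E] [NormedSpace ℝ E]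
    {g : E → ℝ} (hg : ContDiff ℝ ω g) {s : Set E} (hs : Convex ℝ s) {c : E} (hc : c ∈ s) {k : ℕ}
    {η M h : ℝ} (hη : 0 ≤ η) (hM : 0 ≤ M) (h0 : 0 ≤ h) (h1 : h ≤ 1) (hsh : ∀ y ∈ s, ‖y - c‖ ≤ h)
    (hjet : ∀ j < k, ‖iteratedFDeriv ℝ j g c‖ ≤ η)
    (htop : ∀ y ∈ s, ‖iteratedFDeriv ℝ k g y‖ ≤ M) :
    ∀ y ∈ s, |g y| ≤ k * η + M * h ^ k := by
  have key : ∀ m ≤ k, ∀ y ∈ s, ‖iteratedFDeriv ℝ (k - m) g y‖ ≤ m * η + M * h ^ m := by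
    intro m
    induction m with
    | zero => intro _ y hy; simpa using htop y hy
    | succ m ih =>
      intro hm y hy
      have ih := ih (by omega)
      have hj : k - (m + 1) + 1 = k - m := by omega
      have := hs.norm_image_sub_le_of_norm_fderiv_le (f := iteratedFDeriv ℝ (k - (m + 1)) g)
        (C := m * η + M * h ^ m)
        (fun x _ => (hg.differentiable_iteratedFDeriv (by exact WithTop.coe_lt_top _)) x)
        (fun x hx => by rw [norm_fderiv_iteratedFDeriv, hj]; exact ih x hx) hc hy
      have h2 := hjet (k - (m + 1)) (by omega)
      have h3 : ‖iteratedFDeriv ℝ (k - (m + 1)) g y‖ ≤ ‖iteratedFDeriv ℝ (k - (m + 1)) g c‖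
          + ‖iteratedFDeriv ℝ (k - (m + 1)) g y - iteratedFDeriv ℝ (k - (m + 1)) g c‖ := by
        have := norm_add_le (iteratedFDeriv ℝ (k - (m + 1)) g c)
          (iteratedFDeriv ℝ (k - (m + 1)) g y - iteratedFDeriv ℝ (k - (m + 1)) g c)
        rwa [add_sub_cancel] at this
      have h4 : (m * η + M * h ^ m) * ‖y - c‖ ≤ (m * η + M * h ^ m) * h := by
        gcongr; exact hsh y hy
      have h5 : m * η * h ≤ m * η := mul_le_of_le_one_right (by positivity) h1
      push_cast
      rw [pow_succ]
      linarith
  intro y hy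
  have := key k le_rfl y hy
  rw [Nat.sub_self] at this
  simpa using this

/-- Functions on a cube of side `2 * α` whose derivatives of order `i ≤ k` are bounded by
`A * Λ ^ i` can be encoded, by their rounded Taylor coefficients at the points of a grid of width `h`, such that
functions with the same code are uniformly close. The logarithm of the number of codes is
proportional to the number `(2 * α / h + 1) ^ d` of grid points, up to a logarithmic factor. -/
theorem exists_jet_code (d k : ℕ) : ∃ (N C : ℝ), 0 ≤ N ∧ 0 ≤ C ∧
    ∀ α Λ A h η : ℝ, 0 ≤ α → 1 ≤ Λ → 0 ≤ A → 0 < h → h ≤ 1 → 0 < η →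
      ∃ (ι : Type) (_ : Fintype ι) (code : ((Fin d → ℝ) → ℝ) → ι),
        Real.log (Fintype.card ι)
          ≤ N * (2 * α / h + 1) ^ d * Real.log (2 * (C * (A * Λ ^ k) / η) + 5) ∧
        ∀ f g : (Fin d → ℝ) → ℝ, ContDiff ℝ ω f → ContDiff ℝ ω g →
          (∀ x ∈ cube d α, JetBound k f x A Λ) → (∀ x ∈ cube d α, JetBound k g x A Λ) →
          code f = code g → ∀ x ∈ cube d α, |f x - g x| ≤ k * η + 2 * A * (Λ * h) ^ k := by
  have hfd : ∀ j : ℕ,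
      FiniteDimensional ℝ (ContinuousMultilinearMap ℝ (fun _ : Fin j => Fin d → ℝ) ℝ) := fun j =>
    FiniteDimensional.of_injective
      (ContinuousMultilinearMap.toMultilinearMapLinear :
        ContinuousMultilinearMap ℝ (fun _ : Fin j => Fin d → ℝ) ℝ →ₗ[ℝ] _)
      ContinuousMultilinearMap.toMultilinearMap_injective
  obtain ⟨N, C, hC, hcode⟩ := exists_rounding
    ((j : Fin k) → ContinuousMultilinearMap ℝ (fun _ : Fin j => Fin d → ℝ) ℝ)
  refine ⟨N, C, by positivity, hC, fun α Λ A h η hα hΛ hA hh hh1 hη => ?_⟩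
  obtain ⟨code, hc1, hc2⟩ := hcode η hη
  set G : ℕ := ⌊2 * α / h⌋₊ with hG
  set Q : ℕ := ⌈C * (A * Λ ^ k) / η + 1⌉₊ with hQ
  have hQQ : (-(Q : ℤ)) ≤ Q := by omega
  set center : (Fin d → Fin (G + 1)) → Fin d → ℝ := fun c i => -α + h * (c i : ℕ) with hcenter
  have hcube : ∀ c, center c ∈ cube d α := by
    intro c
    have hle : ∀ i, h * ((c i : ℕ) : ℝ) ≤ 2 * α := fun i => by
      have h1 : ((c i : ℕ) : ℝ) ≤ G := by exact_mod_cast Nat.lt_succ_iff.1 (c i).2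
      have h2 : (G : ℝ) ≤ 2 * α / h := Nat.floor_le (by positivity)
      rw [le_div_iff₀ hh] at h2
      nlinarith
    refine ⟨fun i => ?_, fun i => ?_⟩
    · have : 0 ≤ h * ((c i : ℕ) : ℝ) := by positivity
      simp only [hcenter]; linarith
    · simp only [hcenter]; linarith [hle i]
  let J : ((Fin d → ℝ) → ℝ) → (Fin d → Fin (G + 1)) →
      ((j : Fin k) → ContinuousMultilinearMap ℝ (fun _ : Fin j => Fin d → ℝ) ℝ) :=
    fun f c j => iteratedFDeriv ℝ j f (center c)
  -- the codes of functions with the assumed derivative bounds lie in `[-Q, Q]`; `projIcc` only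
  -- serves to define the code for all functions
  refine ⟨(Fin d → Fin (G + 1)) → Fin N → Set.Icc (-(Q : ℤ)) Q, inferInstance,
    fun f c i => Set.projIcc _ _ hQQ (code (J f c) i), ?_, ?_⟩
  · have hcard : Fintype.card ((Fin d → Fin (G + 1)) → Fin N → Set.Icc (-(Q : ℤ)) Q)
        = ((2 * Q + 1) ^ N) ^ ((G + 1) ^ d) := by
      simp only [Fintype.card_pi, Finset.prod_const, Finset.card_univ, Fintype.card_fin,
        Fintype.card_ofFinset, Int.card_Icc]
      congr 2
      omega
    rw [hcard]
    push_cast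
    rw [Real.log_pow, Real.log_pow, ← mul_assoc, mul_comm _ (N : ℝ)]
    have h1 : (G : ℝ) ≤ 2 * α / h := Nat.floor_le (by positivity)
    have h2 : (Q : ℝ) ≤ C * (A * Λ ^ k) / η + 1 + 1 := (Nat.ceil_lt_add_one (by positivity)).le
    have h3 : Real.log (2 * Q + 1) ≤ Real.log (2 * (C * (A * Λ ^ k) / η) + 5) :=
      Real.log_le_log (by positivity) (by linarith)
    have h4 : 0 ≤ Real.log (2 * Q + 1) := Real.log_nonneg (by
      have : (0 : ℝ) ≤ Q := Nat.cast_nonneg _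
      linarith)
    push_cast
    gcongr
  · intro f g hf hg hfJ hgJ hcodes x hx
    have hidx : ∀ i, ⌊(x i + α) / h⌋₊ < G + 1 := fun i => by
      refine Nat.lt_succ_of_le (Nat.floor_le_floor ?_)
      gcongr
      linarith [hx.2 i]
    set c : Fin d → Fin (G + 1) := fun i => ⟨⌊(x i + α) / h⌋₊, hidx i⟩ with hcdef
    have hdist : ‖x - center c‖ ≤ h := by
      rw [pi_norm_le_iff_of_nonneg hh.le]
      intro i
      have h0 : 0 ≤ x i + α := by linarith [hx.1 i]
      have h1 := Nat.floor_le (div_nonneg h0 hh.le)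
      have h2 := Nat.lt_floor_add_one ((x i + α) / h)
      rw [le_div_iff₀ hh] at h1
      rw [div_lt_iff₀ hh] at h2
      rw [Real.norm_eq_abs, abs_le]
      simp only [Pi.sub_apply, hcenter, hcdef]
      constructor <;> nlinarith
    have hnorm : ∀ f : (Fin d → ℝ) → ℝ, (∀ x ∈ cube d α, JetBound k f x A Λ) →
        ‖J f c‖ ≤ A * Λ ^ k := by
      intro f hfJ
      rw [pi_norm_le_iff_of_nonneg (by positivity)]
      intro j
      refine (hfJ _ (hcube c) j j.2.le).trans ?_
      gcongr
      exact j.2.le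
    have hmem : ∀ f : (Fin d → ℝ) → ℝ, (∀ x ∈ cube d α, JetBound k f x A Λ) → ∀ i,
        code (J f c) i ∈ Set.Icc (-(Q : ℤ)) Q := by
      intro f hfJ i
      have h1 := (hc2 _ _ (hnorm f hfJ) i).trans (Nat.le_ceil _)
      rw [← hQ] at h1
      exact abs_le.1 (by exact_mod_cast h1)
    have hcodeeq : code (J f c) = code (J g c) := by
      ext i
      have := congrArg Subtype.val (congrFun (congrFun hcodes c) i)
      simpa only [Set.projIcc_of_mem hQQ (hmem f hfJ i), Set.projIcc_of_mem hQQ (hmem g hgJ i)]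
        using this
    have hclose := hc1 _ _ hcodeeq
    have hsub : ∀ j y, iteratedFDeriv ℝ j (f - g) y
        = iteratedFDeriv ℝ j f y - iteratedFDeriv ℝ j g y := fun j y =>
      iteratedFDeriv_sub_apply (hf.contDiffAt.of_le le_top) (hg.contDiffAt.of_le le_top)
    have hconv : Convex ℝ (cube d α ∩ Metric.closedBall (center c) h) :=
      (convex_Icc _ _).inter (convex_closedBall _ _)
    have := norm_iteratedFDeriv_le_of_center (g := f - g) (hf.sub hg) hconv
      (c := center c) (k := k) (η := η) (M := 2 * A * Λ ^ k) (h := h)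
      ⟨hcube c, Metric.mem_closedBall_self hh.le⟩ hη.le (by positivity) hh.le hh1
      (fun y hy => by simpa [dist_eq_norm] using hy.2)
      (fun j hj => by
        rw [hsub]
        exact (norm_le_pi_norm (J f c - J g c) ⟨j, hj⟩).trans hclose)
      (fun y hy => by
        rw [hsub]
        refine (norm_sub_le _ _).trans ?_
        have h1 := hfJ y hy.1 k le_rfl
        have h2 := hgJ y hy.1 k le_rfl
        linarith) x ⟨hx, by rw [Metric.mem_closedBall, dist_eq_norm]; exact hdist⟩
    rw [mul_pow, ← mul_assoc]
    exact this

end Cover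

/-! ### Uniform deviations of the truncated empirical risk -/

section Deviation

variable {d n : ℕ}

lemma abs_trunc_le {β : ℝ} (hβ : 0 ≤ β) (z : ℝ) : |trunc β z| ≤ β :=
  abs_le.2 ⟨le_max_left _ _, max_le (by linarith) (min_le_left _ _)⟩

lemma trunc_eq_self {β z : ℝ} (h : |z| ≤ β) : trunc β z = z := by
  rw [abs_le] at h
  rw [trunc, min_eq_right h.2, max_eq_right h.1]

lemma abs_trunc_sub_trunc_le (β y z : ℝ) : |trunc β y - trunc β z| ≤ |y - z| := by
  unfold trunc
  have h1 := abs_max_sub_max_le_max (-β) (min β y) (-β) (min β z)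
  have h2 := abs_min_sub_min_le_max β y β z
  simp only [sub_self, abs_zero] at h1 h2
  rw [max_eq_right (abs_nonneg (min β y - min β z))] at h1
  rw [max_eq_right (abs_nonneg (y - z))] at h2
  exact h1.trans h2

lemma continuous_trunc (β : ℝ) : Continuous (trunc β) :=
  continuous_const.max (continuous_const.min continuous_id)

/-- Truncation at `±β` does not increase the distance to a value in `[-β, β]`. -/
lemma abs_trunc_sub_le {β z y : ℝ} (hy : |y| ≤ β) : |trunc β z - y| ≤ |z - y| := by
  conv_lhs => rw [← trunc_eq_self hy]
  exact abs_trunc_sub_trunc_le _ _ _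

/-- The squared error of the prediction `f x`, truncated at `±β`, of the response `y`, truncated at
`±b`, restricted to inputs in `[-α, α]^d`. -/
noncomputable def truncLoss (α β b : ℝ) (f : (Fin d → ℝ) → ℝ) (z : (Fin d → ℝ) × ℝ) : ℝ :=
  (trunc β (f z.1) - trunc b z.2) ^ 2 * (cube d α).indicator (fun _ => (1 : ℝ)) z.1

variable {α β b : ℝ} {f g : (Fin d → ℝ) → ℝ}

lemma indicator_cube_mem (x : Fin d → ℝ) :
    (cube d α).indicator (fun _ => (1 : ℝ)) x ∈ Set.Icc (0 : ℝ) 1 := by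
  by_cases h : x ∈ cube d α <;> simp [h]

lemma measurableSet_cube : MeasurableSet (cube d α) := measurableSet_Icc

lemma measurable_truncLoss (hf : Measurable f) : Measurable (truncLoss α β b f) := by
  have h1 : Measurable fun z : (Fin d → ℝ) × ℝ => trunc β (f z.1) :=
    (continuous_trunc β).measurable.comp (hf.comp measurable_fst)
  have h2 : Measurable fun z : (Fin d → ℝ) × ℝ => trunc b z.2 :=
    (continuous_trunc b).measurable.comp measurable_snd
  have h3 : Measurable fun z : (Fin d → ℝ) × ℝ => (cube d α).indicator (fun _ => (1 : ℝ)) z.1 :=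
    (measurable_const.indicator measurableSet_cube).comp measurable_fst
  exact ((h1.sub h2).pow_const 2).mul h3

lemma truncLoss_mem (hb : 0 ≤ b) (hbβ : b ≤ β) (z : (Fin d → ℝ) × ℝ) :
    truncLoss α β b f z ∈ Set.Icc 0 (4 * β ^ 2) := by
  have h1 := indicator_cube_mem (α := α) z.1
  have h2 : (trunc β (f z.1) - trunc b z.2) ^ 2 ≤ 4 * β ^ 2 := by
    have h3 := abs_le.1 (abs_trunc_le (hb.trans hbβ) (f z.1))
    have h4 := abs_le.1 ((abs_trunc_le hb z.2).trans hbβ)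
    nlinarith
  refine ⟨mul_nonneg (sq_nonneg _) h1.1, (mul_le_of_le_one_right (sq_nonneg _) h1.2).trans h2⟩

lemma abs_truncLoss_sub_le (hb : 0 ≤ b) (hbβ : b ≤ β) {γ : ℝ} (hγ : 0 ≤ γ)
    (h : ∀ x ∈ cube d α, |f x - g x| ≤ γ) (z : (Fin d → ℝ) × ℝ) :
    |truncLoss α β b f z - truncLoss α β b g z| ≤ 4 * β * γ := by
  have hβ : 0 ≤ β := hb.trans hbβ
  by_cases hz : z.1 ∈ cube d α
  · simp only [truncLoss, Set.indicator_of_mem hz, mul_one]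
    have h1 := (abs_trunc_sub_trunc_le β (f z.1) (g z.1)).trans (h _ hz)
    have h2 := abs_le.1 (abs_trunc_le hβ (f z.1))
    have h3 := abs_le.1 (abs_trunc_le hβ (g z.1))
    have h4 := abs_le.1 ((abs_trunc_le hb z.2).trans hbβ)
    have h5 : (trunc β (f z.1) - trunc b z.2) ^ 2 - (trunc β (g z.1) - trunc b z.2) ^ 2
        = (trunc β (f z.1) + trunc β (g z.1) - 2 * trunc b z.2)
          * (trunc β (f z.1) - trunc β (g z.1)) := by ring
    rw [h5, abs_mul]
    gcongr
    rw [abs_le]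
    constructor <;> linarith
  · simp only [truncLoss, Set.indicator_of_notMem hz, mul_zero, sub_zero, abs_zero]
    positivity

variable {Ω : Type*} [MeasurableSpace Ω] {P : Measure Ω} [IsProbabilityMeasure P]
  {D : ℕ → Ω → (Fin d → ℝ) × ℝ} {ν : Measure ((Fin d → ℝ) × ℝ)}

/-- Hoeffding's inequality for a fixed function. -/
lemma prob_risk_gt_le (hD : ∀ i, Measurable (D i)) (hind : iIndepFun D P)
    (hlaw : ∀ i, P.map (D i) = ν) (hf : Measurable f) (hb : 0 ≤ b) (hbβ : b ≤ β) (hn : 0 < n)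
    {ε : ℝ} (hε : 0 ≤ ε) :
    P.real {ω | 1 / (n : ℝ) * ∑ i : Fin n, truncLoss α β b f (D i ω) + ε
        ≤ ∫ z, truncLoss α β b f z ∂ν}
      ≤ Real.exp (-(n * ε ^ 2 / (8 * β ^ 4))) := by
  set ℓ := truncLoss α β b f with hℓ
  have hm : Measurable ℓ := measurable_truncLoss hf
  have hint : ∀ i, ∫ ω, ℓ (D i ω) ∂P = ∫ z, ℓ z ∂ν := fun i => by
    rw [← hlaw i, integral_map (hD i).aemeasurable hm.aestronglyMeasurable]
  have hsub : ∀ i, HasSubgaussianMGF (fun ω => -(ℓ (D i ω) - ∫ z, ℓ z ∂ν))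
      ((‖4 * β ^ 2 - 0‖₊ / 2) ^ 2) P := fun i => by
    have := hasSubgaussianMGF_of_mem_Icc (μ := P) (X := fun ω => ℓ (D i ω)) (a := 0) (b := 4 * β ^ 2)
      (hm.comp (hD i)).aemeasurable (Eventually.of_forall fun ω => truncLoss_mem hb hbβ _)
    rw [hint i] at this
    exact this.neg
  have hind' : iIndepFun (fun i ω => -(ℓ (D i ω) - ∫ z, ℓ z ∂ν)) P :=
    hind.comp (fun _ z => -(ℓ z - ∫ z, ℓ z ∂ν)) fun _ => (hm.sub_const _).neg
  have hn' : (0 : ℝ) < n := by exact_mod_cast hn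
  have key := HasSubgaussianMGF.measure_sum_range_ge_le_of_iIndepFun hind' (n := n)
    (fun i _ => hsub i) (ε := n * ε) (by positivity)
  refine le_trans (measureReal_mono fun ω hω => ?_) (key.trans (Real.exp_le_exp.2 ?_))
  · simp only [Set.mem_ofPred_eq] at hω ⊢
    rw [Finset.sum_neg_distrib, Finset.sum_sub_distrib, Finset.sum_range]
    simp only [Finset.sum_const, Finset.card_range, nsmul_eq_mul]
    have h1 : (n : ℝ) * (1 / (n : ℝ) * ∑ i : Fin n, ℓ (D i ω) + ε) ≤ n * ∫ z, ℓ z ∂ν := by gcongr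
    rw [mul_add, ← mul_assoc, mul_one_div_cancel hn'.ne', one_mul] at h1
    linarith
  · push_cast
    rw [sub_zero, Real.norm_of_nonneg (by positivity)]
    rcases eq_or_ne β 0 with rfl | hβ
    · simp
    · rw [neg_div, neg_le_neg_iff]
      refine le_of_eq ?_
      field_simp
      ring

/-- Uniform deviations over a class of functions that is finite up to a uniform error `γ`. The event
need not be measurable; `P` is used as an outer measure. -/
theorem prob_uniform_deviation_le [IsProbabilityMeasure ν] (hD : ∀ i, Measurable (D i))
    (hind : iIndepFun D P)
    (hlaw : ∀ i, P.map (D i) = ν) (hb : 0 ≤ b) (hbβ : b ≤ β) (hn : 0 < n)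
    {ε γ : ℝ} (hε : 0 ≤ ε) (hγ : 0 ≤ γ) {𝓕 : Set ((Fin d → ℝ) → ℝ)} (h𝓕 : ∀ f ∈ 𝓕, Measurable f)
    {ι : Type} [Fintype ι] (code : ((Fin d → ℝ) → ℝ) → ι)
    (hcode : ∀ f ∈ 𝓕, ∀ g ∈ 𝓕, code f = code g → ∀ x ∈ cube d α, |f x - g x| ≤ γ) :
    P {ω | ∃ f ∈ 𝓕, 1 / (n : ℝ) * ∑ i : Fin n, truncLoss α β b f (D i ω) + ε + 8 * β * γ
        < ∫ z, truncLoss α β b f z ∂ν}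
      ≤ ENNReal.ofReal (Fintype.card ι * Real.exp (-(n * ε ^ 2 / (8 * β ^ 4)))) := by
  classical
  set B : ((Fin d → ℝ) → ℝ) → Set Ω := fun f =>
    {ω | 1 / (n : ℝ) * ∑ i : Fin n, truncLoss α β b f (D i ω) + ε ≤ ∫ z, truncLoss α β b f z ∂ν}
  -- the representative of a code, if some function of the class has this code
  set A : ι → Set Ω := fun c =>
    if h : ∃ f ∈ 𝓕, code f = c then B h.choose else ∅ with hA
  have hAle : ∀ c, P (A c) ≤ ENNReal.ofReal (Real.exp (-(n * ε ^ 2 / (8 * β ^ 4)))) := by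
    intro c
    simp only [hA]
    split_ifs with h
    · rw [← ENNReal.ofReal_toReal (measure_ne_top P _)]
      exact ENNReal.ofReal_le_ofReal
        (prob_risk_gt_le hD hind hlaw (h𝓕 _ h.choose_spec.1) hb hbβ hn hε)
    · simp
  have hn' : (0 : ℝ) < n := by exact_mod_cast hn
  refine (measure_mono (t := ⋃ c, A c) ?_).trans ((measure_iUnion_fintype_le _ _).trans ?_)
  · rintro ω ⟨f, hf, hω⟩
    refine Set.mem_iUnion.2 ⟨code f, ?_⟩
    have hex : ∃ g ∈ 𝓕, code g = code f := ⟨f, hf, rfl⟩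
    simp only [hA, dif_pos hex]
    obtain ⟨hg, hgc⟩ := hex.choose_spec
    set g := hex.choose
    have hclose := fun z => abs_le.1 (abs_truncLoss_sub_le hb hbβ hγ (hcode g hg f hf hgc) z)
    have hintb : ∀ f ∈ 𝓕, Integrable (truncLoss α β b f) ν := fun f hf =>
      Integrable.of_bound (measurable_truncLoss (h𝓕 f hf)).aestronglyMeasurable (4 * β ^ 2)
        (Eventually.of_forall fun z => by
          have := truncLoss_mem (α := α) (f := f) hb hbβ z
          rw [Real.norm_of_nonneg this.1]; exact this.2)
    have h1 : ∫ z, truncLoss α β b f z ∂ν ≤ ∫ z, truncLoss α β b g z ∂ν + 4 * β * γ := by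
      have : ∫ z, truncLoss α β b f z ∂ν ≤ ∫ z, (truncLoss α β b g z + 4 * β * γ) ∂ν :=
        integral_mono (hintb f hf) ((hintb g hg).add (integrable_const _)) fun z => by
          linarith [(hclose z).1]
      rwa [integral_add (hintb g hg) (integrable_const _), integral_const, probReal_univ,
        one_smul] at this
    have h2 : 1 / (n : ℝ) * ∑ i : Fin n, truncLoss α β b g (D i ω)
        ≤ 1 / (n : ℝ) * ∑ i : Fin n, truncLoss α β b f (D i ω) + 4 * β * γ := by
      have : ∑ i : Fin n, truncLoss α β b g (D i ω)
          ≤ ∑ i : Fin n, (truncLoss α β b f (D i ω) + 4 * β * γ) :=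
        Finset.sum_le_sum fun i _ => by linarith [(hclose (D i ω)).2]
      rw [Finset.sum_add_distrib] at this
      simp only [Finset.sum_const, Finset.card_univ, Fintype.card_fin, nsmul_eq_mul] at this
      calc _ ≤ 1 / (n : ℝ) * (∑ i : Fin n, truncLoss α β b f (D i ω) + n * (4 * β * γ)) := by gcongr
        _ = _ := by field_simp
    simp only [B, Set.mem_ofPred_eq]
    linarith
  · refine (Finset.sum_le_sum fun c _ => hAle c).trans ?_
    rw [Finset.sum_const, Finset.card_univ, nsmul_eq_mul, ENNReal.ofReal_mul (Nat.cast_nonneg _),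
      ENNReal.ofReal_natCast]

end Deviation

/-! ### The reference network -/

section Reference

variable {d L r K : ℕ}

/-- The single network with given weights. -/
noncomputable def blockWeights (u : BlockIndex d L r → ℝ) : Weights d L r 1 :=
  WithLp.toLp 2 (Sum.elim 0 (Sum.elim (fun q => u (Sum.inl q.2)) fun q => u (Sum.inr q.2)))

lemma subnet_eq_blockWeights (w : Weights d L r K) (x : Fin d → ℝ) (κ : Fin K) :
    subnet w x κ = subnet (blockWeights fun b => w (blockIndex κ b)) x 0 :=
  subnet_congr x (fun _ _ => rfl) fun _ _ _ => rfl

lemma continuous_blockWeights_subnet :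
    Continuous fun p : (BlockIndex d L r → ℝ) × (Fin d → ℝ) => subnet (blockWeights p.1) p.2 0 := by
  refine (subnet_contDiff (E := (BlockIndex d L r → ℝ) × (Fin d → ℝ))
    (w := fun p => blockWeights p.1) (ξ := fun p => p.2) (κ := 0) (fun a => ?_)
    fun j => (contDiff_apply ℝ ℝ j).comp contDiff_snd).continuous
  rcases a with a | a | a
  · exact contDiff_const
  · exact (contDiff_apply ℝ ℝ (Sum.inl a.2 : BlockIndex d L r)).comp contDiff_fst
  · exact (contDiff_apply ℝ ℝ (Sum.inr a.2 : BlockIndex d L r)).comp contDiff_fst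

/-- On a bounded set of inputs a single network depends uniformly continuously on its weights. -/
lemma exists_blockClose_modulus (v : Weights d L r 1) (α : ℝ) {ε : ℝ} (hε : 0 < ε) :
    ∃ δ > 0, ∀ (K : ℕ) (w : Weights d L r K) (κ : Fin K), BlockClose w v δ κ →
      ∀ x ∈ cube d α, |subnet w x κ - subnet v x 0| ≤ ε := by
  set u₀ : BlockIndex d L r → ℝ := fun b => v (blockIndex 0 b)
  have hcomp : IsCompact (Metric.closedBall u₀ 1 ×ˢ cube d α) :=
    (isCompact_closedBall u₀ 1).prod isCompact_Icc
  obtain ⟨δ, hδ, h⟩ := Metric.uniformContinuousOn_iff.1 (hcomp.uniformContinuousOn_of_continuous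
    (continuous_blockWeights_subnet (d := d) (L := L) (r := r)).continuousOn) ε hε
  refine ⟨min (δ / 2) 1, by positivity, fun K w κ hw x hx => ?_⟩
  have hdist : dist (fun b => w (blockIndex κ b)) u₀ ≤ min (δ / 2) 1 :=
    (dist_pi_le_iff (by positivity)).2 fun b => hw b
  have := h (fun b => w (blockIndex κ b), x) ⟨hdist.trans (min_le_right _ _), hx⟩ (u₀, x)
    ⟨Metric.mem_closedBall_self zero_le_one, hx⟩ (by
      rw [Prod.dist_eq, dist_self, max_eq_left dist_nonneg]
      linarith [min_le_left (δ / 2) 1])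
  rw [subnet_eq_blockWeights w, subnet_eq_blockWeights v]
  exact this.le

lemma network_replaceOuter (w : Weights d L r K) (u : Fin K → ℝ) (x : Fin d → ℝ) :
    network (replaceOuter w u) x = ∑ κ, u κ * subnet w x κ :=
  Finset.sum_congr rfl fun κ _ => by
    rw [show subnet (replaceOuter w u) x κ = subnet w x κ from
      subnet_congr x (fun _ _ => rfl) fun _ _ _ => rfl]
    rfl

/-- If many initial networks are close to each of the networks `v j`, and few coordinates move, then
`∑ j, a j * v j` is approximated along the whole path by a fixed choice of the outer weights. The
coefficient `a j` is spread evenly over the networks that start close to `v j` and move little, so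
that the outer weights have a small Euclidean norm. -/
lemma exists_reference_weights {J T : ℕ} {a : Fin J → ℝ} {v : Fin J → Weights d L r 1}
    {α₀ δ s q R : ℝ} (hδ : 0 < δ) (hq : 0 < q) {w : ℕ → Weights d L r K}
    (hmod : ∀ (j : Fin J) (w : Weights d L r K) (κ : Fin K), BlockClose w (v j) δ κ →
      ∀ x ∈ cube d α₀, |subnet w x κ - subnet (v j) x 0| ≤ s)
    (hclose : ∀ j, q / 2 ≤ ({κ | BlockClose (w 0) (v j) (δ / 2) κ}.ncard : ℝ))
    (hmove : ∀ A : Finset (WeightIndex d L r K),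
      (∀ a ∈ A, ∃ t ≤ T, δ / 2 < |w t a - w 0 a|) → (A.card : ℝ) * (δ / 2) ^ 2 ≤ R ^ 2)
    (hqR : R ^ 2 ≤ q / 4 * (δ / 2) ^ 2) :
    ∃ u : Fin K → ℝ, ∑ κ, u κ ^ 2 ≤ (∑ j, |a j|) ^ 2 * (4 / q) ∧
      ∀ t ≤ T, ∀ x,
        |network (replaceOuter (w t) u) x - ∑ j, a j * subnet (v j) x 0| ≤ ∑ j, |a j| ∧
        (x ∈ cube d α₀ →
          |network (replaceOuter (w t) u) x - ∑ j, a j * subnet (v j) x 0| ≤ (∑ j, |a j|) * s) := by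
  classical
  -- the networks that move, and for each `j` the networks that start close to `v j` and do not
  set Bad : Finset (Fin K) :=
    Finset.univ.filter fun κ => ∃ b, ∃ t ≤ T, δ / 2 < |w t (blockIndex κ b) - w 0 (blockIndex κ b)|
    with hBad
  have hBadcard : (Bad.card : ℝ) ≤ q / 4 := by
    have hex : ∀ κ ∈ Bad, ∃ b, ∃ t ≤ T,
        δ / 2 < |w t (blockIndex κ b) - w 0 (blockIndex κ b)| := fun κ hκ =>
      (Finset.mem_filter.1 hκ).2
    rcases Bad.eq_empty_or_nonempty with h0 | ⟨κ₀, hκ₀⟩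
    · rw [h0]; simp; positivity
    have : Nonempty (BlockIndex d L r) := ⟨(hex κ₀ hκ₀).choose⟩
    choose! b hb using hex
    have h1 := hmove (Bad.image fun κ => blockIndex κ (b κ)) (by
      intro a ha
      obtain ⟨κ, hκ, rfl⟩ := Finset.mem_image.1 ha
      exact hb κ hκ)
    rw [Finset.card_image_of_injective _ fun κ κ' h => (blockIndex_eq_iff.1 h).1] at h1
    exact le_of_mul_le_mul_right (h1.trans hqR) (by positivity)
  set G : Fin J → Finset (Fin K) := fun j =>
    Finset.univ.filter fun κ => BlockClose (w 0) (v j) (δ / 2) κ ∧ κ ∉ Bad with hG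
  have hGcard : ∀ j, q / 4 ≤ ((G j).card : ℝ) := by
    intro j
    have h1 : {κ | BlockClose (w 0) (v j) (δ / 2) κ}.ncard ≤ (G j).card + Bad.card := by
      rw [Set.ncard_eq_toFinset_card']
      refine (Finset.card_le_card fun κ hκ => ?_).trans (Finset.card_union_le _ _)
      simp only [Set.mem_toFinset, Set.mem_ofPred_eq] at hκ
      by_cases h : κ ∈ Bad <;> simp [hG, h, hκ]
    have h2 : ({κ | BlockClose (w 0) (v j) (δ / 2) κ}.ncard : ℝ) ≤ (G j).card + Bad.card := by
      exact_mod_cast h1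
    linarith [hclose j]
  have hGpos : ∀ j, (0 : ℝ) < (G j).card := fun j => lt_of_lt_of_le (by positivity) (hGcard j)
  -- the uniform distribution on `G j`
  set ι : Fin J → Fin K → ℝ := fun j κ => if κ ∈ G j then ((G j).card : ℝ)⁻¹ else 0 with hι
  have hsum : ∀ (j : Fin J) (φ : Fin K → ℝ),
      ∑ κ, ι j κ * φ κ = ((G j).card : ℝ)⁻¹ * ∑ κ ∈ G j, φ κ := by
    intro j φ
    simp only [hι, ite_mul, zero_mul, Finset.sum_ite_mem, Finset.univ_inter, Finset.mul_sum]
  have hdiff : ∀ t x, network (replaceOuter (w t) fun κ => ∑ j, a j * ι j κ) x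
        - ∑ j, a j * subnet (v j) x 0
      = ∑ j, a j * (((G j).card : ℝ)⁻¹ * ∑ κ ∈ G j, (subnet (w t) x κ - subnet (v j) x 0)) := by
    intro t x
    rw [network_replaceOuter]
    simp only [Finset.sum_mul]
    rw [Finset.sum_comm, ← Finset.sum_sub_distrib]
    refine Finset.sum_congr rfl fun j _ => ?_
    simp only [mul_assoc]
    rw [← Finset.mul_sum, hsum, Finset.sum_sub_distrib, ← mul_sub]
    congr 1
    have := (hGpos j).ne'
    simp only [Finset.sum_const, nsmul_eq_mul]
    field_simp
  have hbound : ∀ t x (c : ℝ), (∀ j, ∀ κ ∈ G j, |subnet (w t) x κ - subnet (v j) x 0| ≤ c) →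
      |network (replaceOuter (w t) fun κ => ∑ j, a j * ι j κ) x - ∑ j, a j * subnet (v j) x 0|
        ≤ (∑ j, |a j|) * c := by
    intro t x c hc
    rw [hdiff, Finset.sum_mul]
    refine (Finset.abs_sum_le_sum_abs _ _).trans (Finset.sum_le_sum fun j _ => ?_)
    rw [abs_mul, abs_mul, abs_of_pos (inv_pos.2 (hGpos j))]
    gcongr
    rw [inv_mul_le_iff₀ (hGpos j)]
    refine (Finset.abs_sum_le_sum_abs _ _).trans ((Finset.sum_le_sum (hc j)).trans ?_)
    simp
  refine ⟨fun κ => ∑ j, a j * ι j κ, ?_, fun t ht x => ⟨?_, fun hx => hbound t x s ?_⟩⟩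
  · -- Cauchy-Schwarz with the weights `|a j|`, and `∑ κ, ι j κ ^ 2 = 1 / #(G j) ≤ 4 / q`
    have h1 : ∀ κ, (∑ j, a j * ι j κ) ^ 2 ≤ (∑ j, |a j|) * ∑ j, |a j| * ι j κ ^ 2 := by
      intro κ
      have := Finset.sum_mul_sq_le_sq_mul_sq Finset.univ (fun j => √|a j|)
        fun j => √|a j| * (SignType.sign (a j) : ℝ) * ι j κ
      refine le_trans (le_of_eq ?_) (this.trans (mul_le_mul (le_of_eq ?_) ?_ ?_ ?_))
      · congr 1
        refine Finset.sum_congr rfl fun j _ => ?_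
        have h2 : √|a j| * √|a j| = |a j| := Real.mul_self_sqrt (abs_nonneg _)
        have h3 := abs_mul_sign (a j)
        calc a j * ι j κ = |a j| * SignType.sign (a j) * ι j κ := by rw [h3]
          _ = _ := by linear_combination (-((SignType.sign (a j) : ℝ) * ι j κ)) * h2
      · exact Finset.sum_congr rfl fun j _ => Real.sq_sqrt (abs_nonneg _)
      · refine Finset.sum_le_sum fun j _ => ?_
        rw [mul_pow, mul_pow, Real.sq_sqrt (abs_nonneg _)]
        have : ((SignType.sign (a j) : SignType) : ℝ) ^ 2 ≤ 1 := by
          rcases lt_trichotomy (a j) 0 with h | h | h <;> simp [h]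
        nlinarith [mul_nonneg (abs_nonneg (a j)) (sq_nonneg (ι j κ))]
      · exact Finset.sum_nonneg fun _ _ => sq_nonneg _
      · exact Finset.sum_nonneg fun _ _ => abs_nonneg _
    refine (Finset.sum_le_sum fun κ _ => h1 κ).trans ?_
    rw [← Finset.mul_sum, Finset.sum_comm, sq, mul_assoc]
    refine mul_le_mul_of_nonneg_left ?_ (Finset.sum_nonneg fun _ _ => abs_nonneg _)
    rw [Finset.sum_mul]
    refine Finset.sum_le_sum fun j _ => ?_
    rw [← Finset.mul_sum]
    gcongr
    have : ∑ κ, ι j κ ^ 2 = ((G j).card : ℝ)⁻¹ := by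
      simp only [sq]
      rw [hsum]
      simp only [hι]
      rw [Finset.sum_congr rfl fun κ hκ => if_pos hκ]
      simp [(hGpos j).ne']
    rw [this, ← one_div, div_le_div_iff₀ (hGpos j) hq]
    linarith [hGcard j]
  · refine (hbound t x 1 fun j κ _ => ?_).trans (by rw [mul_one])
    have h1 := subnet_mem_Icc (w t) x κ
    have h2 := subnet_mem_Icc (v j) x 0
    rw [abs_le]
    constructor <;> linarith [h1.1, h1.2, h2.1, h2.2]
  · intro j κ hκ
    obtain ⟨h1, h2⟩ := (Finset.mem_filter.1 hκ).2
    refine hmod j (w t) κ (fun b => ?_) x hx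
    have h3 : |w t (blockIndex κ b) - w 0 (blockIndex κ b)| ≤ δ / 2 := by
      by_contra hcon
      push Not at hcon
      exact h2 (Finset.mem_filter.2 ⟨Finset.mem_univ _, b, t, ht, hcon⟩)
    have h4 := abs_sub_le (w t (blockIndex κ b)) (w 0 (blockIndex κ b)) (v j (blockIndex 0 b))
    linarith [h1 b]

end Reference

/-! ### From the empirical risk to the `L²` error -/

section Statistics

variable {d L r K n : ℕ} {Ω : Type*} [MeasurableSpace Ω] {P : Measure Ω}
  {X : Ω → Fin d → ℝ} {Y : Ω → ℝ} {m : (Fin d → ℝ) → ℝ}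

lemma memLp_regression (hX : Measurable X) (hY_sq : MemLp Y 2 P) (hm : Measurable m)
    (hm_reg : (fun ω => m (X ω)) =ᵐ[P] P[Y|MeasurableSpace.comap X inferInstance]) :
    MemLp m 2 (P.map X) := by
  rw [memLp_map_measure_iff hm.aestronglyMeasurable hX.aemeasurable]
  exact (memLp_congr_ae hm_reg).2 (hY_sq.condExp one_le_two)

variable [IsProbabilityMeasure P]

/-- The regression function is the orthogonal projection of `Y` on the square integrable functions
of `X`. -/
lemma integral_sq_error_eq (hX : Measurable X) (hY_sq : MemLp Y 2 P) (hm : Measurable m)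
    (hm_reg : (fun ω => m (X ω)) =ᵐ[P] P[Y|MeasurableSpace.comap X inferInstance])
    {g : (Fin d → ℝ) → ℝ} (hg : Measurable g) (hgL : MemLp (fun ω => g (X ω)) 2 P) :
    ∫ ω, (g (X ω) - Y ω) ^ 2 ∂P
      = ∫ x, (g x - m x) ^ 2 ∂(P.map X) + ∫ ω, (m (X ω) - Y ω) ^ 2 ∂P := by
  have hmL : MemLp (fun ω => m (X ω)) 2 P := (memLp_regression hX hY_sq hm hm_reg).comp_of_map
    hX.aemeasurable
  have hsm : AEStronglyMeasurable (fun x => (g x - m x) ^ 2) (P.map X) :=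
    ((hg.sub hm).pow_const 2).aestronglyMeasurable
  rw [integral_map hX.aemeasurable hsm]
  have h1 : MemLp (fun ω => g (X ω) - m (X ω)) 2 P := hgL.sub hmL
  have h2 : MemLp (fun ω => m (X ω) - Y ω) 2 P := hmL.sub hY_sq
  have hle : MeasurableSpace.comap X inferInstance ≤ (inferInstance : MeasurableSpace Ω) :=
    hX.comap_le
  have hφ : StronglyMeasurable[MeasurableSpace.comap X inferInstance]
      fun ω => g (X ω) - m (X ω) :=
    ((hg.sub hm).comp (comap_measurable X)).stronglyMeasurable
  have hi1 : Integrable ((fun ω => g (X ω) - m (X ω)) * Y) P := h1.integrable_mul hY_sq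
  have hi2 : Integrable ((fun ω => g (X ω) - m (X ω)) * fun ω => m (X ω)) P := h1.integrable_mul hmL
  -- `(g - m)(X)` is a function of `X`, so `Y` may be replaced by its conditional expectation
  have hcross : ∫ ω, (g (X ω) - m (X ω)) * Y ω ∂P = ∫ ω, (g (X ω) - m (X ω)) * m (X ω) ∂P := by
    have h3 := condExp_mul_of_stronglyMeasurable_left hφ hi1 (hY_sq.integrable one_le_two)
    have h4 := integral_condExp hle (μ := P) (f := (fun ω => g (X ω) - m (X ω)) * Y)
    rw [integral_congr_ae h3] at h4
    refine h4.symm.trans (integral_congr_ae ?_)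
    filter_upwards [hm_reg] with ω hω
    simp only [Pi.mul_apply]
    rw [hω]
  have hsplit : ∀ ω, (g (X ω) - Y ω) ^ 2 = ((g (X ω) - m (X ω)) ^ 2 + (m (X ω) - Y ω) ^ 2)
      + 2 * ((g (X ω) - m (X ω)) * m (X ω) - (g (X ω) - m (X ω)) * Y ω) := fun ω => by ring
  simp only [hsplit]
  have hi3 : Integrable (fun ω => (g (X ω) - m (X ω)) ^ 2 + (m (X ω) - Y ω) ^ 2) P :=
    h1.integrable_sq.add h2.integrable_sq
  have hi4 : Integrable (fun ω =>
      (g (X ω) - m (X ω)) * m (X ω) - (g (X ω) - m (X ω)) * Y ω) P := hi2.sub hi1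
  rw [integral_add hi3 (hi4.const_mul 2), integral_add h1.integrable_sq h2.integrable_sq,
    integral_const_mul]
  have h5 : ∫ ω, ((g (X ω) - m (X ω)) * m (X ω) - (g (X ω) - m (X ω)) * Y ω) ∂P = 0 :=
    (integral_sub hi2 hi1).trans (sub_eq_zero.2 hcross.symm)
  rw [h5]
  ring

lemma l2Error_eq {μ : Measure (Fin d → ℝ)} {g m : (Fin d → ℝ) → ℝ} (hg : MemLp g 2 μ)
    (hm : MemLp m 2 μ) : l2Error μ g m = ENNReal.ofReal (∫ x, (g x - m x) ^ 2 ∂μ) := by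
  have hi : Integrable (fun x => (g x - m x) ^ 2) μ := (hg.sub hm).integrable_sq
  rw [ofReal_integral_eq_lintegral_ofReal hi
    (Eventually.of_forall fun x => sq_nonneg _)]
  simp [l2Error]

lemma l2Error_le {μ : Measure (Fin d → ℝ)} [IsProbabilityMeasure μ] {g m : (Fin d → ℝ) → ℝ} {β : ℝ}
    (hg : ∀ x, |g x| ≤ β) (hm : MemLp m 2 μ) :
    l2Error μ g m ≤ ENNReal.ofReal (2 * β ^ 2 + 2 * ∫ x, m x ^ 2 ∂μ) := by
  have h1 : ∀ x, |g x - m x| ^ 2 ≤ 2 * β ^ 2 + 2 * m x ^ 2 := fun x => by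
    rw [sq_abs]
    have := sq_le_sq' (abs_le.1 (hg x)).1 (abs_le.1 (hg x)).2
    nlinarith [sq_nonneg (g x + m x)]
  refine (lintegral_mono fun x => ENNReal.ofReal_le_ofReal (h1 x)).trans (le_of_eq ?_)
  have hi : Integrable (fun x => 2 * β ^ 2 + 2 * m x ^ 2) μ :=
    (integrable_const _).add (hm.integrable_sq.const_mul 2)
  rw [← ofReal_integral_eq_lintegral_ofReal hi
    (Eventually.of_forall fun x => by positivity),
    integral_add (integrable_const _) (hm.integrable_sq.const_mul 2), integral_const,
    probReal_univ, one_smul, integral_const_mul]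

lemma add_sq_le_young {e : ℝ} (he : 0 < e) (p q : ℝ) :
    (p + q) ^ 2 ≤ (1 + e) * p ^ 2 + (1 + 1 / e) * q ^ 2 := by
  have h : 0 ≤ (e * p - q) ^ 2 / e := by positivity
  have h2 : (e * p - q) ^ 2 / e = e * p ^ 2 - 2 * (p * q) + 1 / e * q ^ 2 := by
    field_simp
    ring
  rw [h2] at h
  nlinarith

/-- The truncated prediction, set to `0` outside of the cube. -/
noncomputable def truncPredictor (α β : ℝ) (f : (Fin d → ℝ) → ℝ) (x : Fin d → ℝ) : ℝ :=
  trunc β (f x) * (cube d α).indicator (fun _ => (1 : ℝ)) x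

lemma abs_truncPredictor_le {α β : ℝ} (hβ : 0 ≤ β) (f : (Fin d → ℝ) → ℝ) (x : Fin d → ℝ) :
    |truncPredictor α β f x| ≤ β := by
  have h := indicator_cube_mem (α := α) x
  rw [truncPredictor, abs_mul, abs_of_nonneg h.1]
  exact (mul_le_of_le_one_right (abs_nonneg _) h.2).trans (abs_trunc_le hβ _)

lemma measurable_truncPredictor {α β : ℝ} {f : (Fin d → ℝ) → ℝ} (hf : Measurable f) :
    Measurable (truncPredictor α β f) :=
  ((continuous_trunc β).measurable.comp hf).mul (measurable_const.indicator measurableSet_cube)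

lemma sq_sub_trunc_le {b : ℝ} (hb : 0 ≤ b) (y : ℝ) : (y - trunc b y) ^ 2 ≤ y ^ 2 := by
  have h0 : trunc b 0 = 0 := trunc_eq_self (by simpa using hb)
  have h1 := abs_trunc_sub_trunc_le b y 0
  rw [h0, sub_zero, sub_zero] at h1
  have h2 : 0 ≤ y * trunc b y := by
    rcases le_total 0 y with hy | hy
    · exact mul_nonneg hy (le_max_of_le_right (le_min hb hy))
    · exact mul_nonneg_of_nonpos_of_nonpos hy (max_le (by linarith) ((min_le_right _ _).trans hy))
  have h3 : |trunc b y| ^ 2 ≤ |y| * |trunc b y| := by nlinarith [abs_nonneg (trunc b y)]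
  rw [sq_abs, ← abs_mul, abs_of_nonneg h2] at h3
  nlinarith

variable {ν : Measure ((Fin d → ℝ) × ℝ)} [IsProbabilityMeasure ν]

/-- The price for truncating the response, and for the inputs outside of the cube. -/
lemma integral_truncPredictor_le {α β b e : ℝ} (he : 0 < e) (hb : 0 ≤ b) (hbβ : b ≤ β)
    {f : (Fin d → ℝ) → ℝ} (hf : Measurable f)
    (hν : Integrable (fun z : (Fin d → ℝ) × ℝ => z.2 ^ 2) ν) :
    ∫ z, (truncPredictor α β f z.1 - z.2) ^ 2 ∂ν
      ≤ (1 + e) * ∫ z, truncLoss α β b f z ∂ν + (1 + 1 / e) * ∫ z, (z.2 - trunc b z.2) ^ 2 ∂ν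
        + ∫ z, (cube d α)ᶜ.indicator (fun _ => (1 : ℝ)) z.1 * z.2 ^ 2 ∂ν := by
  have hi1 : Integrable (truncLoss α β b f) ν :=
    Integrable.of_bound (measurable_truncLoss hf).aestronglyMeasurable (4 * β ^ 2)
      (Eventually.of_forall fun z => by
        have := truncLoss_mem (α := α) (f := f) hb hbβ z
        rw [Real.norm_of_nonneg this.1]; exact this.2)
  have hi2 : Integrable (fun z : (Fin d → ℝ) × ℝ => (z.2 - trunc b z.2) ^ 2) ν :=
    hν.mono' ((measurable_snd.sub ((continuous_trunc b).measurable.comp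
      measurable_snd)).pow_const 2).aestronglyMeasurable (Eventually.of_forall fun z => by
        rw [Real.norm_of_nonneg (sq_nonneg _)]; exact sq_sub_trunc_le hb _)
  have hi3 : Integrable (fun z : (Fin d → ℝ) × ℝ =>
      (cube d α)ᶜ.indicator (fun _ => (1 : ℝ)) z.1 * z.2 ^ 2) ν :=
    hν.mono' (((measurable_const.indicator measurableSet_cube.compl).comp measurable_fst).mul
      (measurable_snd.pow_const 2)).aestronglyMeasurable (Eventually.of_forall fun z => by
        rw [norm_mul, Real.norm_of_nonneg (sq_nonneg z.2)]
        by_cases hz : z.1 ∈ cube d α <;> simp [hz, sq_nonneg])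
  have hi4 : Integrable (fun z : (Fin d → ℝ) × ℝ => (1 + e) * truncLoss α β b f z
      + (1 + 1 / e) * (z.2 - trunc b z.2) ^ 2) ν := (hi1.const_mul _).add (hi2.const_mul _)
  rw [← integral_const_mul, ← integral_const_mul, ← integral_add (hi1.const_mul _) (hi2.const_mul _),
    ← integral_add hi4 hi3]
  refine integral_mono_of_nonneg (Eventually.of_forall fun z => sq_nonneg _)
    (hi4.add hi3) (Eventually.of_forall fun z => ?_)
  by_cases hz : z.1 ∈ cube d α
  · simp only [truncPredictor, truncLoss, Set.indicator_of_mem hz, mul_one,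
      Set.indicator_of_notMem (Set.notMem_compl_iff.2 hz), zero_mul, add_zero]
    have := add_sq_le_young he (trunc β (f z.1) - trunc b z.2) (trunc b z.2 - z.2)
    have h2 : (trunc b z.2 - z.2) ^ 2 = (z.2 - trunc b z.2) ^ 2 := by ring
    rw [sub_add_sub_cancel, h2] at this
    exact this
  · simp only [truncPredictor, truncLoss, Set.indicator_of_notMem hz, mul_zero, zero_sub, neg_sq,
      Set.indicator_of_mem (Set.mem_compl hz), one_mul, zero_add]
    have : 0 ≤ (1 + 1 / e) * (z.2 - trunc b z.2) ^ 2 := by positivity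
    linarith

/-- Truncating the network does not increase its distance to truncated responses, so the truncated
empirical loss is controlled by the risk that gradient descent minimises. -/
lemma empirical_truncLoss_le {α β b c₂ e : ℝ} (he : 0 < e) (hb : 0 ≤ b) (hbβ : b ≤ β) (hc₂ : 0 ≤ c₂)
    (data : Fin n → (Fin d → ℝ) × ℝ) (w : Weights d L r K) :
    1 / (n : ℝ) * ∑ i, truncLoss α β b (network w) (data i)
      ≤ (1 + e) * risk c₂ α data w
        + (1 + 1 / e) * (1 / (n : ℝ) * ∑ i, ((data i).2 - trunc b (data i).2) ^ 2) := by
  have h1 : ∀ i, truncLoss α β b (network w) (data i)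
      ≤ (1 + e) * (|network w (data i).1 - (data i).2| ^ 2
          * (cube d α).indicator (fun _ => (1 : ℝ)) (data i).1)
        + (1 + 1 / e) * ((data i).2 - trunc b (data i).2) ^ 2 := by
    intro i
    have hind := indicator_cube_mem (α := α) (data i).1
    set t := (cube d α).indicator (fun _ => (1 : ℝ)) (data i).1
    have h2 := abs_trunc_sub_le (β := β) (z := network w (data i).1)
      ((abs_trunc_le hb (data i).2).trans hbβ)
    have h3 := add_sq_le_young he (network w (data i).1 - (data i).2)
      ((data i).2 - trunc b (data i).2)
    rw [sub_add_sub_cancel] at h3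
    have h4 := sq_le_sq.2 h2
    have h5 : 0 ≤ (1 + 1 / e) * ((data i).2 - trunc b (data i).2) ^ 2 := by positivity
    rw [truncLoss, sq_abs]
    have h6 := mul_le_mul_of_nonneg_right (h4.trans h3) hind.1
    rw [add_mul] at h6
    have h7 := mul_le_of_le_one_right h5 hind.2
    linarith
  have h2 : 1 / (n : ℝ) * ∑ i, truncLoss α β b (network w) (data i)
      ≤ 1 / (n : ℝ) * ∑ i, ((1 + e) * (|network w (data i).1 - (data i).2| ^ 2
          * (cube d α).indicator (fun _ => (1 : ℝ)) (data i).1)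
        + (1 + 1 / e) * ((data i).2 - trunc b (data i).2) ^ 2) := by
    gcongr with i _; exact h1 i
  rw [Finset.sum_add_distrib, ← Finset.mul_sum, ← Finset.mul_sum] at h2
  have h3 : 0 ≤ (1 + e) * (c₂ * ∑ κ, |outerWeight w κ| ^ 2) := by positivity
  unfold risk
  linarith

/-- The risk of a network that is close to `h` on a cube, and not too far away elsewhere. -/
lemma risk_le_of_approx {α α₀ a s c₂ e : ℝ} (he : 0 < e) {h : (Fin d → ℝ) → ℝ}
    (data : Fin n → (Fin d → ℝ) × ℝ) {w : Weights d L r K} (ha : ∀ x, |network w x - h x| ≤ a)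
    (hs : ∀ x ∈ cube d α₀, |network w x - h x| ≤ s) :
    risk c₂ α data w ≤ 1 / (n : ℝ) * ∑ i, ((1 + e) * (h (data i).1 - (data i).2) ^ 2
        + (1 + 1 / e) * (s ^ 2 + a ^ 2 * (cube d α₀)ᶜ.indicator (fun _ => (1 : ℝ)) (data i).1))
      + c₂ * ∑ κ, outerWeight w κ ^ 2 := by
  unfold risk
  simp only [sq_abs]
  gcongr with i _
  have hind := indicator_cube_mem (α := α) (data i).1
  refine (mul_le_of_le_one_right (sq_nonneg _) hind.2).trans ?_
  have h1 := add_sq_le_young he (h (data i).1 - (data i).2) (network w (data i).1 - h (data i).1)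
  rw [add_comm (h (data i).1 - (data i).2), sub_add_sub_cancel] at h1
  refine h1.trans ?_
  gcongr
  by_cases hx : (data i).1 ∈ cube d α₀
  · rw [Set.indicator_of_notMem (Set.notMem_compl_iff.2 hx), mul_zero, add_zero]
    have := hs _ hx
    rw [← sq_abs]
    gcongr
  · rw [Set.indicator_of_mem (Set.mem_compl hx), mul_one, ← sq_abs]
    have : |network w (data i).1 - h (data i).1| ^ 2 ≤ a ^ 2 := by gcongr; exact ha _
    nlinarith [sq_nonneg s]

/-- Integration over the good event, where the error is at most `U - V` for a function `U` of mean
at most `V + θ`, and over the bad event, where it is at most `C`. The error `err` and the event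
`Bad` need not be measurable. -/
lemma lintegral_error_le {err : Ω → ENNReal} {U : Ω → ℝ} {V θ C : ℝ} {Bad : Set Ω} (hV : 0 ≤ V)
    (hθ : 0 ≤ θ) (hU : Integrable U P) (hU0 : ∀ ω, 0 ≤ U ω) (hEU : ∫ ω, U ω ∂P ≤ V + θ)
    (hgood : ∀ ω, ω ∉ Bad → err ω + ENNReal.ofReal V ≤ ENNReal.ofReal (U ω))
    (hbad : ∀ ω, err ω ≤ ENNReal.ofReal C) :
    ∫⁻ ω, err ω ∂P ≤ ENNReal.ofReal θ + (ENNReal.ofReal V + ENNReal.ofReal C) * P Bad := by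
  set A := toMeasurable P Bad with hA
  have hAm : MeasurableSet A := measurableSet_toMeasurable _ _
  have hPA : P A = P Bad := measure_toMeasurable _
  have h1 : ∫⁻ ω in A, err ω ∂P ≤ ENNReal.ofReal C * P A := by
    refine (lintegral_mono fun ω => hbad ω).trans (le_of_eq ?_)
    simp
  have h2 : ∫⁻ ω in Aᶜ, err ω ∂P + ENNReal.ofReal V * P Aᶜ ≤ ENNReal.ofReal (V + θ) := by
    have h3 : ∫⁻ ω in Aᶜ, (err ω + ENNReal.ofReal V) ∂P
        = ∫⁻ ω in Aᶜ, err ω ∂P + ENNReal.ofReal V * P Aᶜ := by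
      rw [lintegral_add_right _ measurable_const]
      simp
    rw [← h3]
    calc ∫⁻ ω in Aᶜ, (err ω + ENNReal.ofReal V) ∂P
        ≤ ∫⁻ ω in Aᶜ, ENNReal.ofReal (U ω) ∂P :=
          setLIntegral_mono_ae' hAm.compl (Eventually.of_forall fun ω hω =>
            hgood ω fun h => hω (subset_toMeasurable P Bad h))
      _ ≤ ∫⁻ ω, ENNReal.ofReal (U ω) ∂P := setLIntegral_le_lintegral _ _
      _ = ENNReal.ofReal (∫ ω, U ω ∂P) :=
          (ofReal_integral_eq_lintegral_ofReal hU (Eventually.of_forall hU0)).symm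
      _ ≤ _ := ENNReal.ofReal_le_ofReal hEU
  have h4 : ENNReal.ofReal V * P A + ENNReal.ofReal V * P Aᶜ = ENNReal.ofReal V := by
    rw [← mul_add, prob_add_prob_compl hAm, mul_one]
  have h5 : ∫⁻ ω in Aᶜ, err ω ∂P ≤ ENNReal.ofReal θ + ENNReal.ofReal V * P A := by
    have h6 : ∫⁻ ω in Aᶜ, err ω ∂P + ENNReal.ofReal V
        ≤ ENNReal.ofReal θ + ENNReal.ofReal V * P A + ENNReal.ofReal V := by
      calc ∫⁻ ω in Aᶜ, err ω ∂P + ENNReal.ofReal V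
          = (∫⁻ ω in Aᶜ, err ω ∂P + ENNReal.ofReal V * P Aᶜ) + ENNReal.ofReal V * P A := by
            rw [add_assoc, add_comm (ENNReal.ofReal V * P Aᶜ), h4]
        _ ≤ ENNReal.ofReal (V + θ) + ENNReal.ofReal V * P A := by gcongr
        _ = _ := by rw [ENNReal.ofReal_add hV hθ]; ring
    exact (ENNReal.add_le_add_iff_right ENNReal.ofReal_ne_top).1 h6
  rw [← lintegral_add_compl _ hAm, ← hPA]
  calc _ ≤ ENNReal.ofReal C * P A + (ENNReal.ofReal θ + ENNReal.ofReal V * P A) := add_le_add h1 h5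
    _ = _ := by ring

end Statistics

/-! ### Growth exponents -/

section Growth

/-- `g` grows at most like `n ^ θ`, up to factors that are smaller than every power of `n`; in
particular logarithmic factors do not count. -/
def GrowthLE (g : ℕ → ℝ) (θ : ℝ) : Prop :=
  ∀ ε > 0, ∀ᶠ n : ℕ in atTop, |g n| ≤ (n : ℝ) ^ (θ + ε)

variable {f g : ℕ → ℝ} {θ θ' : ℝ}

lemma GrowthLE.of_le (hg : GrowthLE g θ) (h : ∀ᶠ n in atTop, |f n| ≤ |g n|) : GrowthLE f θ :=
  fun ε hε => by filter_upwards [hg ε hε, h] with n h1 h2 using h2.trans h1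

lemma GrowthLE.mono (hg : GrowthLE g θ) (h : θ ≤ θ') : GrowthLE g θ' := fun ε hε => by
  filter_upwards [hg ε hε, eventually_ge_atTop 1] with n h1 hn
  exact h1.trans (Real.rpow_le_rpow_of_exponent_le (by exact_mod_cast hn) (by linarith))

lemma GrowthLE.eventually_le (hg : GrowthLE g θ) (h : θ < θ') :
    ∀ᶠ n : ℕ in atTop, |g n| ≤ (n : ℝ) ^ θ' := by
  filter_upwards [hg (θ' - θ) (sub_pos.2 h)] with n hn
  simpa using hn

lemma GrowthLE.tendsto_zero (hg : GrowthLE g θ) (h : θ < 0) : Tendsto g atTop (𝓝 0) := by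
  refine squeeze_zero_norm' (hg.eventually_le (θ' := θ / 2) (by linarith)) ?_
  have h1 : Tendsto (fun x : ℝ => x ^ (-(-(θ / 2)))) atTop (𝓝 0) :=
    tendsto_rpow_neg_atTop (by linarith)
  simp only [neg_neg] at h1
  exact h1.comp tendsto_natCast_atTop_atTop

lemma growthLE_rpow (θ : ℝ) : GrowthLE (fun n => (n : ℝ) ^ θ) θ := fun ε hε => by
  filter_upwards [eventually_ge_atTop 1] with n hn
  rw [abs_of_nonneg (by positivity)]
  exact Real.rpow_le_rpow_of_exponent_le (by exact_mod_cast hn) (by linarith)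

lemma growthLE_const (c : ℝ) : GrowthLE (fun _ => c) 0 := fun ε hε => by
  have := (tendsto_rpow_atTop hε).comp tendsto_natCast_atTop_atTop (α := ℕ)
  filter_upwards [this.eventually_ge_atTop |c|] with n hn
  simpa using hn

lemma growthLE_log : GrowthLE (fun n => Real.log n) 0 := fun ε hε => by
  have := (isLittleO_log_rpow_atTop hε).comp_tendsto (tendsto_natCast_atTop_atTop (R := ℝ))
  filter_upwards [this.def one_pos] with n hn
  simp only [Function.comp, one_mul, Real.norm_eq_abs] at hn
  rwa [zero_add, ← abs_of_nonneg (show 0 ≤ (n : ℝ) ^ ε by positivity)]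

lemma GrowthLE.mul (hf : GrowthLE f θ) (hg : GrowthLE g θ') :
    GrowthLE (fun n => f n * g n) (θ + θ') := fun ε hε => by
  filter_upwards [hf (ε / 2) (half_pos hε), hg (ε / 2) (half_pos hε), eventually_ge_atTop 1]
    with n h1 h2 hn
  rw [abs_mul, show θ + θ' + ε = (θ + ε / 2) + (θ' + ε / 2) by ring,
    Real.rpow_add (by exact_mod_cast hn)]
  gcongr

lemma GrowthLE.const_mul (hg : GrowthLE g θ) (c : ℝ) : GrowthLE (fun n => c * g n) θ := by
  simpa using (growthLE_const c).mul hg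

lemma GrowthLE.add (hf : GrowthLE f θ) (hg : GrowthLE g θ) : GrowthLE (fun n => f n + g n) θ := by
  have h : GrowthLE (fun n => 2 * (n : ℝ) ^ θ) θ := (growthLE_rpow θ).const_mul 2
  intro ε hε
  filter_upwards [hf (ε / 2) (half_pos hε), hg (ε / 2) (half_pos hε),
    (growthLE_const 2).eventually_le (half_pos hε), eventually_ge_atTop 1] with n h1 h2 h3 hn
  rw [show θ + ε = ε / 2 + (θ + ε / 2) by ring, Real.rpow_add (by exact_mod_cast hn)]
  have h4 : 0 ≤ (n : ℝ) ^ (θ + ε / 2) := by positivity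
  rw [abs_of_pos two_pos] at h3
  calc |f n + g n| ≤ |f n| + |g n| := abs_add_le _ _
    _ ≤ 2 * (n : ℝ) ^ (θ + ε / 2) := by linarith
    _ ≤ _ := by gcongr

lemma GrowthLE.add_const (hf : GrowthLE f θ) (h : 0 ≤ θ) (c : ℝ) :
    GrowthLE (fun n => f n + c) θ :=
  hf.add ((growthLE_const c).mono h)

lemma GrowthLE.pow (hf : GrowthLE f θ) (k : ℕ) : GrowthLE (fun n => f n ^ k) (k * θ) := by
  induction k with
  | zero => simpa using growthLE_const 1
  | succ k ih =>
    have := ih.mul hf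
    simp only [pow_succ]
    convert this using 1
    push_cast
    ring

lemma GrowthLE.sqrt (hf : GrowthLE f 0) : GrowthLE (fun n => √(f n)) 0 := by
  refine (((hf.of_le (f := fun n => |f n|) (by simp)).add_const le_rfl 1)).of_le
    (Eventually.of_forall fun n => ?_)
  have h0 := abs_nonneg (f n)
  rw [abs_of_nonneg (Real.sqrt_nonneg _), abs_of_nonneg (by positivity)]
  rw [Real.sqrt_le_left (by positivity)]
  nlinarith [le_abs_self (f n)]

lemma GrowthLE.log (hf : GrowthLE f θ) (h1 : ∀ᶠ n in atTop, 1 ≤ f n) :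
    GrowthLE (fun n => Real.log (f n)) 0 := by
  refine (growthLE_log.const_mul (θ + 1)).of_le ?_
  filter_upwards [hf.eventually_le (θ' := θ + 1) (by linarith), h1, eventually_ge_atTop 1]
    with n h2 h3 hn
  have hn' : (0 : ℝ) < n := by exact_mod_cast hn
  rw [abs_of_nonneg (Real.log_nonneg h3), ← Real.log_rpow hn']
  refine le_trans (Real.log_le_log (by linarith) ?_) (le_abs_self _)
  rwa [abs_of_nonneg (by linarith)] at h2

end Growth

/-! ### The parameters of the estimate -/

section Parameters

/-- The distance that gradient descent can move the weights while the mean squared response is at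
most `(log n) ^ 3`; the step size times the number of steps is at most `c₄ * log n + 1`. -/
noncomputable def moveBound (c₄ : ℝ) (n : ℕ) : ℝ := √(2 * (c₄ * Real.log n + 1) * Real.log n ^ 3)

/-- The bound for the norm of the outer weights that the regularisation enforces while the risk is
at most `(log n) ^ 3`, with some room for an additional vector of norm at most `1`. -/
noncomputable def outerBound (c₂ : ℝ) (n : ℕ) : ℝ := √(2 * (Real.log n ^ 3 / c₂) + 2)

/-- The bound for the input weights along the path of gradient descent. -/
noncomputable def inputBound (c₄ τ : ℝ) (n : ℕ) : ℝ := (n : ℝ) ^ τ + moveBound c₄ n + 1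

/-- The bound for the hidden weights along the path of gradient descent. -/
noncomputable def hiddenBound (d : ℕ) (c₄ : ℝ) (n : ℕ) : ℝ :=
  20 * (d : ℝ) * Real.log n ^ 2 + moveBound c₄ n + 1

lemma growthLE_log_pow (k : ℕ) : GrowthLE (fun n => Real.log n ^ k) 0 := by
  simpa using growthLE_log.pow k

lemma growthLE_moveBound (c₄ : ℝ) : GrowthLE (moveBound c₄) 0 := by
  refine GrowthLE.sqrt ?_
  simpa using (((growthLE_log.const_mul c₄).add_const le_rfl 1).const_mul 2).mul (growthLE_log_pow 3)

lemma growthLE_outerBound (c₂ : ℝ) : GrowthLE (outerBound c₂) 0 := by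
  refine GrowthLE.sqrt ?_
  have := (((growthLE_log_pow 3).const_mul c₂⁻¹).const_mul 2).add_const le_rfl 2
  simpa only [div_eq_inv_mul] using this

lemma growthLE_hiddenBound (d : ℕ) (c₄ : ℝ) : GrowthLE (hiddenBound d c₄) 0 :=
  (((growthLE_log_pow 2).const_mul _).add (growthLE_moveBound c₄)).add_const le_rfl 1

lemma growthLE_inputBound (c₄ : ℝ) {τ : ℝ} (hτ : 0 ≤ τ) : GrowthLE (inputBound c₄ τ) τ :=
  ((growthLE_rpow τ).add ((growthLE_moveBound c₄).mono hτ)).add_const hτ 1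

lemma moveBound_nonneg (c₄ : ℝ) (n : ℕ) : 0 ≤ moveBound c₄ n := Real.sqrt_nonneg _

lemma one_le_inputBound (c₄ τ : ℝ) (n : ℕ) : 1 ≤ inputBound c₄ τ n := by
  have := moveBound_nonneg c₄ n
  have : 0 ≤ (n : ℝ) ^ τ := by positivity
  unfold inputBound
  linarith

lemma one_le_hiddenBound (d : ℕ) (c₄ : ℝ) (n : ℕ) : 1 ≤ hiddenBound d c₄ n := by
  have := moveBound_nonneg c₄ n
  have : 0 ≤ 20 * (d : ℝ) * Real.log n ^ 2 := by positivity
  unfold hiddenBound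
  linarith

lemma growthLE_netScale (d L r : ℕ) (S c₁ c₄ : ℝ) {τ : ℝ} (hτ : 0 ≤ τ) :
    GrowthLE (fun n => netScale d L r S (c₁ * Real.log n) (inputBound c₄ τ n) (hiddenBound d c₄ n))
      τ := by
  have h1 := (((growthLE_inputBound c₄ hτ).const_mul (d + 1)).mul
    (growthLE_log.const_mul c₁)).const_mul 2
  have h2 := (((((growthLE_hiddenBound d c₄).const_mul (r + 1)).mul
    (growthLE_const S))).const_mul 2).pow (L - 1)
  have := h1.mul h2
  simpa [netScale] using this

lemma tendsto_log_natCast : Tendsto (fun n : ℕ => Real.log n) atTop atTop :=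
  Real.tendsto_log_atTop.comp tendsto_natCast_atTop_atTop

variable {K : ℕ → ℕ} {r : ℕ} {κ τ : ℝ}

lemma growthLE_of_upper
    (hK_upper : Tendsto (fun n : ℕ => (K n : ℝ) / (n : ℝ) ^ κ) atTop (𝓝 0)) :
    GrowthLE (fun n => (K n : ℝ)) κ := by
  refine (growthLE_rpow κ).of_le ?_
  filter_upwards [hK_upper.eventually_le_const one_pos, eventually_ge_atTop 1] with n h1 hn
  have hn' : (0 : ℝ) < n := by exact_mod_cast hn
  rw [div_le_one (by positivity)] at h1
  rw [abs_of_nonneg (Nat.cast_nonneg _), abs_of_nonneg (by positivity)]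
  exact h1

lemma eventually_pow_le_of_lower
    (hK_lower : Tendsto (fun n : ℕ => (K n : ℝ) / ((n : ℝ) ^ r * Real.log n)) atTop atTop) :
    ∀ᶠ n : ℕ in atTop, (n : ℝ) ^ r ≤ K n := by
  filter_upwards [hK_lower.eventually_ge_atTop 1, tendsto_log_natCast.eventually_ge_atTop 1,
    eventually_ge_atTop 1] with n h1 h2 hn
  have hn' : (0 : ℝ) < n := by exact_mod_cast hn
  rw [le_div_iff₀ (by positivity), one_mul] at h1
  exact le_trans (le_mul_of_one_le_right (by positivity) h2) h1

/-- The step size `1 / L_n` is smaller than the inverse of the smoothness constant: the latter grows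
like `K_n * n ^ (2 * τ)`, where `2 * τ < 1` and `n ≤ √K_n`. -/
lemma eventually_smoothConst_le {d L : ℕ} {Ln : ℕ → ℝ} (S c₁ c₂ c₄ : ℝ) (hc₂ : 0 < c₂)
    (hr : 2 ≤ r) (hτ : 0 ≤ τ) (hτ2 : 2 * τ < 1)
    (hK_lower : Tendsto (fun n : ℕ => (K n : ℝ) / ((n : ℝ) ^ r * Real.log n)) atTop atTop)
    (hLn : ∀ n : ℕ, 1 ≤ n → Real.log n ^ (10 * L + 10) * (K n : ℝ) ^ (3 / 2 : ℝ) ≤ Ln n) :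
    ∀ᶠ n : ℕ in atTop, (n : ℝ) ≤ Ln n ∧
      Real.log n ^ 3 + 2 * smoothConst d L r (K n) c₂ S (Real.log n ^ 3) (c₁ * Real.log n)
        (outerBound c₂ n) (inputBound c₄ τ n) (hiddenBound d c₄ n) ≤ Ln n := by
  set U := outerBound c₂
  set Λ := fun n : ℕ =>
    netScale d L r S (c₁ * Real.log n) (inputBound c₄ τ n) (hiddenBound d c₄ n) with hΛ
  have hU := growthLE_outerBound c₂
  have h1 : GrowthLE (fun n => 2 * ((U n + 1) * S) ^ 2 + 2 * Real.log n ^ 3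
      + c₂ * (2 * U n ^ 2 + 2)) 0 := by
    refine GrowthLE.add (GrowthLE.add ?_ ((growthLE_log_pow 3).const_mul 2)) ?_
    · simpa using ((((hU.add_const le_rfl 1).mul (growthLE_const S)).pow 2).const_mul 2)
    · simpa using ((((hU.pow 2).const_mul 2).add_const (by simp) 2).const_mul c₂)
  have h2 : GrowthLE (fun n => (2 * (1 + Λ n)) ^ 2) (2 * τ) := by
    have := (((growthLE_netScale d L r S c₁ c₄ hτ).add_const hτ 1).const_mul 2).pow 2
    simpa [add_comm] using this
  have h3 := ((growthLE_log_pow 3).mono (θ' := 0 + 2 * τ) (by linarith)).add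
    ((h1.mul h2).const_mul 2)
  filter_upwards [h3.eventually_le (θ' := 1) (by linarith), eventually_pow_le_of_lower hK_lower,
    eventually_ge_atTop 1, tendsto_log_natCast.eventually_ge_atTop 1] with n h4 h5 hn hlog
  have hn1 : (1 : ℝ) ≤ n := by exact_mod_cast hn
  have hK2 : (n : ℝ) ^ 2 ≤ K n := (pow_le_pow_right₀ hn1 hr).trans h5
  have hK1 : (1 : ℝ) ≤ K n := le_trans (by nlinarith) hK2
  have hsq : (n : ℝ) ≤ √(K n) := Real.le_sqrt_of_sq_le hK2
  have hpow : (K n : ℝ) ^ (3 / 2 : ℝ) = K n * √(K n) := by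
    rw [Real.sqrt_eq_rpow, show (3 / 2 : ℝ) = 1 + 1 / 2 by norm_num,
      Real.rpow_add (by linarith), Real.rpow_one]
  have hLK : K n * √(K n) ≤ Ln n := by
    rw [← hpow]
    exact le_trans (le_mul_of_one_le_left (by positivity) (one_le_pow₀ hlog)) (hLn n hn)
  have hKn : K n * (n : ℝ) ≤ Ln n := le_trans (by gcongr) hLK
  refine ⟨le_trans (le_mul_of_one_le_left (by linarith) hK1) hKn, le_trans ?_ hKn⟩
  rw [Real.rpow_one] at h4
  have h6 := (le_abs_self _).trans h4
  have hUn : 0 ≤ U n := Real.sqrt_nonneg _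
  have h7 : (2 * (√(K n) * (U n + 1) * S) ^ 2 + 2 * Real.log n ^ 3 + c₂ * (2 * U n ^ 2 + 2))
      ≤ K n * (2 * ((U n + 1) * S) ^ 2 + 2 * Real.log n ^ 3 + c₂ * (2 * U n ^ 2 + 2)) := by
    have h8 : (√(K n) * (U n + 1) * S) ^ 2 = K n * ((U n + 1) * S) ^ 2 := by
      rw [mul_assoc, mul_pow, Real.sq_sqrt (by linarith)]
    rw [h8]
    have h9 : 0 ≤ 2 * Real.log n ^ 3 + c₂ * (2 * U n ^ 2 + 2) := by positivity
    nlinarith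
  have h10 : 0 ≤ Real.log n ^ 3 := by positivity
  calc Real.log n ^ 3 + 2 * smoothConst d L r (K n) c₂ S (Real.log n ^ 3) (c₁ * Real.log n)
        (U n) (inputBound c₄ τ n) (hiddenBound d c₄ n)
      ≤ K n * Real.log n ^ 3 + 2 * ((K n * (2 * ((U n + 1) * S) ^ 2 + 2 * Real.log n ^ 3
          + c₂ * (2 * U n ^ 2 + 2))) * (2 * (1 + Λ n)) ^ 2) := by
        rw [smoothConst]
        gcongr
        exact le_mul_of_one_le_left h10 hK1
    _ = K n * (Real.log n ^ 3 + 2 * ((2 * ((U n + 1) * S) ^ 2 + 2 * Real.log n ^ 3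
          + c₂ * (2 * U n ^ 2 + 2)) * (2 * (1 + Λ n)) ^ 2)) := by ring
    _ ≤ K n * n := by gcongr

/-- The expected number of initial networks close to a given one grows like a positive power of `n`:
the input weights contribute the factor `n ^ (-τ * (d + 1) * r)` to the probability, and
`τ * (d + 1) < 1`. -/
lemma growthLE_inv_closeProb {d L : ℕ} {δ : ℝ}
    (hK_lower : Tendsto (fun n : ℕ => (K n : ℝ) / ((n : ℝ) ^ r * Real.log n)) atTop atTop) :
    GrowthLE (fun n => (K n * closeProb d L r δ ((n : ℝ) ^ τ) (20 * (d : ℝ) * Real.log n ^ 2))⁻¹)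
      (-(r * (1 - τ * (d + 1)))) := by
  have h1 : GrowthLE (fun n => ((K n : ℝ))⁻¹) (-(r : ℝ)) := by
    refine (growthLE_rpow (-(r : ℝ))).of_le ?_
    filter_upwards [eventually_pow_le_of_lower hK_lower, eventually_ge_atTop 1] with n h1 hn
    have hn' : (0 : ℝ) < n := by exact_mod_cast hn
    rw [Real.rpow_neg hn'.le, Real.rpow_natCast, abs_inv, abs_inv, abs_of_nonneg (Nat.cast_nonneg _),
      abs_of_nonneg (by positivity)]
    gcongr
  have h2 := ((growthLE_rpow τ).const_mul δ⁻¹).pow (r * (d + 1))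
  have h3 := (((growthLE_log_pow 2).const_mul (20 * (d : ℝ))).const_mul δ⁻¹).pow
    ((L - 1) * (r * (r + 1)))
  have := h1.mul (h2.mul h3)
  have he : -(r : ℝ) + (((r * (d + 1) : ℕ) : ℝ) * τ + (((L - 1) * (r * (r + 1)) : ℕ) : ℝ) * 0)
      = -(r * (1 - τ * (d + 1))) := by push_cast; ring
  rw [he] at this
  refine this.of_le (Eventually.of_forall fun n => le_of_eq ?_)
  congr 1
  rw [closeProb, mul_inv, mul_inv, ← inv_pow, ← inv_pow, inv_div, inv_div, div_eq_inv_mul,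
    div_eq_inv_mul]

end Parameters

section InputDerivatives

open scoped ContDiff

variable {d L r : ℕ}

/-- Networks with bounded weights as functions of the input. -/
lemma network_jet_input {k K : ℕ} {B X U I H : ℝ} (hB1 : 1 ≤ B)
    (hB : ∀ i ≤ k, ∀ x : ℝ, ‖iteratedFDeriv ℝ i Real.sigmoid x‖ ≤ B) (hI : 1 ≤ I) (hX : 1 ≤ X)
    (hH : 1 ≤ H) (hU : 0 ≤ U) {w : Weights d L r K} (hw : WeightBound w U I H)
    {x : Fin d → ℝ} (hx : x ∈ cube d X) :
    JetBound k (network w) x (√K * U * (k.factorial * B))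
      (1 + netScale d L r (k.factorial * B) X I H) := by
  have := network_jet (E := Fin d → ℝ) (D₀ := 1) (w := fun _ => w) (ξ := fun x => x) (e := x)
    (C := fun κ => |outerWeight w κ|) (A := √K * U)
    hB1 hB hI hX hH zero_le_one (fun _ => contDiff_const) (fun j => contDiff_apply ℝ ℝ j)
    (fun κ => JetBound.const _ zero_le_one le_rfl) (hw.sum_abs_le hU)
    (fun κ i j => JetBound.const _ zero_le_one (hw.input κ i j))
    (fun κ l i j => JetBound.const _ zero_le_one (hw.hidden κ l i j)) (fun j => by
      have h1 : ‖(ContinuousLinearMap.proj j : (Fin d → ℝ) →L[ℝ] ℝ)‖ ≤ X * 1 :=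
        ContinuousLinearMap.opNorm_le_bound _ (by linarith) fun y => by
          have : ‖(ContinuousLinearMap.proj j : (Fin d → ℝ) →L[ℝ] ℝ) y‖ ≤ ‖y‖ := norm_le_pi_norm y j
          nlinarith [norm_nonneg y]
      have := JetBound.affine (k := k) (x := x)
        (ContinuousLinearMap.proj j : (Fin d → ℝ) →L[ℝ] ℝ) 0 (C := X) (D := 1)
        (by simpa using abs_le.2 ⟨hx.1 j, hx.2 j⟩) h1
      simpa using this)
  rwa [one_mul] at this

lemma contDiff_network_input {K : ℕ} (w : Weights d L r K) : ContDiff ℝ ω (network w) :=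
  network_contDiff (E := Fin d → ℝ) (w := fun _ => w) (ξ := fun x => x) (fun _ => contDiff_const)
    fun j => contDiff_apply ℝ ℝ j

end InputDerivatives

section Deviation

variable {d L r : ℕ}

/-- The networks with bounded weights. -/
def networkClass (d L r K : ℕ) (U I H : ℝ) : Set ((Fin d → ℝ) → ℝ) :=
  {f | ∃ w : Weights d L r K, WeightBound w U I H ∧ f = network w}

variable {Ω : Type*} [MeasurableSpace Ω] {P : Measure Ω} [IsProbabilityMeasure P]
  {D : ℕ → Ω → (Fin d → ℝ) × ℝ} {ν : Measure ((Fin d → ℝ) × ℝ)} [IsProbabilityMeasure ν]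

/-- The truncated risks of all networks that gradient descent can reach are simultaneously close to
the empirical ones. The input weights of size `n ^ τ` make the networks vary on the length scale
`n ^ (-τ)`, so that about `n ^ (τ * d)` grid points suffice to encode them, with fixed many
derivatives at each; the number `K` of networks enters only through its logarithm. -/
theorem tendsto_prob_deviation {K : ℕ → ℕ} {κ τ c₁ c₂ c₃ c₄ b ε : ℝ} (hκ : 0 < κ) (hτ : 0 < τ)
    (hτ_lt : τ < 1 / ((d : ℝ) + 1)) (hc₁ : 0 < c₁) (hc₃ : 0 < c₃) (hb : 0 ≤ b) (hε : 0 < ε)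
    (hK_upper : Tendsto (fun n : ℕ => (K n : ℝ) / (n : ℝ) ^ κ) atTop (𝓝 0))
    (hD : ∀ i, Measurable (D i)) (hind : iIndepFun D P) (hlaw : ∀ i, P.map (D i) = ν) :
    Tendsto (fun n : ℕ => ENNReal.ofReal (Real.log n ^ 2) *
      P {ω | ∃ f ∈ networkClass d L r (K n) (outerBound c₂ n) (inputBound c₄ τ n)
          (hiddenBound d c₄ n),
        1 / (n : ℝ) * ∑ i : Fin n, truncLoss (c₁ * Real.log n) (c₃ * Real.log n) b f (D i ω) + ε
          < ∫ z, truncLoss (c₁ * Real.log n) (c₃ * Real.log n) b f z ∂ν}) atTop (𝓝 0) := by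
  -- the grid has width `n ^ (-ρ)` with `τ < ρ < 1 / d`
  set ρ : ℝ := 1 / ((d : ℝ) + 1) with hρ
  have hd1 : (0 : ℝ) < (d : ℝ) + 1 := by positivity
  have hρ0 : 0 < ρ := by positivity
  have hρd : (d : ℝ) * ρ < 1 := by rw [hρ, mul_one_div, div_lt_one hd1]; linarith
  -- with `k` derivatives the error at a grid point is of order `n ^ κ * n ^ (-(ρ - τ) * k)`
  obtain ⟨k, hk⟩ := exists_nat_ge ((κ + 1) / (ρ - τ))
  rw [div_le_iff₀ (by linarith)] at hk
  obtain ⟨B, hB1, hB⟩ := exists_bound_iteratedFDeriv_sigmoid k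
  obtain ⟨N, C, hN, hC, hcode⟩ := exists_jet_code d k
  set S : ℝ := k.factorial * B with hS
  set A : ℕ → ℝ := fun n => √(K n) * outerBound c₂ n * S with hA
  set Λ : ℕ → ℝ := fun n =>
    1 + netScale d L r S (c₁ * Real.log n) (inputBound c₄ τ n) (hiddenBound d c₄ n) with hΛ
  have hAg : GrowthLE A κ := by
    have h1 : GrowthLE (fun n => √(K n : ℝ)) κ := by
      refine (growthLE_of_upper hK_upper).of_le (Eventually.of_forall fun n => ?_)
      rw [abs_of_nonneg (Real.sqrt_nonneg _), abs_of_nonneg (Nat.cast_nonneg _),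
        Real.sqrt_le_left (Nat.cast_nonneg _)]
      exact_mod_cast Nat.le_self_pow two_ne_zero _
    simpa using (h1.mul (growthLE_outerBound c₂)).mul (growthLE_const S)
  have hΛg : GrowthLE Λ τ := by
    have := (growthLE_netScale d L r S c₁ c₄ hτ.le).add_const hτ.le 1
    simpa [hΛ, add_comm] using this
  have hinv : GrowthLE (fun n => ((n : ℝ))⁻¹) (-1) := by
    simpa [Real.rpow_neg_one] using growthLE_rpow (-1)
  have hh : GrowthLE (fun n => ((n : ℝ) ^ ρ)⁻¹) (-ρ) := by
    refine (growthLE_rpow (-ρ)).of_le (Eventually.of_forall fun n => ?_)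
    rw [Real.rpow_neg (Nat.cast_nonneg n)]
  -- the approximation error and the entropy of the code
  set γ : ℕ → ℝ := fun n => k * (n : ℝ)⁻¹ + 2 * A n * (Λ n * ((n : ℝ) ^ ρ)⁻¹) ^ k with hγ
  have hγg : GrowthLE γ (-1) := by
    refine (hinv.const_mul k).add (((hAg.const_mul 2).mul ((hΛg.mul hh).pow k)).mono ?_)
    nlinarith
  set lc : ℕ → ℝ := fun n => N * (2 * (c₁ * Real.log n) / ((n : ℝ) ^ ρ)⁻¹ + 1) ^ d
    * Real.log (2 * (C * (A n * Λ n ^ k) / (n : ℝ)⁻¹) + 5) with hlc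
  have hA0 : ∀ n, 0 ≤ A n := fun n =>
    mul_nonneg (mul_nonneg (Real.sqrt_nonneg _) (Real.sqrt_nonneg _)) (by positivity)
  have hlcg : GrowthLE lc (d * ρ) := by
    have h1 : GrowthLE (fun n : ℕ => 2 * (c₁ * Real.log n) / ((n : ℝ) ^ ρ)⁻¹ + 1) ρ := by
      have := (((growthLE_log.const_mul c₁).const_mul 2).mul (growthLE_rpow ρ))
      rw [zero_add] at this
      simpa only [div_inv_eq_mul] using this.add_const hρ0.le 1
    have h2 : GrowthLE (fun n : ℕ => 2 * (C * (A n * Λ n ^ k) / (n : ℝ)⁻¹) + 5)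
        (κ + k * τ + 1) := by
      have := (((hAg.mul (hΛg.pow k)).const_mul C).mul (growthLE_rpow 1)).const_mul 2
      simp only [Real.rpow_one] at this
      simpa only [div_inv_eq_mul] using this.add_const (by positivity) 5
    have h3 := h2.log (by
      filter_upwards [tendsto_log_natCast.eventually_ge_atTop 0] with n hn
      have hΛ0 : 0 ≤ Λ n := add_nonneg zero_le_one (netScale_nonneg (by positivity) (by positivity)
        (zero_le_one.trans (one_le_inputBound _ _ _)) (zero_le_one.trans (one_le_hiddenBound _ _ _)))
      have := hA0 n
      have : 0 ≤ C * (A n * Λ n ^ k) / (n : ℝ)⁻¹ := by positivity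
      linarith)
    exact (((h1.pow d).const_mul N).mul h3).mono (add_zero _).le
  set β : ℕ → ℝ := fun n => c₃ * Real.log n with hβ
  have hβg : GrowthLE β 0 := growthLE_log.const_mul c₃
  have hγ8 : Tendsto (fun n => 8 * β n * γ n) atTop (𝓝 0) :=
    (((hβg.const_mul 8).mul hγg)).tendsto_zero (by norm_num)
  have hmain : GrowthLE (fun n => lc n * β n ^ 4 * (64 / ε ^ 2)) (d * ρ) := by
    have := (hlcg.mul (hβg.pow 4)).mul (growthLE_const (64 / ε ^ 2))
    simpa using this
  have hfin : GrowthLE (fun n => Real.log n ^ 2 * ((64 / ε ^ 2) * (β n ^ 4 * (n : ℝ)⁻¹))) (-1) := by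
    have := (growthLE_log_pow 2).mul ((((hβg.pow 4).mul hinv)).const_mul (64 / ε ^ 2))
    simpa using this
  have hlim := ENNReal.tendsto_ofReal (hfin.tendsto_zero (by norm_num))
  rw [ENNReal.ofReal_zero] at hlim
  refine tendsto_of_tendsto_of_tendsto_of_le_of_le' tendsto_const_nhds hlim
    (Eventually.of_forall fun _ => bot_le) ?_
  filter_upwards [eventually_ge_atTop 1, hγ8.eventually_le_const (half_pos hε),
    hmain.eventually_le hρd,
    (tendsto_log_natCast.const_mul_atTop hc₁).eventually_ge_atTop 1,
    (tendsto_log_natCast.const_mul_atTop hc₃).eventually_ge_atTop (max b 1)]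
    with n hn h1 h2 h3 h4
  have hn1 : (1 : ℝ) ≤ n := by exact_mod_cast hn
  have hn0 : (0 : ℝ) < n := by linarith
  have hβb : b ≤ β n := (le_max_left _ _).trans h4
  have hβ1 : 1 ≤ β n := (le_max_right _ _).trans h4
  have hS0 : 0 ≤ S := by positivity
  have hns : 0 ≤ netScale d L r S (c₁ * Real.log n) (inputBound c₄ τ n) (hiddenBound d c₄ n) :=
    netScale_nonneg hS0 (by linarith) (zero_le_one.trans (one_le_inputBound _ _ _))
      (zero_le_one.trans (one_le_hiddenBound _ _ _))
  have hΛ1 : 1 ≤ Λ n := by simp only [hΛ]; linarith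
  have hpρ : 1 ≤ (n : ℝ) ^ ρ := Real.one_le_rpow hn1 hρ0.le
  obtain ⟨ι, _, code, hcard, hclose⟩ := hcode (c₁ * Real.log n) (Λ n) (A n) ((n : ℝ) ^ ρ)⁻¹
    (n : ℝ)⁻¹ (by linarith) hΛ1 (hA0 n) (by positivity) (inv_le_one_of_one_le₀ hpρ) (by positivity)
  have hγ0 : 0 ≤ γ n := by
    have := hA0 n
    have : 0 ≤ Λ n := by linarith
    simp only [hγ]; positivity
  have hjet : ∀ w : Weights d L r (K n),
      WeightBound w (outerBound c₂ n) (inputBound c₄ τ n) (hiddenBound d c₄ n) →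
      ∀ x ∈ cube d (c₁ * Real.log n), JetBound k (network w) x (A n) (Λ n) := fun w hw x hx =>
    network_jet_input hB1 hB (one_le_inputBound _ _ _) h3 (one_le_hiddenBound _ _ _)
      (Real.sqrt_nonneg _) hw hx
  have hdev := prob_uniform_deviation_le (α := c₁ * Real.log n) (β := β n) (b := b) (n := n)
    (ε := ε / 2) (γ := γ n)
    (𝓕 := networkClass d L r (K n) (outerBound c₂ n) (inputBound c₄ τ n) (hiddenBound d c₄ n))
    hD hind hlaw hb hβb (by omega) (by positivity) hγ0
    (by rintro f ⟨w, -, rfl⟩; exact (contDiff_network_input w).continuous.measurable) code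
    (by
      rintro f ⟨w, hw, rfl⟩ g ⟨w', hw', rfl⟩ hcc x hx
      exact hclose _ _ (contDiff_network_input w) (contDiff_network_input w') (hjet w hw)
        (hjet w' hw') hcc x hx)
  have hP : P {ω | ∃ f ∈ networkClass d L r (K n) (outerBound c₂ n) (inputBound c₄ τ n)
          (hiddenBound d c₄ n),
        1 / (n : ℝ) * ∑ i : Fin n, truncLoss (c₁ * Real.log n) (β n) b f (D i ω) + ε
          < ∫ z, truncLoss (c₁ * Real.log n) (β n) b f z ∂ν}
      ≤ ENNReal.ofReal ((64 / ε ^ 2) * (β n ^ 4 * (n : ℝ)⁻¹)) := by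
    refine (measure_mono ?_).trans (hdev.trans (ENNReal.ofReal_le_ofReal ?_))
    · rintro ω ⟨f, hf, hω⟩
      exact ⟨f, hf, lt_of_le_of_lt (by linarith) hω⟩
    · -- the entropy is at most half of the exponent `2 * y` in Hoeffding's inequality, and
      -- `exp (-y) ≤ 1 / y`
      set y : ℝ := n * ε ^ 2 / (64 * β n ^ 4) with hy
      have hy0 : 0 < y := by positivity
      have hexp : (n : ℝ) * (ε / 2) ^ 2 / (8 * β n ^ 4) = y + y := by
        rw [hy]; field_simp; ring
      have hlcy : lc n ≤ y := by
        rw [Real.rpow_one] at h2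
        have h5 := (le_abs_self _).trans h2
        rw [hy, le_div_iff₀ (by positivity)]
        have h6 : lc n * β n ^ 4 * (64 / ε ^ 2) * ε ^ 2 ≤ n * ε ^ 2 := by gcongr
        have h7 : lc n * β n ^ 4 * (64 / ε ^ 2) * ε ^ 2 = lc n * (64 * β n ^ 4) := by
          field_simp
        linarith
      calc (Fintype.card ι : ℝ) * Real.exp (-(n * (ε / 2) ^ 2 / (8 * β n ^ 4)))
          ≤ Real.exp y * Real.exp (-(y + y)) := by
            rw [hexp]
            gcongr
            exact (Real.le_exp_log _).trans (Real.exp_le_exp.2 (hcard.trans hlcy))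
        _ = (Real.exp y)⁻¹ := by rw [← Real.exp_add, ← Real.exp_neg]; congr 1; ring
        _ ≤ y⁻¹ := by
            gcongr
            linarith [Real.add_one_le_exp y]
        _ = (64 / ε ^ 2) * (β n ^ 4 * (n : ℝ)⁻¹) := by rw [hy]; field_simp
  rw [ENNReal.ofReal_mul (by positivity)]
  gcongr

end Deviation

/-! ### Comparison with a fixed linear combination of networks -/

section Comparison

variable {d L r K n : ℕ}

/-- A fixed linear combination of networks, with which the estimate is compared. -/
noncomputable def referenceNet {J : ℕ} (a : Fin J → ℝ) (v : Fin J → Weights d L r 1)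
    (x : Fin d → ℝ) : ℝ :=
  ∑ j, a j * subnet (v j) x 0

/-- The loss of `h`, enlarged by the error of imitating `h` with randomly initialised networks:
the imitation is exact up to `a * s` on the cube of size `α₀`, and up to `a` elsewhere. -/
noncomputable def imitationLoss (θ a s α₀ : ℝ) (h : (Fin d → ℝ) → ℝ) (z : (Fin d → ℝ) × ℝ) : ℝ :=
  (1 + θ) * (h z.1 - z.2) ^ 2
    + (1 + 1 / θ) * ((a * s) ^ 2 + a ^ 2 * (cube d α₀)ᶜ.indicator (fun _ => (1 : ℝ)) z.1)

/-- The loss whose sample mean dominates the prediction error of the estimate, up to a small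
constant; `b` is the level at which responses are truncated. -/
noncomputable def comparisonLoss (θ a s α₀ b : ℝ) (h : (Fin d → ℝ) → ℝ) (z : (Fin d → ℝ) × ℝ) : ℝ :=
  (1 + θ) * ((1 + θ) * imitationLoss θ a s α₀ h z + (1 + 1 / θ) * (z.2 - trunc b z.2) ^ 2)

variable {J : ℕ} {a : Fin J → ℝ} {v : Fin J → Weights d L r 1}

lemma continuous_referenceNet : Continuous (referenceNet a v) :=
  continuous_finsetSum _ fun j _ => (continuous_subnet (v j) 0).const_mul (a j)

lemma memLp_referenceNet (μ : Measure (Fin d → ℝ)) [IsFiniteMeasure μ] :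
    MemLp (referenceNet a v) 2 μ :=
  memLp_finsetSum _ fun j _ => (memLp_subnet μ (v j) 0).const_mul (a j)

lemma imitationLoss_nonneg {θ A s α₀ : ℝ} (hθ : 0 < θ) (h : (Fin d → ℝ) → ℝ)
    (z : (Fin d → ℝ) × ℝ) : 0 ≤ imitationLoss θ A s α₀ h z := by
  have : 0 ≤ (cube d α₀)ᶜ.indicator (fun _ => (1 : ℝ)) z.1 :=
    Set.indicator_nonneg (fun _ _ => zero_le_one) _
  unfold imitationLoss
  positivity

lemma comparisonLoss_nonneg {θ A s α₀ b : ℝ} (hθ : 0 < θ) (h : (Fin d → ℝ) → ℝ)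
    (z : (Fin d → ℝ) × ℝ) : 0 ≤ comparisonLoss θ A s α₀ b h z := by
  have := imitationLoss_nonneg (A := A) (s := s) (α₀ := α₀) hθ h z
  unfold comparisonLoss
  positivity

/-- On the event that the initial weights contain many approximate copies of each component of the
reference network, gradient descent reaches a risk that is not much larger than the risk of the
reference network. -/
lemma risk_gradDescent_le {α₀ δ s θ c₁ c₂ c₄ τ B ℓ q : ℝ} (hθ : 0 < θ) (hc₂ : 0 < c₂)
    (hc₄ : 0 < c₄) (hB1 : 1 ≤ B) (hB : ∀ i ≤ 2, ∀ x : ℝ, ‖iteratedFDeriv ℝ i Real.sigmoid x‖ ≤ B)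
    (hδ : 0 < δ)
    (hmod : ∀ (j : Fin J) (w : Weights d L r K) (κ : Fin K), BlockClose w (v j) δ κ →
      ∀ x ∈ cube d α₀, |subnet w x κ - subnet (v j) x 0| ≤ s)
    (hn : 1 ≤ n) (hlog : 1 ≤ Real.log n) (hX : 1 ≤ c₁ * Real.log n) (hnℓ : (n : ℝ) ≤ ℓ)
    (hsm : Real.log n ^ 3 + 2 * smoothConst d L r K c₂ ((2 : ℕ).factorial * B) (Real.log n ^ 3)
      (c₁ * Real.log n) (outerBound c₂ n) (inputBound c₄ τ n) (hiddenBound d c₄ n) ≤ ℓ)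
    (hq : 0 < q) (hqR : moveBound c₄ n ^ 2 ≤ q / 4 * (δ / 2) ^ 2)
    (hcost : c₂ * ((∑ j, |a j|) ^ 2 * (4 / q))
      + ((∑ j, |a j|) ^ 2 * (4 / q) + 2 * (Real.log n ^ 3 / n)) / (2 * (c₄ * Real.log n)) ≤ θ)
    {data : Fin n → (Fin d → ℝ) × ℝ} (hV : 1 / (n : ℝ) * ∑ i, (data i).2 ^ 2 ≤ Real.log n ^ 3)
    {w₀ : Weights d L r K} (h0 : ∀ κ, outerWeight w₀ κ = 0)
    (h0I : ∀ κ i j, |inputWeight w₀ κ i j| ≤ (n : ℝ) ^ τ)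
    (h0H : ∀ κ l i j, |hiddenWeight w₀ κ l i j| ≤ 20 * (d : ℝ) * Real.log n ^ 2)
    (hclose : ∀ j, q / 2 ≤ ({κ | BlockClose w₀ (v j) (δ / 2) κ}.ncard : ℝ)) :
    WeightBound (gradDescent c₂ (c₁ * Real.log n) (1 / ℓ) data w₀ ⌈c₄ * ℓ * Real.log n⌉₊)
        (outerBound c₂ n) (inputBound c₄ τ n) (hiddenBound d c₄ n) ∧
      risk c₂ (c₁ * Real.log n) data
          (gradDescent c₂ (c₁ * Real.log n) (1 / ℓ) data w₀ ⌈c₄ * ℓ * Real.log n⌉₊)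
        ≤ 1 / (n : ℝ) * ∑ i, imitationLoss θ (∑ j, |a j|) s α₀ (referenceNet a v) (data i) + θ := by
  have hn1 : (1 : ℝ) ≤ n := by exact_mod_cast hn
  have hℓ1 : 1 ≤ ℓ := hn1.trans hnℓ
  have hℓ0 : 0 < ℓ := by linarith
  set T := ⌈c₄ * ℓ * Real.log n⌉₊ with hT
  -- the number of steps times the step size is of the order of `log n`
  have hT0 : 0 < T := Nat.ceil_pos.2 (by positivity)
  have hT1 : c₄ * Real.log n ≤ 1 / ℓ * T := by
    have := Nat.le_ceil (c₄ * ℓ * Real.log n)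
    rw [one_div, ← div_eq_inv_mul, le_div_iff₀ hℓ0]
    linarith
  have hT2 : 1 / ℓ * T ≤ c₄ * Real.log n + 1 := by
    have := (Nat.ceil_lt_add_one (show 0 ≤ c₄ * ℓ * Real.log n by positivity)).le
    rw [one_div, ← div_eq_inv_mul, div_le_iff₀ hℓ0]
    linarith
  have hR2 : moveBound c₄ n ^ 2 = 2 * (c₄ * Real.log n + 1) * Real.log n ^ 3 :=
    Real.sq_sqrt (by positivity)
  obtain ⟨hbound, hmove, hreg⟩ := gradDescent_analysis (lam := 1 / ℓ) (R := moveBound c₄ n) (T := T)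
    (I := inputBound c₄ τ n) (H := hiddenBound d c₄ n) (U := outerBound c₂ n)
    (α := c₁ * Real.log n) hc₂ hB1 hB (by positivity) (by positivity) (moveBound_nonneg _ _) le_rfl
    le_rfl hX le_rfl (Real.sqrt_nonneg _) (by rw [outerBound, Real.sq_sqrt (by positivity)]) hV h0
    h0I h0H (by positivity) hT0
    (by rw [one_div, ← div_eq_inv_mul, div_le_one hℓ0]; exact hsm)
    (by rw [hR2]; gcongr)
  obtain ⟨u, hu, hclose'⟩ := exists_reference_weights (a := a) (T := T)
    (w := gradDescent c₂ (c₁ * Real.log n) (1 / ℓ) data w₀) hδ hq hmod hclose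
    (hmove (δ / 2) (half_pos hδ)) hqR
  refine ⟨hbound T le_rfl, ?_⟩
  refine (hreg u (1 / (n : ℝ) * ∑ i, imitationLoss θ (∑ j, |a j|) s α₀ (referenceNet a v) (data i)
    + c₂ * ∑ κ, u κ ^ 2) fun t ht => ?_).trans ?_
  · exact risk_le_of_approx (w := replaceOuter _ u) hθ data (fun x => (hclose' t ht.le x).1)
      fun x hx => (hclose' t ht.le x).2 hx
  · have h1 : c₂ * ∑ κ, u κ ^ 2 ≤ c₂ * ((∑ j, |a j|) ^ 2 * (4 / q)) := by gcongr
    have h2 : (∑ κ, u κ ^ 2 + 2 * (1 / ℓ) * Real.log n ^ 3) / (2 * (1 / ℓ * T))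
        ≤ ((∑ j, |a j|) ^ 2 * (4 / q) + 2 * (Real.log n ^ 3 / n)) / (2 * (c₄ * Real.log n)) := by
      have h3 : 2 * (1 / ℓ) * Real.log n ^ 3 = 2 * (Real.log n ^ 3 / ℓ) := by ring
      rw [h3]
      gcongr
    linarith

variable {ν : Measure ((Fin d → ℝ) × ℝ)}

/-- The prediction error of the truncated network in terms of its risk, when the network generalises
well. -/
lemma integral_truncPredictor_le_comparisonLoss [IsProbabilityMeasure ν]
    {α β b θ A s α₀ c₂ : ℝ} {h : (Fin d → ℝ) → ℝ}
    (hθ : 0 < θ) (hθ1 : θ ≤ 1) (hb : 0 ≤ b) (hbβ : b ≤ β) (hc₂ : 0 ≤ c₂)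
    (hν : Integrable (fun z : (Fin d → ℝ) × ℝ => z.2 ^ 2) ν)
    (htr : (1 + 1 / θ) * ∫ z, (z.2 - trunc b z.2) ^ 2 ∂ν ≤ θ)
    (hout : ∫ z, (cube d α)ᶜ.indicator (fun _ => (1 : ℝ)) z.1 * z.2 ^ 2 ∂ν ≤ θ)
    {data : Fin n → (Fin d → ℝ) × ℝ} {w : Weights d L r K}
    (hdev : ∫ z, truncLoss α β b (network w) z ∂ν
      ≤ 1 / (n : ℝ) * ∑ i, truncLoss α β b (network w) (data i) + θ)
    (hrisk : risk c₂ α data w ≤ 1 / (n : ℝ) * ∑ i, imitationLoss θ A s α₀ h (data i) + θ) :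
    ∫ z, (truncPredictor α β (network w) z.1 - z.2) ^ 2 ∂ν
      ≤ 1 / (n : ℝ) * ∑ i, comparisonLoss θ A s α₀ b h (data i) + 8 * θ := by
  have hmeas : Measurable (network w) := (contDiff_network_input w).continuous.measurable
  have h1 := integral_truncPredictor_le (α := α) hθ hb hbβ hmeas hν
  have h2 := empirical_truncLoss_le (α := α) hθ hb hbβ hc₂ data w
  have h3 : 1 / (n : ℝ) * ∑ i, comparisonLoss θ A s α₀ b h (data i)
      = (1 + θ) * ((1 + θ) * (1 / (n : ℝ) * ∑ i, imitationLoss θ A s α₀ h (data i))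
        + (1 + 1 / θ) * (1 / (n : ℝ) * ∑ i, ((data i).2 - trunc b (data i).2) ^ 2)) := by
    simp only [comparisonLoss]
    rw [← Finset.mul_sum, Finset.sum_add_distrib, ← Finset.mul_sum, ← Finset.mul_sum]
    ring
  rw [h3]
  have h4 : (1 + θ) * ∫ z, truncLoss α β b (network w) z ∂ν
      ≤ (1 + θ) * ((1 + θ) * (1 / (n : ℝ) * ∑ i, imitationLoss θ A s α₀ h (data i) + θ)
        + (1 + 1 / θ) * (1 / (n : ℝ) * ∑ i, ((data i).2 - trunc b (data i).2) ^ 2) + θ) := by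
    gcongr
    refine hdev.trans (add_le_add_left (h2.trans ?_) _)
    gcongr
  have h5 : (1 + θ) * θ + (1 + θ) ^ 2 * θ ≤ 6 * θ := by
    have : (1 + θ) + (1 + θ) ^ 2 ≤ 6 := by nlinarith
    nlinarith
  linarith

lemma tendsto_integral_trunc (hν : Integrable (fun z : (Fin d → ℝ) × ℝ => z.2 ^ 2) ν) :
    Tendsto (fun b : ℕ => ∫ z, (z.2 - trunc (b : ℝ) z.2) ^ 2 ∂ν) atTop (𝓝 0) := by
  have := tendsto_integral_of_dominated_convergence (μ := ν)
    (F := fun (b : ℕ) z => (z.2 - trunc (b : ℝ) z.2) ^ 2) (f := fun _ => 0) (fun z => z.2 ^ 2)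
    (fun b => ((measurable_snd.sub ((continuous_trunc (b : ℝ)).measurable.comp
      measurable_snd)).pow_const 2).aestronglyMeasurable) hν
    (fun b => Eventually.of_forall fun z => by
      rw [Real.norm_of_nonneg (sq_nonneg _)]; exact sq_sub_trunc_le (Nat.cast_nonneg b) _)
    (Eventually.of_forall fun z => tendsto_const_nhds.congr' (by
      filter_upwards [tendsto_natCast_atTop_atTop.eventually_ge_atTop |z.2|] with b hb
      rw [trunc_eq_self hb]; ring))
  simpa using this

lemma tendsto_integral_compl_cube {g : (Fin d → ℝ) × ℝ → ℝ} (hg : Integrable g ν) {α : ℕ → ℝ}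
    (hα : Tendsto α atTop atTop) :
    Tendsto (fun n => ∫ z, (cube d (α n))ᶜ.indicator (fun _ => (1 : ℝ)) z.1 * g z ∂ν) atTop
      (𝓝 0) := by
  have := tendsto_integral_of_dominated_convergence (μ := ν)
    (F := fun n z => (cube d (α n))ᶜ.indicator (fun _ => (1 : ℝ)) z.1 * g z) (f := fun _ => 0)
    (fun z => ‖g z‖)
    (fun n => (((measurable_const.indicator measurableSet_cube.compl).comp
      measurable_fst).aestronglyMeasurable.mul hg.aestronglyMeasurable)) hg.norm
    (fun n => Eventually.of_forall fun z => by
      by_cases hz : z.1 ∈ cube d (α n) <;> simp [hz])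
    (Eventually.of_forall fun z => tendsto_const_nhds.congr' (by
      filter_upwards [hα.eventually_ge_atTop ‖z.1‖] with n hn
      have hz : z.1 ∈ cube d (α n) := by
        have h := fun j => abs_le.1 ((norm_le_pi_norm z.1 j).trans hn)
        exact ⟨fun j => (h j).1, fun j => (h j).2⟩
      simp [hz]))
  simpa using this

/-- The choice of the reference network, and of all quantities that depend on it but not on the
sample size. -/
lemma exists_comparison [IsProbabilityMeasure ν] (hr : 0 < r) (L : ℕ)
    (hν : Integrable (fun z : (Fin d → ℝ) × ℝ => z.2 ^ 2) ν) {m : (Fin d → ℝ) → ℝ}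
    (hm : MemLp m 2 (ν.map Prod.fst)) {θ : ℝ} (hθ : 0 < θ) (hθ1 : θ ≤ 1) :
    ∃ (J : ℕ) (a : Fin J → ℝ) (v : Fin J → Weights d L r 1) (α₀ s b δ : ℝ), 0 ≤ b ∧ 0 < δ ∧
      (∀ (K : ℕ) (j : Fin J) (w : Weights d L r K) (κ : Fin K), BlockClose w (v j) δ κ →
        ∀ x ∈ cube d α₀, |subnet w x κ - subnet (v j) x 0| ≤ s) ∧
      ∫ x, (referenceNet a v x - m x) ^ 2 ∂(ν.map Prod.fst) ≤ θ ∧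
      (1 + 1 / θ) * ((∑ j, |a j|) * s) ^ 2 ≤ θ ∧
      (1 + 1 / θ) * ((∑ j, |a j|) ^ 2
        * ∫ z, (cube d α₀)ᶜ.indicator (fun _ => (1 : ℝ)) z.1 * 1 ∂ν) ≤ θ ∧
      (1 + 1 / θ) * ∫ z, (z.2 - trunc b z.2) ^ 2 ∂ν ≤ θ := by
  have : IsProbabilityMeasure (ν.map Prod.fst) :=
    Measure.isProbabilityMeasure_map measurable_fst.aemeasurable
  obtain ⟨J, a, v, hav⟩ := exists_subnet_combination_approx hr (ν.map Prod.fst) L hm hθ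
  set A := ∑ j, |a j| with hA
  have hA0 : 0 ≤ A := Finset.sum_nonneg fun _ _ => abs_nonneg _
  obtain ⟨b, hb⟩ := (((tendsto_integral_trunc hν).const_mul (1 + 1 / θ)).eventually_le_const
    (by simpa using hθ)).exists
  obtain ⟨i, hi⟩ := ((((tendsto_integral_compl_cube (ν := ν) (integrable_const (1 : ℝ))
    tendsto_natCast_atTop_atTop).const_mul (A ^ 2)).const_mul (1 + 1 / θ)).eventually_le_const
    (by simpa using hθ)).exists
  have hs : 0 < θ / (2 * (A + 1)) := by positivity
  choose δ hδ hδm using fun j => exists_blockClose_modulus (v j) (i : ℝ) hs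
  obtain ⟨δ₀, hδ₀, hle⟩ : ∃ δ₀ > 0, ∀ j, δ₀ ≤ δ j := by
    rcases isEmpty_or_nonempty (Fin J) with h | h
    · exact ⟨1, one_pos, fun j => h.elim j⟩
    · obtain ⟨j₀, hj₀⟩ := Finite.exists_min δ
      exact ⟨δ j₀, hδ j₀, hj₀⟩
  refine ⟨J, a, v, i, θ / (2 * (A + 1)), b, δ₀, Nat.cast_nonneg b, hδ₀, fun K j w κ hw => ?_, hav, ?_,
    hi, hb⟩
  · exact hδm j K w κ fun c => (hw c).trans (hle j)
  · have h1 : A * (θ / (2 * (A + 1))) ≤ θ / 2 := by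
      rw [mul_div_left_comm, div_eq_mul_inv θ 2]
      refine mul_le_mul_of_nonneg_left ?_ hθ.le
      rw [div_le_iff₀ (by positivity)]
      linarith
    have h2 : 0 ≤ A * (θ / (2 * (A + 1))) := by positivity
    calc (1 + 1 / θ) * (A * (θ / (2 * (A + 1)))) ^ 2 ≤ (1 + 1 / θ) * (θ / 2) ^ 2 := by gcongr
      _ = (θ + 1) * θ / 4 := by field_simp; ring
      _ ≤ θ := by nlinarith

lemma integrable_comparisonLoss [IsProbabilityMeasure ν]
    (hν : Integrable (fun z : (Fin d → ℝ) × ℝ => z.2 ^ 2) ν) {θ A s α₀ b : ℝ} (hb : 0 ≤ b)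
    {h : (Fin d → ℝ) → ℝ} (hh : Integrable (fun z => (h z.1 - z.2) ^ 2) ν) :
    Integrable (comparisonLoss θ A s α₀ b h) ν ∧
      ∫ z, comparisonLoss θ A s α₀ b h z ∂ν
        = (1 + θ) * ((1 + θ) * ((1 + θ) * ∫ z, (h z.1 - z.2) ^ 2 ∂ν + (1 + 1 / θ) * ((A * s) ^ 2
            + A ^ 2 * ∫ z, (cube d α₀)ᶜ.indicator (fun _ => (1 : ℝ)) z.1 * 1 ∂ν))
          + (1 + 1 / θ) * ∫ z, (z.2 - trunc b z.2) ^ 2 ∂ν) := by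
  have hi1 : Integrable (fun z : (Fin d → ℝ) × ℝ => (z.2 - trunc b z.2) ^ 2) ν :=
    hν.mono' ((measurable_snd.sub ((continuous_trunc b).measurable.comp
      measurable_snd)).pow_const 2).aestronglyMeasurable (Eventually.of_forall fun z => by
        rw [Real.norm_of_nonneg (sq_nonneg _)]; exact sq_sub_trunc_le hb _)
  have hi2 : Integrable (fun z : (Fin d → ℝ) × ℝ =>
      (cube d α₀)ᶜ.indicator (fun _ => (1 : ℝ)) z.1) ν :=
    Integrable.of_bound ((measurable_const.indicator measurableSet_cube.compl).comp
      measurable_fst).aestronglyMeasurable 1 (Eventually.of_forall fun z => by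
        by_cases hz : z.1 ∈ cube d α₀ <;> simp [hz])
  have hi3 : Integrable (fun z : (Fin d → ℝ) × ℝ => (1 + 1 / θ) * ((A * s) ^ 2
      + A ^ 2 * (cube d α₀)ᶜ.indicator (fun _ => (1 : ℝ)) z.1)) ν :=
    ((integrable_const _).add (hi2.const_mul _)).const_mul _
  have hi4 : Integrable (imitationLoss θ A s α₀ h) ν := (hh.const_mul (1 + θ)).add hi3
  refine ⟨((hi4.const_mul (1 + θ)).add (hi1.const_mul (1 + 1 / θ))).const_mul (1 + θ), ?_⟩
  simp only [comparisonLoss, mul_one]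
  rw [integral_const_mul, integral_add (hi4.const_mul _) (hi1.const_mul _), integral_const_mul,
    integral_const_mul]
  simp only [imitationLoss]
  rw [integral_add (hh.const_mul _) hi3, integral_const_mul, integral_const_mul,
    integral_add (integrable_const _) (hi2.const_mul _), integral_const_mul, integral_const,
    probReal_univ, one_smul]

end Comparison

/-! ### The exceptional events -/

section Exceptional

variable {d L r : ℕ} {Ω : Type*} [MeasurableSpace Ω] {P : Measure Ω}
  {D : ℕ → Ω → (Fin d → ℝ) × ℝ} {ν : Measure ((Fin d → ℝ) × ℝ)} {K : ℕ → ℕ} {τ : ℝ}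
  {W : (n : ℕ) → Ω → Weights d L r (K n)}

lemma integral_sampleMean (hD : ∀ i, Measurable (D i)) (hlaw : ∀ i, P.map (D i) = ν)
    {g : (Fin d → ℝ) × ℝ → ℝ} (hg : Integrable g ν) {n : ℕ} (hn : 1 ≤ n) :
    Integrable (fun ω => 1 / (n : ℝ) * ∑ i : Fin n, g (D i ω)) P ∧
      ∫ ω, 1 / (n : ℝ) * ∑ i : Fin n, g (D i ω) ∂P = ∫ z, g z ∂ν := by
  have hi : ∀ i, Integrable (fun ω => g (D i ω)) P := fun i => by
    rw [← hlaw i] at hg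
    exact hg.comp_measurable (hD i)
  have hE : ∀ i, ∫ ω, g (D i ω) ∂P = ∫ z, g z ∂ν := fun i => by
    have h := hg.aestronglyMeasurable
    rw [← hlaw i] at h ⊢
    exact (integral_map (hD i).aemeasurable h).symm
  refine ⟨(integrable_finsetSum _ fun (i : Fin n) _ => hi i).const_mul _, ?_⟩
  rw [integral_const_mul, integral_finsetSum _ fun (i : Fin n) _ => hi i]
  have hn' : (n : ℝ) ≠ 0 := by exact_mod_cast (by omega : n ≠ 0)
  simp only [hE, Finset.sum_const, Finset.card_univ, Fintype.card_fin, nsmul_eq_mul]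
  field_simp

/-- Markov's inequality: the mean squared response exceeds `(log n) ^ 3` with probability
`O((log n) ^ (-3))`. -/
lemma tendsto_prob_large_response [IsProbabilityMeasure P] (hD : ∀ i, Measurable (D i))
    (hlaw : ∀ i, P.map (D i) = ν) (hν : Integrable (fun z : (Fin d → ℝ) × ℝ => z.2 ^ 2) ν) :
    Tendsto (fun n : ℕ => ENNReal.ofReal (Real.log n ^ 2) *
      P {ω | Real.log n ^ 3 < 1 / (n : ℝ) * ∑ i : Fin n, (D i ω).2 ^ 2}) atTop (𝓝 0) := by
  have hlim := ENNReal.tendsto_ofReal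
    (tendsto_log_natCast.const_div_atTop (∫ z, z.2 ^ 2 ∂ν))
  rw [ENNReal.ofReal_zero] at hlim
  refine tendsto_of_tendsto_of_tendsto_of_le_of_le' tendsto_const_nhds hlim
    (Eventually.of_forall fun _ => bot_le) ?_
  filter_upwards [eventually_ge_atTop 1, tendsto_log_natCast.eventually_ge_atTop 1] with n hn hlog
  obtain ⟨hi, hE⟩ := integral_sampleMean hD hlaw hν hn
  have h1 := mul_meas_ge_le_integral_of_nonneg
    (Eventually.of_forall fun ω => by
      show 0 ≤ 1 / (n : ℝ) * ∑ i : Fin n, (D i ω).2 ^ 2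
      positivity) hi (Real.log n ^ 3)
  rw [hE] at h1
  have h2 : P {ω | Real.log n ^ 3 < 1 / (n : ℝ) * ∑ i : Fin n, (D i ω).2 ^ 2}
      ≤ ENNReal.ofReal (P.real {ω | Real.log n ^ 3 ≤ 1 / (n : ℝ) * ∑ i : Fin n, (D i ω).2 ^ 2}) := by
    rw [ofReal_measureReal]
    refine measure_mono fun ω hω => ?_
    simp only [Set.mem_ofPred_eq] at hω ⊢
    exact hω.le
  refine (mul_le_mul_right h2 _).trans ?_
  rw [← ENNReal.ofReal_mul (by positivity)]
  refine ENNReal.ofReal_le_ofReal ?_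
  rw [le_div_iff₀ (by linarith)]
  linarith [show Real.log n ^ 2 * P.real {ω | Real.log n ^ 3 ≤ 1 / (n : ℝ) *
    ∑ i : Fin n, (D i ω).2 ^ 2} * Real.log n = Real.log n ^ 3 * P.real {ω | Real.log n ^ 3 ≤
      1 / (n : ℝ) * ∑ i : Fin n, (D i ω).2 ^ 2} by ring]

/-- The expected number of initial networks that are `δ`-close to a given one. -/
noncomputable def closeCount (d L r : ℕ) (K : ℕ → ℕ) (τ δ : ℝ) (n : ℕ) : ℝ :=
  K n * closeProb d L r δ ((n : ℝ) ^ τ) (20 * (d : ℝ) * Real.log n ^ 2)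

lemma eventually_closeCount_pos (hd : 1 ≤ d) {δ : ℝ} (hδ : 0 < δ)
    (hK_lower : Tendsto (fun n : ℕ => (K n : ℝ) / ((n : ℝ) ^ r * Real.log n)) atTop atTop) :
    ∀ᶠ n in atTop, 0 < closeCount d L r K τ δ n := by
  filter_upwards [eventually_pow_le_of_lower hK_lower, eventually_ge_atTop 1,
    tendsto_log_natCast.eventually_ge_atTop 1] with n h1 hn hlog
  have hn' : (0 : ℝ) < n := by exact_mod_cast hn
  have hd' : (0 : ℝ) < d := by exact_mod_cast hd
  have hK : (0 : ℝ) < K n := lt_of_lt_of_le (by positivity) h1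
  unfold closeCount closeProb
  positivity

lemma tendsto_mul_inv_closeCount (hr : 0 < r) (hτ : τ * ((d : ℝ) + 1) < 1) {g : ℕ → ℝ}
    (hg : GrowthLE g 0) (δ : ℝ)
    (hK_lower : Tendsto (fun n : ℕ => (K n : ℝ) / ((n : ℝ) ^ r * Real.log n)) atTop atTop) :
    Tendsto (fun n => g n * (closeCount d L r K τ δ n)⁻¹) atTop (𝓝 0) := by
  refine (hg.mul (growthLE_inv_closeProb (d := d) (L := L) (τ := τ) (δ := δ)
    hK_lower)).tendsto_zero ?_
  have hr' : (0 : ℝ) < r := by exact_mod_cast hr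
  nlinarith

lemma tendsto_prob_few_blockClose [IsProbabilityMeasure P] (hd : 1 ≤ d) (hr : 0 < r) (hτ0 : 0 < τ)
    (hτ : τ * ((d : ℝ) + 1) < 1) {δ : ℝ} (hδ : 0 < δ)
    (hK_lower : Tendsto (fun n : ℕ => (K n : ℝ) / ((n : ℝ) ^ r * Real.log n)) atTop atTop)
    (hW : ∀ n : ℕ, 2 ≤ n → IsRandomInit P n τ (W n)) (v : Weights d L r 1) :
    Tendsto (fun n : ℕ => ENNReal.ofReal (Real.log n ^ 2) *
      P {ω | ({κ | BlockClose (W n ω) v δ κ}.ncard : ℝ) < closeCount d L r K τ δ n / 2})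
      atTop (𝓝 0) := by
  have hlim := ENNReal.tendsto_ofReal (tendsto_mul_inv_closeCount (L := L) hr hτ
    ((growthLE_log_pow 2).const_mul 4) δ hK_lower)
  rw [ENNReal.ofReal_zero] at hlim
  refine tendsto_of_tendsto_of_tendsto_of_le_of_le' tendsto_const_nhds hlim
    (Eventually.of_forall fun _ => bot_le) ?_
  have hd' : (0 : ℝ) < d := by exact_mod_cast hd
  have hpow : Tendsto (fun n : ℕ => (n : ℝ) ^ τ) atTop atTop :=
    (tendsto_rpow_atTop hτ0).comp tendsto_natCast_atTop_atTop
  have hlog : Tendsto (fun n : ℕ => 20 * (d : ℝ) * Real.log n ^ 2) atTop atTop :=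
    ((tendsto_pow_atTop two_ne_zero).comp tendsto_log_natCast).const_mul_atTop (by positivity)
  filter_upwards [eventually_all.2 fun b => hpow.eventually_ge_atTop
      (|v (blockIndex 0 (Sum.inl b))| + δ),
    eventually_all.2 fun b => hlog.eventually_ge_atTop (|v (blockIndex 0 (Sum.inr b))| + δ),
    eventually_closeCount_pos hd hδ hK_lower, eventually_ge_atTop 2] with n h1 h2 h3 hn
  refine (mul_le_mul_right (prob_few_blockClose_le (hW n hn) hδ h1 h2 h3 rfl) _).trans ?_
  rw [← ENNReal.ofReal_mul (by positivity)]
  refine ENNReal.ofReal_le_ofReal (le_of_eq ?_)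
  rw [div_eq_mul_inv]
  ring

lemma IsRandomInit.ae_abs_le {n K : ℕ} {W : Ω → Weights d L r K} (hW : IsRandomInit P n τ W)
    (hd : 1 ≤ d) (hn : 2 ≤ n) :
    ∀ᵐ ω ∂P, (∀ κ i j, |inputWeight (W ω) κ i j| ≤ (n : ℝ) ^ τ) ∧
      ∀ κ l i j, |hiddenWeight (W ω) κ l i j| ≤ 20 * (d : ℝ) * Real.log n ^ 2 := by
  have hd' : (0 : ℝ) < d := by exact_mod_cast hd
  have hlog : 0 < Real.log n := Real.log_pos (by exact_mod_cast hn)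
  have hn' : (0 : ℝ) < n := by exact_mod_cast (by omega : 0 < n)
  simp only [eventually_and, eventually_all]
  exact ⟨fun κ i j => IsUniform_ae_abs_le (by positivity) (hW.input κ i j),
    fun κ l i j => IsUniform_ae_abs_le (by positivity) (hW.hidden κ l i j)⟩

end Exceptional

end ParallelNet

/-! ### Universal consistency -/

open ParallelNet

theorem theorem1
    (d L r : ℕ) (hd : 1 ≤ d) (hL : 2 ≤ L) (hr : 2 * d ≤ r)
    (c₁ c₂ c₃ c₄ : ℝ) (hc₁ : 0 < c₁) (hc₂ : 0 < c₂) (hc₃ : 0 < c₃) (hc₄ : 0 < c₄)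
    (τ : ℝ) (hτ_pos : 0 < τ) (hτ_lt : τ < 1 / ((d : ℝ) + 1))
    (K : ℕ → ℕ) (κ : ℝ) (hκ : 0 < κ)
    (hK_upper : Tendsto (fun n : ℕ => (K n : ℝ) / (n : ℝ) ^ κ) atTop (𝓝 0))
    (hK_lower : Tendsto (fun n : ℕ => (K n : ℝ) / ((n : ℝ) ^ r * Real.log n)) atTop atTop)
    (Ln : ℕ → ℝ) (hLn_pos : ∀ n : ℕ, 1 ≤ n → 0 < Ln n)
    (hLn : ∀ n : ℕ, 1 ≤ n →
      Real.log n ^ (10 * L + 10) * (K n : ℝ) ^ (3 / 2 : ℝ) ≤ Ln n)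
    {Ω : Type*} [MeasurableSpace Ω] (P : Measure Ω) [IsProbabilityMeasure P]
    -- the pair `(X, Y)` with square integrable `Y`, and its regression function `m`
    (X : Ω → Fin d → ℝ) (Y : Ω → ℝ) (hX : Measurable X) (hY : Measurable Y)
    (hY_sq : MemLp Y 2 P)
    (m : (Fin d → ℝ) → ℝ) (hm : Measurable m)
    (hm_reg : (fun ω => m (X ω)) =ᵐ[P] P[Y|MeasurableSpace.comap X inferInstance])
    -- the data
    (D : ℕ → Ω → (Fin d → ℝ) × ℝ)
    (hD : ∀ i, Measurable (D i)) (hD_indep : iIndepFun D P)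
    (hD_ident : ∀ i, IdentDistrib (D i) (fun ω => (X ω, Y ω)) P P)
    -- the random initial weights, independent of the data
    (W : (n : ℕ) → Ω → ParallelNet.Weights d L r (K n))
    (hW : ∀ n : ℕ, 2 ≤ n → ParallelNet.IsRandomInit P n τ (W n))
    (hW_indep : ∀ n : ℕ, 2 ≤ n → IndepFun (W n) (fun ω (i : Fin n) => D i ω) P) :
    Tendsto
      (fun n : ℕ => ∫⁻ ω,
        ParallelNet.l2Error (P.map X)
          (ParallelNet.estimate c₂ (c₁ * Real.log n) (c₃ * Real.log n) (1 / Ln n)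
            ⌈c₄ * Ln n * Real.log n⌉₊ (fun i : Fin n => D i ω) (W n ω))
          m ∂P)
      atTop (𝓝 0) := by
  have hr2 : 2 ≤ r := by omega
  have hd1 : (1 : ℝ) ≤ d := by exact_mod_cast hd
  have hτd : τ * ((d : ℝ) + 1) < 1 := by rwa [lt_div_iff₀ (by positivity)] at hτ_lt
  have hτ2 : 2 * τ < 1 := by nlinarith
  -- the common law of the data
  have hXY : Measurable fun ω => (X ω, Y ω) := hX.prodMk hY
  set ν := P.map fun ω => (X ω, Y ω) with hνdef
  have hνprob : IsProbabilityMeasure ν := Measure.isProbabilityMeasure_map hXY.aemeasurable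
  have hlaw : ∀ i, P.map (D i) = ν := fun i => (hD_ident i).map_eq
  have hfst : ν.map Prod.fst = P.map X := by
    rw [hνdef, Measure.map_map measurable_fst hXY]; rfl
  have hμprob : IsProbabilityMeasure (P.map X) := Measure.isProbabilityMeasure_map hX.aemeasurable
  have hν : Integrable (fun z : (Fin d → ℝ) × ℝ => z.2 ^ 2) ν := by
    rw [hνdef, integrable_map_measure (measurable_snd.pow_const 2).aestronglyMeasurable
      hXY.aemeasurable]
    exact hY_sq.integrable_sq
  have hmL : MemLp m 2 (P.map X) := memLp_regression hX hY_sq hm hm_reg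
  have hsm : ∀ g : (Fin d → ℝ) → ℝ, Measurable g →
      Measurable fun z : (Fin d → ℝ) × ℝ => (g z.1 - z.2) ^ 2 := fun g hg =>
    ((hg.comp measurable_fst).sub measurable_snd).pow_const 2
  have hproj : ∀ g : (Fin d → ℝ) → ℝ, Measurable g → MemLp g 2 (P.map X) →
      ∫ z, (g z.1 - z.2) ^ 2 ∂ν
        = ∫ x, (g x - m x) ^ 2 ∂(P.map X) + ∫ ω, (m (X ω) - Y ω) ^ 2 ∂P := by
    intro g hg hgL
    rw [← integral_sq_error_eq hX hY_sq hm hm_reg hg (hgL.comp_of_map hX.aemeasurable), hνdef,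
      integral_map hXY.aemeasurable (hsm g hg).aestronglyMeasurable]
  set V := ∫ ω, (m (X ω) - Y ω) ^ 2 ∂P with hVdef
  have hV0 : 0 ≤ V := integral_nonneg fun ω => sq_nonneg _
  obtain ⟨B, hB1, hB⟩ := exists_bound_iteratedFDeriv_sigmoid 2
  rw [ENNReal.tendsto_nhds_zero]
  intro ε hε
  -- all errors are measured by `θ`; the constants `7` and `26` collect the contributions of
  -- `comparisonLoss` and of the deviations
  obtain ⟨θ, hθ, hθ1, hθε⟩ : ∃ θ : ℝ, 0 < θ ∧ θ ≤ 1 ∧ ENNReal.ofReal ((7 * V + 26) * θ) ≤ ε / 2 := by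
    have h1 : Tendsto (fun θ : ℝ => ENNReal.ofReal ((7 * V + 26) * θ)) (𝓝[>] 0) (𝓝 0) := by
      have : Continuous fun θ : ℝ => ENNReal.ofReal ((7 * V + 26) * θ) :=
        ENNReal.continuous_ofReal.comp (continuous_const_mul _)
      simpa using (this.tendsto 0).mono_left nhdsWithin_le_nhds
    have h2 := ENNReal.tendsto_nhds_zero.1 h1 (ε / 2) (ENNReal.half_pos hε.ne')
    have h3 : ∀ᶠ θ : ℝ in 𝓝[>] 0, θ ∈ Set.Ioc (0 : ℝ) 1 := Ioc_mem_nhdsGT one_pos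
    obtain ⟨θ, h4, h5⟩ := (h3.and h2).exists
    exact ⟨θ, h4.1, h4.2, h5⟩
  -- the reference network `h`
  obtain ⟨J, a, v, α₀, s, b, δ, hb, hδ, hmod, hha, hhs, hhα, hhb⟩ :=
    exists_comparison (r := r) (by omega) L hν (m := m) (by rwa [hfst]) hθ hθ1
  rw [hfst] at hha
  set A := ∑ j, |a j| with hA
  set h := referenceNet a v with hh
  set q := closeCount d L r K τ (δ / 2) with hq
  have hhmeas : Measurable h := continuous_referenceNet.measurable
  have hhν : Integrable (fun z : (Fin d → ℝ) × ℝ => (h z.1 - z.2) ^ 2) ν := by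
    rw [hνdef, integrable_map_measure (hsm h hhmeas).aestronglyMeasurable hXY.aemeasurable]
    exact (((memLp_referenceNet (P.map X)).comp_of_map hX.aemeasurable).sub hY_sq).integrable_sq
  obtain ⟨hcint, hcE⟩ := integrable_comparisonLoss (θ := θ) (A := A) (s := s) (α₀ := α₀) hν hb hhν
  have hcE' : ∫ z, comparisonLoss θ A s α₀ b h z ∂ν + 8 * θ ≤ V + (7 * V + 26) * θ := by
    rw [hproj h hhmeas (memLp_referenceNet _)] at hcE
    have h1 : ∫ z, comparisonLoss θ A s α₀ b h z ∂ν
        ≤ (1 + θ) * ((1 + θ) * ((1 + θ) * (θ + V) + (θ + θ)) + θ) := by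
      rw [hcE]
      gcongr
      rw [mul_add]
      exact add_le_add hhs hhα
    have h2 : (1 + θ) ^ 3 ≤ 1 + 7 * θ := by nlinarith [mul_nonneg hθ.le (sub_nonneg.2 hθ1)]
    have h3 := mul_le_mul_of_nonneg_right h2 (show 0 ≤ θ + V by linarith)
    nlinarith [mul_nonneg hθ.le (sub_nonneg.2 hθ1)]
  -- the exceptional events: weights outside of their ranges, large responses, few initial networks
  -- close to a component of `h`, and large deviations
  set Bad : ℕ → Set Ω := fun n =>
    {ω | ¬ ((∀ κ i j, |inputWeight (W n ω) κ i j| ≤ (n : ℝ) ^ τ) ∧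
      ∀ κ l i j, |hiddenWeight (W n ω) κ l i j| ≤ 20 * (d : ℝ) * Real.log n ^ 2)} ∪
    {ω | Real.log n ^ 3 < 1 / (n : ℝ) * ∑ i : Fin n, (D i ω).2 ^ 2} ∪
    (⋃ j, {ω | ({κ | BlockClose (W n ω) (v j) (δ / 2) κ}.ncard : ℝ) < q n / 2}) ∪
    {ω | ∃ f ∈ networkClass d L r (K n) (outerBound c₂ n) (inputBound c₄ τ n) (hiddenBound d c₄ n),
        1 / (n : ℝ) * ∑ i : Fin n, truncLoss (c₁ * Real.log n) (c₃ * Real.log n) b f (D i ω) + θ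
          < ∫ z, truncLoss (c₁ * Real.log n) (c₃ * Real.log n) b f z ∂ν} with hBad
  set M : ℝ := V + 2 * c₃ ^ 2 + 2 * ∫ x, m x ^ 2 ∂(P.map X) with hM
  have hbad : Tendsto
      (fun n : ℕ => ENNReal.ofReal M * (ENNReal.ofReal (Real.log n ^ 2) * P (Bad n)))
      atTop (𝓝 0) := by
    have h1 := tendsto_prob_large_response hD hlaw hν
    have h2 := tendsto_finsetSum (Finset.univ : Finset (Fin J)) fun j _ =>
      tendsto_prob_few_blockClose hd (by omega) hτ_pos hτd (half_pos hδ) hK_lower hW (v j)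
    have h3 := tendsto_prob_deviation (L := L) (r := r) (c₂ := c₂) (c₄ := c₄) hκ hτ_pos hτ_lt hc₁ hc₃
      hb hθ hK_upper hD hD_indep hlaw
    have h4 := ENNReal.Tendsto.const_mul (a := ENNReal.ofReal M) ((h1.add h2).add h3)
      (Or.inr ENNReal.ofReal_ne_top)
    simp only [Finset.sum_const_zero, add_zero, mul_zero] at h4
    refine tendsto_of_tendsto_of_tendsto_of_le_of_le' tendsto_const_nhds h4
      (Eventually.of_forall fun _ => bot_le) ?_
    filter_upwards [eventually_ge_atTop 2] with n hn
    refine mul_le_mul_right ?_ _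
    rw [← Finset.mul_sum, ← mul_add, ← mul_add]
    refine mul_le_mul_right ?_ _
    refine (measure_union_le _ _).trans (add_le_add_left ((measure_union_le _ _).trans
      (add_le_add ((measure_union_le _ _).trans (le_of_eq ?_)) (measure_iUnion_fintype_le _ _))) _)
    rw [ae_iff.1 ((hW n hn).ae_abs_le hd hn), zero_add]
  -- the conditions on the sample size
  have hqR : Tendsto (fun n => moveBound c₄ n ^ 2 * (q n)⁻¹) atTop (𝓝 0) :=
    tendsto_mul_inv_closeCount (by omega) hτd (by simpa using (growthLE_moveBound c₄).pow 2) _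
      hK_lower
  have hcost : Tendsto (fun n : ℕ => c₂ * (A ^ 2 * (4 / q n))
      + (A ^ 2 * (4 / q n) + 2 * (Real.log n ^ 3 / n)) / (2 * (c₄ * Real.log n))) atTop (𝓝 0) := by
    have h1 : Tendsto (fun n => A ^ 2 * (4 / q n)) atTop (𝓝 0) := by
      have := (tendsto_mul_inv_closeCount (d := d) (L := L) (K := K) (τ := τ) (by omega) hτd
        (growthLE_const 4) (δ / 2) hK_lower).const_mul (A ^ 2)
      rw [mul_zero] at this
      exact this.congr fun n => by rw [hq, div_eq_mul_inv 4]
    have h2 : Tendsto (fun n : ℕ => Real.log n ^ 3 / n) atTop (𝓝 0) := by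
      have : GrowthLE (fun n : ℕ => ((n : ℝ))⁻¹) (-1) := by
        simpa [Real.rpow_neg_one] using growthLE_rpow (-1)
      simpa only [div_eq_mul_inv] using ((growthLE_log_pow 3).mul this).tendsto_zero (by norm_num)
    have h3 : Tendsto (fun n : ℕ => 2 * (c₄ * Real.log n)) atTop atTop :=
      (tendsto_log_natCast.const_mul_atTop hc₄).const_mul_atTop two_pos
    simpa using (h1.const_mul c₂).add ((h1.add (h2.const_mul 2)).div_atTop h3)
  have hlogc : ∀ c : ℝ, 0 < c → Tendsto (fun n : ℕ => c * Real.log n) atTop atTop := fun c hc =>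
    tendsto_log_natCast.const_mul_atTop hc
  filter_upwards [ENNReal.tendsto_nhds_zero.1 hbad (ε / 2) (ENNReal.half_pos hε.ne'),
    hqR.eventually_le_const (show 0 < (δ / 2) ^ 2 / 4 by positivity), hcost.eventually_le_const hθ,
    eventually_closeCount_pos (L := L) (τ := τ) hd (half_pos hδ) hK_lower,
    eventually_smoothConst_le (d := d) ((2 : ℕ).factorial * B) c₁ c₂ c₄ hc₂ hr2 hτ_pos.le hτ2
      hK_lower hLn,
    (tendsto_integral_compl_cube hν (hlogc c₁ hc₁)).eventually_le_const hθ,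
    (hlogc c₁ hc₁).eventually_ge_atTop 1, (hlogc c₃ hc₃).eventually_ge_atTop b,
    tendsto_log_natCast.eventually_ge_atTop 1, eventually_ge_atTop 2]
    with n hbadn hqRn hcostn hqn hsmn houtn hXn hbn hlogn hn
  obtain ⟨hUi, hUE⟩ := integral_sampleMean hD hlaw hcint (show 1 ≤ n by omega)
  have hmain := lintegral_error_le (P := P) (V := V) (θ := (7 * V + 26) * θ)
    (C := 2 * (c₃ * Real.log n) ^ 2 + 2 * ∫ x, m x ^ 2 ∂(P.map X)) (Bad := Bad n)
    (err := fun ω => l2Error (P.map X) (estimate c₂ (c₁ * Real.log n) (c₃ * Real.log n) (1 / Ln n)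
      ⌈c₄ * Ln n * Real.log n⌉₊ (fun i : Fin n => D i ω) (W n ω)) m)
    (U := fun ω => 1 / (n : ℝ) * ∑ i : Fin n, comparisonLoss θ A s α₀ b h (D i ω) + 8 * θ)
    hV0 (by positivity) (hUi.add (integrable_const _)) (fun ω => ?_) ?_ (fun ω hω => ?_)
    (fun ω => l2Error_le (abs_truncPredictor_le (by positivity) _) hmL)
  · refine hmain.trans ?_
    rw [← ENNReal.add_halves ε]
    refine add_le_add hθε (le_trans ?_ hbadn)
    rw [← mul_assoc]
    gcongr
    have hm0 : 0 ≤ ∫ x, m x ^ 2 ∂(P.map X) := integral_nonneg fun x => sq_nonneg _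
    rw [← ENNReal.ofReal_add hV0 (by positivity), ← ENNReal.ofReal_mul (by positivity)]
    refine ENNReal.ofReal_le_ofReal ?_
    have h1 : 1 ≤ Real.log n ^ 2 := one_le_pow₀ hlogn
    have h2 := le_mul_of_one_le_right (add_nonneg hV0 (mul_nonneg zero_le_two hm0)) h1
    linarith
  · have : 0 ≤ ∑ i : Fin n, comparisonLoss θ A s α₀ b h (D i ω) :=
      Finset.sum_nonneg fun i _ => comparisonLoss_nonneg hθ _ _
    positivity
  · rw [integral_add hUi (integrable_const _), hUE, integral_const, probReal_univ, one_smul]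
    exact hcE'
  · simp only [hBad, Set.mem_union, Set.mem_iUnion, Set.mem_ofPred_eq, not_or, not_not, not_lt,
      not_exists] at hω
    obtain ⟨⟨⟨⟨hωI, hωH⟩, hωY⟩, hωc⟩, hωd⟩ := hω
    -- on the good event: optimisation, generalisation, and orthogonality
    obtain ⟨hwb, hrisk⟩ := risk_gradDescent_le (τ := τ) (ℓ := Ln n) (q := q n) hθ hc₂ hc₄ hB1 hB hδ
      (hmod (K n)) (by omega) hlogn hXn hsmn.1 hsmn.2 hqn
      (by
        rw [← div_eq_mul_inv, div_le_iff₀ hqn] at hqRn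
        linarith) hcostn hωY ((hW n hn).outer ω) hωI hωH hωc
    set w := gradDescent c₂ (c₁ * Real.log n) (1 / Ln n) (fun i : Fin n => D i ω) (W n ω)
      ⌈c₄ * Ln n * Real.log n⌉₊ with hw
    have hdev := not_lt.1 fun hlt => hωd (network w) ⟨⟨w, hwb, rfl⟩, hlt⟩
    have hpred := integral_truncPredictor_le_comparisonLoss hθ hθ1 hb hbn hc₂.le hν hhb houtn hdev
      hrisk
    have hwm : Measurable (truncPredictor (c₁ * Real.log n) (c₃ * Real.log n) (network w)) :=
      measurable_truncPredictor (contDiff_network_input w).continuous.measurable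
    have hwL : MemLp (truncPredictor (c₁ * Real.log n) (c₃ * Real.log n) (network w)) 2 (P.map X) :=
      MemLp.of_bound hwm.aestronglyMeasurable (c₃ * Real.log n)
        (Eventually.of_forall fun x => abs_truncPredictor_le (by positivity) _ x)
    rw [hproj _ hwm hwL] at hpred
    have hl2 := l2Error_eq hwL hmL
    refine le_trans (le_of_eq ?_) (ENNReal.ofReal_le_ofReal hpred)
    rw [ENNReal.ofReal_add (integral_nonneg fun x => sq_nonneg _) hV0, ← hl2]
    rfl
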